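/- **Model.** In the *strictly implicit model*, a priority queue holding $n$ distinct elements of a totally ordered set consists, between operations, only of an array containing these $n$ elements, together with the number $n$. An operation is a fixed (uniform) RAM program with $O(1)$ word registers of $\Theta(\log n)$ bits each and $O(1)$ registers for elements; the usual word operations ($+,-,\cdot,/,\bmod$, bitwise operations, shifts, comparisons) take unit time, and elements can only be copied and compared, at unit cost. A *move* is a write to the array. $\mathrm{Insert}(x)$, for $x$ not present, enlarges the array by one cell, which receives $x$; $\mathrm{ExtractMin}$, on a nonempty array, returns the minimum and the array loses its last cell. **Forests of relaxed binomial trees.** Cells are numbered from $0$. For $0\le k<N:=\lfloor n/3\rfloor$, *node* $k$ consists of the cells $3k,3k+1,3k+2$; the last $n \bmod 3$ cells are a buffer. The *key* of a node is the smallest of its three elements. The order of the three elements encodes one of the states "root", "minimum of its own subtree", "minimum among strictly smaller subtrees" (according to whether the smallest element is in the first, second or third cell). A *binomial tree* of size $1$ is a single node; one of size $2^{i+1}$ arises from two of size $2^i$ by making the root of one the rightmost child of the root of the other. It is laid out in preorder, children being visited in order of increasing size. A *relaxed binomial tree* is a binomial tree whose root is in state "root" and has the smallest key of the tree, and in which every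 non-root node $c_\ell$, the $\ell$-th child of its parent with earlier siblings $c_0,\dots,c_{\ell-1}$, either is in state "minimum of its own subtree" and its key is smallest among all elements of its subtree, or is in state "minimum among strictly smaller subtrees" and its key is smaller than all elements in the subtrees of $c_0,\dots,c_{\ell-1}$. An array of distinct elements *is an RBT forest* if its $N$ nodes are the concatenation of relaxed binomial trees in nonincreasing order of size, with at most five trees of size $2^i$ for each $i\ge 0$. **Theorem.** In the strictly implicit model, for distinct elements, there is a priority queue supporting Insert in worst-case $O(1)$ time (hence $O(1)$ moves) and ExtractMin in worst-case $O(\log n)$ time and moves (read as $O(1+\lfloor\log_2 n\rfloor)$), where $n\geq 1$ is the number of elements before the extraction. Here Insert adds the given element to the stored set, and ExtractMin returns and removes the smallest stored element. The constants and the programs do not depend on the ordered set. Moreover: 1. Every array that arises from the empty array by a sequence of Insert and ExtractMin operations is an RBT forest; in particular, both operations preserve the property that at most five trees of each size $2^i$ exist. 2. The shape of the forest is determined by the array alone. Precisely, for every array that is an RBT forest with $N$ nodes: (a) any two decompositions of it into an RBT forest have the same sequence of tree sizes; (b) for all $i,k\ge 0$, there is a tree of size $2^i$ at nodes $k,\dots,k+2^i-1$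 if and only if node $k$ encodes "root", node $k+2^i$ encodes "root" or $k+2^i=N$, and, if $i\ge 1$, node $k+2^{i-1}$ encodes "not root"; (c) if there is a tree of size $2^i$, then the root of the rightmost such tree is node $N-2^ik-x$ for some $k\in\{1,2,3,4,5\}$, where $x=N\bmod 2^i$; (d) a fixed program that is given $i\le\lfloor\log_2 n\rfloor$ (with $\log_2 0$ read as $0$) computes, in $O(1)$ time and with no moves, the number of trees of size $2^i$ and, if there are any, the position of the leftmost one. -/

import Mathlib

namespace ImplicitPQ

universe u

/-! ## The strictly implicit model

A uniform program for a comparison-based word RAM.  A program mentions only finitely many word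
registers and element registers, so the working memory of an operation is `O(1)` words and `O(1)`
elements.  Elements can only be copied and compared. -/

/-- Unit-cost operations on words. -/
inductive WordOp
  | add | sub | mul | div | mod | and | or | xor | shl | shr

def WordOp.eval : WordOp → ℕ → ℕ → ℕ
  | .add, a, b => a + b
  | .sub, a, b => a - b
  | .mul, a, b => a * b
  | .div, a, b => a / b
  | .mod, a, b => a % b
  | .and, a, b => a &&& b
  | .or, a, b => a ||| b
  | .xor, a, b => a ^^^ b
  | .shl, a, b => a <<< b
  | .shr, a, b => a >>> b

/-- Tests: compare two word registers, or compare the elements in two element registers. -/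
inductive Test
  | wordEq (a b : ℕ)
  | wordLt (a b : ℕ)
  | eltLt (e f : ℕ)

/-- Programs. -/
inductive Prog
  | skip
  /-- word register `d` gets the literal `k` -/
  | const (d k : ℕ)
  /-- word register `d` gets the result of `o` on the word registers `a` and `b` -/
  | op (d : ℕ) (o : WordOp) (a b : ℕ)
  /-- element register `e` gets a copy of element register `f` -/
  | copy (e f : ℕ)
  /-- element register `e` gets the array cell whose index is in word register `a` -/
  | load (e a : ℕ)
  /-- the array cell whose index is in word register `a` gets element register `e` -/
  | store (a e : ℕ)
  | seq (p q : Prog)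
  | ite (b : Test) (p q : Prog)
  | loop (b : Test) (p : Prog)

/-- A machine state: word registers, element registers (initially empty) and the array. -/
structure State (α : Type u) where
  word : ℕ → ℕ
  elt : ℕ → Option α
  arr : List α

def Test.eval {α : Type u} [LinearOrder α] (s : State α) : Test → Option Bool
  | .wordEq a b => some (decide (s.word a = s.word b))
  | .wordLt a b => some (decide (s.word a < s.word b))
  | .eltLt e f =>
    match s.elt e, s.elt f with
    | some x, some y => some (decide (x < y))
    | _, _ => none

/-- `Exec w p s s' t m`: with word size `w`, program `p` started in state `s` halts in state `s'`
after `t` steps, `m` of which are moves, i.e. writes to the array.  There is no execution if a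
word would not fit into `w` bits, if an index is outside the array, or if an empty element
register is used. -/
inductive Exec {α : Type u} [LinearOrder α] (w : ℕ) :
    Prog → State α → State α → ℕ → ℕ → Prop
  | skip (s : State α) : Exec w .skip s s 1 0
  | const (s : State α) (d k : ℕ) (hk : k < 2 ^ w) :
      Exec w (.const d k) s { s with word := Function.update s.word d k } 1 0
  | op (s : State α) (d : ℕ) (o : WordOp) (a b : ℕ)
      (hv : o.eval (s.word a) (s.word b) < 2 ^ w) :
      Exec w (.op d o a b) s
        { s with word := Function.update s.word d (o.eval (s.word a) (s.word b)) } 1 0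
  | copy (s : State α) (e f : ℕ) (x : α) (hx : s.elt f = some x) :
      Exec w (.copy e f) s { s with elt := Function.update s.elt e (some x) } 1 0
  | load (s : State α) (e a : ℕ) (x : α) (hx : s.arr[s.word a]? = some x) :
      Exec w (.load e a) s { s with elt := Function.update s.elt e (some x) } 1 0
  | store (s : State α) (a e : ℕ) (x : α) (ha : s.word a < s.arr.length)
      (hx : s.elt e = some x) :
      Exec w (.store a e) s { s with arr := s.arr.set (s.word a) x } 1 1
  | seq (p q : Prog) (s s' s'' : State α) (t m t' m' : ℕ)
      (hp : Exec w p s s' t m) (hq : Exec w q s' s'' t' m') :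
      Exec w (.seq p q) s s'' (t + t') (m + m')
  | iteTrue (b : Test) (p q : Prog) (s s' : State α) (t m : ℕ)
      (hb : b.eval s = some true) (hp : Exec w p s s' t m) :
      Exec w (.ite b p q) s s' (t + 1) m
  | iteFalse (b : Test) (p q : Prog) (s s' : State α) (t m : ℕ)
      (hb : b.eval s = some false) (hq : Exec w q s s' t m) :
      Exec w (.ite b p q) s s' (t + 1) m
  | loopTrue (b : Test) (p : Prog) (s s' s'' : State α) (t m t' m' : ℕ)
      (hb : b.eval s = some true) (hp : Exec w p s s' t m)
      (hq : Exec w (.loop b p) s' s'' t' m') :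
      Exec w (.loop b p) s s'' (t + t' + 1) (m + m')
  | loopFalse (b : Test) (p : Prog) (s : State α) (hb : b.eval s = some false) :
      Exec w (.loop b p) s s 1 0

/-- The machine is deterministic. -/
theorem Exec.det {α : Type u} [LinearOrder α] {w : ℕ} {p : Prog} {s s₁ s₂ : State α}
    {t₁ m₁ t₂ m₂ : ℕ} (h₁ : Exec w p s s₁ t₁ m₁) (h₂ : Exec w p s s₂ t₂ m₂) :
    s₁ = s₂ ∧ t₁ = t₂ ∧ m₁ = m₂ := by
  induction h₁ generalizing s₂ t₂ m₂ with
  | seq p q s s' s'' t m t' m' hp hq ihp ihq =>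
    cases h₂ with
    | seq _ _ _ u _ _ _ _ _ hp' hq' =>
      obtain ⟨rfl, rfl, rfl⟩ := ihp hp'
      obtain ⟨rfl, rfl, rfl⟩ := ihq hq'
      exact ⟨rfl, rfl, rfl⟩
  | iteTrue b p q s s' t m hb hp ih =>
    cases h₂ with
    | iteTrue _ _ _ _ _ _ _ hb' hp' =>
      obtain ⟨rfl, rfl, rfl⟩ := ih hp'
      exact ⟨rfl, rfl, rfl⟩
    | iteFalse _ _ _ _ _ _ _ hb' hp' => simp [hb] at hb'
  | iteFalse b p q s s' t m hb hp ih =>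
    cases h₂ with
    | iteTrue _ _ _ _ _ _ _ hb' hp' => simp [hb] at hb'
    | iteFalse _ _ _ _ _ _ _ hb' hp' =>
      obtain ⟨rfl, rfl, rfl⟩ := ih hp'
      exact ⟨rfl, rfl, rfl⟩
  | loopTrue b p s s' s'' t m t' m' hb hp hq ihp ihq =>
    cases h₂ with
    | loopTrue _ _ _ u _ _ _ _ _ hb' hp' hq' =>
      obtain ⟨rfl, rfl, rfl⟩ := ihp hp'
      obtain ⟨rfl, rfl, rfl⟩ := ihq hq'
      exact ⟨rfl, rfl, rfl⟩
    | loopFalse _ _ _ hb' => simp [hb] at hb'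
  | loopFalse b p s hb =>
    cases h₂ with
    | loopTrue _ _ _ u _ _ _ _ _ hb' hp' hq' => simp [hb] at hb'
    | loopFalse _ _ _ hb' => exact ⟨rfl, rfl, rfl⟩
  | _ => cases h₂; simp_all

/-- The word size `Θ(log n)` on an array of `n` elements. -/
def wordSize (c n : ℕ) : ℕ := c * (Nat.log 2 n + 1)

/-- The state in which an operation starts: only the array `l`, its length (in word register `0`)
and a word argument (in word register `1`) are available. -/
def initState {α : Type u} (l : List α) (arg : ℕ) : State α where
  word := fun r => if r = 0 then l.length else if r = 1 then arg else 0
  elt := fun _ => none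
  arr := l

/-- Running the program `p` as `Insert(x)` on the array `l` gives the array `l'`: the array grows
by one cell, `x` is written there (one step and one move), and `p` is run. -/
def InsertRun {α : Type u} [LinearOrder α] (c : ℕ) (p : Prog) (l : List α) (x : α) (l' : List α)
    (t m : ℕ) : Prop :=
  ∃ (s : State α) (t₀ m₀ : ℕ),
    Exec (wordSize c (l.length + 1)) p (initState (l ++ [x]) 0) s t₀ m₀ ∧
      s.arr = l' ∧ t = t₀ + 1 ∧ m = m₀ + 1

/-- Running the program `p` as `ExtractMin` on the array `l` returns `x` (in element register `0`)
and, after the last cell has been dropped, leaves the array `l'`. -/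
def ExtractRun {α : Type u} [LinearOrder α] (c : ℕ) (p : Prog) (l : List α) (x : α) (l' : List α)
    (t m : ℕ) : Prop :=
  ∃ s : State α, Exec (wordSize c l.length) p (initState l 0) s t m ∧
    s.elt 0 = some x ∧ s.arr.dropLast = l'

/-- The arrays that arise from the empty one by a sequence of insertions of elements that are not
present and of extractions from nonempty arrays. -/
inductive Reachable {α : Type u} [LinearOrder α] (c : ℕ) (ins ext : Prog) : List α → Prop
  | empty : Reachable c ins ext []
  | insert (l l' : List α) (x : α) (t m : ℕ) (hl : Reachable c ins ext l) (hx : x ∉ l)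
      (h : InsertRun c ins l x l' t m) : Reachable c ins ext l'
  | extract (l l' : List α) (x : α) (t m : ℕ) (hl : Reachable c ins ext l) (hne : l ≠ [])
      (h : ExtractRun c ext l x l' t m) : Reachable c ins ext l'

/-! ## Nodes -/

/-- A node stores three elements in consecutive array cells. -/
abbrev Node (α : Type u) : Type u := α × α × α

/-- The nodes of an array: node `k` consists of the cells `3k`, `3k+1`, `3k+2` (everything is
counted from `0`).  The last `n mod 3` elements are the buffer. -/
def nodes {α : Type u} : List α → List (Node α)
  | a :: b :: c :: l => (a, b, c) :: nodes l
  | _ => []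

def Node.elems {α : Type u} (a : Node α) : List α := [a.1, a.2.1, a.2.2]

/-- The element of a node that takes part in the tree order: the smallest of the three. -/
def Node.key {α : Type u} [LinearOrder α] (a : Node α) : α := min a.1 (min a.2.1 a.2.2)

/-- The states a node can be in: root of a tree, minimum of its own subtree, minimum among the
strictly smaller subtrees (those of its siblings to the left). -/
inductive NodeState
  | isRoot | ownMin | smallerMin

/-- The state is encoded by the order of the three elements, namely by the cell that holds the
smallest one. -/
def Node.state {α : Type u} [LinearOrder α] (a : Node α) : NodeState :=
  if a.1 = Node.key a then .isRoot else if a.2.1 = Node.key a then .ownMin else .smallerMin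

/-! ## Relaxed binomial trees -/

/-- Binomial trees of size `2 ^ i`.  In `link t s` the root of `s` has become the rightmost child
of the root of `t`. -/
inductive BinTree (β : Type u) : ℕ → Type u
  | single (b : β) : BinTree β 0
  | link {i : ℕ} (t s : BinTree β i) : BinTree β (i + 1)

def BinTree.root {β : Type u} : {i : ℕ} → BinTree β i → β
  | _, .single b => b
  | _, .link t _ => t.root

/-- The preorder traversal, children being visited in order of increasing size. -/
def BinTree.preorder {β : Type u} : {i : ℕ} → BinTree β i → List β
  | _, .single b => [b]
  | _, .link t s => t.preorder ++ s.preorder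

/-- The relaxed order at all nodes except the root.  In `link t s` the root of `s` is the child
`c_i` of the root of `t`, and the subtrees of `c_0, …, c_{i-1}` together are `t` without its
root. -/
def BinTree.Relaxed {α : Type u} [LinearOrder α] : {i : ℕ} → BinTree (Node α) i → Prop
  | _, .single _ => True
  | _, .link t s => t.Relaxed ∧ s.Relaxed ∧
      ((s.root.state = .ownMin ∧ ∀ b ∈ s.preorder, ∀ y ∈ b.elems, s.root.key ≤ y) ∨
        (s.root.state = .smallerMin ∧ ∀ b ∈ t.preorder.tail, ∀ y ∈ b.elems, s.root.key ≤ y))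

/-- Relaxed binomial trees. -/
def BinTree.IsRBT {α : Type u} [LinearOrder α] {i : ℕ} (t : BinTree (Node α) i) : Prop :=
  t.Relaxed ∧ t.root.state = .isRoot ∧ ∀ b ∈ t.preorder, ∀ y ∈ b.elems, t.root.key ≤ y

/-! ## Forests -/

/-- The array `l` of distinct elements, without its buffer, is the forest `F` of relaxed binomial
trees, laid out from left to right in nonincreasing order of size, with at most five trees of each
size. -/
structure IsForest {α : Type u} [LinearOrder α] (l : List α)
    (F : List (Σ i, BinTree (Node α) i)) : Prop where
  nodup : l.Nodup
  layout : F.flatMap (fun T => T.2.preorder) = nodes l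
  rbt : ∀ T ∈ F, T.2.IsRBT
  sorted : (F.map Sigma.fst).Pairwise (· ≥ ·)
  five : ∀ i, (F.map Sigma.fst).count i ≤ 5

/-- There is a tree of size `2 ^ i` in `F` that starts at node `k`. -/
def TreeAt {α : Type u} (F : List (Σ i, BinTree (Node α) i)) (i k : ℕ) : Prop :=
  ∃ (F₁ F₂ : List (Σ i, BinTree (Node α) i)) (T : BinTree (Node α) i),
    F = F₁ ++ ⟨i, T⟩ :: F₂ ∧ k = (F₁.map fun S => 2 ^ S.1).sum

/-- Node `k` of the array exists and encodes "root". -/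
def RootAt {α : Type u} [LinearOrder α] (l : List α) (k : ℕ) : Prop :=
  ∃ a, (nodes l)[k]? = some a ∧ a.state = .isRoot

/-- Node `k` of the array exists and encodes "not root". -/
def NonRootAt {α : Type u} [LinearOrder α] (l : List α) (k : ℕ) : Prop :=
  ∃ a, (nodes l)[k]? = some a ∧ a.state ≠ .isRoot

end ImplicitPQ

open ImplicitPQ

namespace ImplicitPQ

universe u

/-! ### Machine layer: costs, compiled word expressions, program logic. -/

section

/-! ## Cost of programs -/

/-! The tree sizes are made a function of the number N of nodes alone. The canonical forest
(`shape`) greedily takes the largest power of two that is at most 2N/3 (or 1, if there is none), so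
every size occurs at most twice, well within the five allowed. Passing from N - 1 to N nodes changes
it in one place only (`shape_increment`, `shape_two_pow`): a tree of size 1 is appended, and if 2^v
is the largest power of two dividing N and N ≠ 2^v, the two trees of size 2^v at the nodes N - 3·2^v
and N - 2·2^v are linked. Since N xor (N - 1) = 2^(v+1) - 1 (`xor_pred`), this place is found with
O(1) word operations. So an insertion takes constant time in the worst case, and the step can be
undone equally fast.

A link moves no subtree. If the left root is smaller, the right root becomes an `ownMin` child.
Otherwise only the two root nodes are exchanged: the old left root is minimal in the left tree, and
the other nodes of that tree are exactly the subtrees of its earlier siblings, so it may be marked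
`smallerMin`. Conversely, the state of the last child tells whether an exchange has to be reverted
(`MinAt.link`, `MinAt.unlink`).

For an extraction, the last node is turned into buffer if the buffer is empty. The minimum is then
in the buffer or the first cell of one of O(log n) trees. In the latter case the root is followed
while its tree is taken apart link by link, until it heads a tree of one node; there a buffer
element replaces the minimum, and the links are redone on the way up. `Path` records that the
subtrees split off are fit for being linked again.

The decoding works for every RBT forest, not only for canonical ones. The states mark exactly the
first nodes of the trees, and a wrong guess of a size is refuted by one of two further states
(`startsAt_iff`). Fewer than 5·2^i nodes follow the trees of size 2^i, of which there are at most
five, so nine candidate positions suffice (`exists_startsAt_iff`).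

Two features of the programs save bookkeeping. Cells are changed by exchanges only, so the stored
set is preserved automatically; and a program without loops takes at most as many steps as its size,
so constant time bounds need no counting. -/

def Prog.size : Prog → ℕ
  | .seq p q => p.size + q.size
  | .ite _ p q => p.size + q.size + 1
  | .loop _ p => p.size + 1
  | _ => 1

def Prog.LoopFree : Prog → Prop
  | .seq p q => p.LoopFree ∧ q.LoopFree
  | .ite _ p q => p.LoopFree ∧ q.LoopFree
  | .loop _ _ => False
  | _ => True

def Prog.StoreFree : Prog → Prop
  | .seq p q => p.StoreFree ∧ q.StoreFree
  | .ite _ p q => p.StoreFree ∧ q.StoreFree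
  | .loop _ p => p.StoreFree
  | .store _ _ => False
  | _ => True

/-- Without loops, every part of the program text is executed at most once. All constant time bounds
come from here. -/
theorem Exec.time_le_size {α : Type u} [LinearOrder α] {w : ℕ} {p : Prog} {s s' : State α}
    {t m : ℕ} (h : Exec w p s s' t m) (hp : p.LoopFree) : t ≤ p.size := by
  induction h with
  | seq p q s s' s'' t m t' m' _ _ ih₁ ih₂ =>
    have := ih₁ hp.1; have := ih₂ hp.2; simp only [Prog.size]; omega
  | iteTrue b p q s s' t m _ _ ih => have := ih hp.1; simp only [Prog.size]; omega
  | iteFalse b p q s s' t m _ _ ih => have := ih hp.2; simp only [Prog.size]; omega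
  | loopTrue => exact hp.elim
  | loopFalse => exact hp.elim
  | _ => simp [Prog.size]

theorem Exec.moves_le_time {α : Type u} [LinearOrder α] {w : ℕ} {p : Prog} {s s' : State α}
    {t m : ℕ} (h : Exec w p s s' t m) : m ≤ t := by
  induction h <;> omega

theorem Exec.moves_eq_zero {α : Type u} [LinearOrder α] {w : ℕ} {p : Prog} {s s' : State α}
    {t m : ℕ} (h : Exec w p s s' t m) (hp : p.StoreFree) : m = 0 := by
  induction h with
  | seq p q s s' s'' t m t' m' _ _ ih₁ ih₂ => simp [ih₁ hp.1, ih₂ hp.2]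
  | iteTrue b p q s s' t m _ _ ih => exact ih hp.1
  | iteFalse b p q s s' t m _ _ ih => exact ih hp.2
  | loopTrue b p s s' s'' t m t' m' _ _ _ ih₁ ih₂ => simp [ih₁ hp, ih₂ hp]
  | store => exact hp.elim
  | _ => rfl

/-! ## Word expressions

Expressions over the word registers below `32`; the registers from `32` on hold intermediate
results. -/

inductive WExp
  | reg (r : ℕ)
  | lit (k : ℕ)
  | bin (o : WordOp) (a b : WExp)

namespace WExp

instance : Add WExp := ⟨.bin .add⟩
instance : Sub WExp := ⟨.bin .sub⟩
instance : Mul WExp := ⟨.bin .mul⟩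
instance : Div WExp := ⟨.bin .div⟩
instance : Mod WExp := ⟨.bin .mod⟩
instance (k : ℕ) : OfNat WExp k := ⟨.lit k⟩

def val (g : ℕ → ℕ) : WExp → ℕ
  | reg r => g r
  | lit k => k
  | bin o a b => o.eval (a.val g) (b.val g)

/-- All intermediate results are below `B`. -/
def Ok (B : ℕ) (g : ℕ → ℕ) : WExp → Prop
  | reg r => r < 32 ∧ g r < B
  | lit k => k < B
  | bin o a b => a.Ok B g ∧ b.Ok B g ∧ o.eval (a.val g) (b.val g) < B

/-- The registers from `d` on serve as a stack. A word is copied by taking the bitwise or with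
itself. -/
def compile : WExp → ℕ → Prog
  | reg r, d => .op d .or r r
  | lit k, d => .const d k
  | bin o a b, d => .seq (a.compile d) (.seq (b.compile (d + 1)) (.op d o d (d + 1)))

variable {B : ℕ} {g : ℕ → ℕ}

@[simp] theorem val_reg (r : ℕ) : (reg r).val g = g r := rfl
@[simp] theorem val_zero : (0 : WExp).val g = 0 := rfl
@[simp] theorem val_one : (1 : WExp).val g = 1 := rfl
@[simp] theorem val_two : (2 : WExp).val g = 2 := rfl
@[simp] theorem val_three : (3 : WExp).val g = 3 := rfl
@[simp] theorem val_add (a b : WExp) : (a + b).val g = a.val g + b.val g := rfl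
@[simp] theorem val_sub (a b : WExp) : (a - b).val g = a.val g - b.val g := rfl
@[simp] theorem val_mul (a b : WExp) : (a * b).val g = a.val g * b.val g := rfl
@[simp] theorem val_div (a b : WExp) : (a / b).val g = a.val g / b.val g := rfl
@[simp] theorem val_mod (a b : WExp) : (a % b).val g = a.val g % b.val g := rfl
@[simp] theorem val_xor (a b : WExp) : (bin .xor a b).val g = a.val g ^^^ b.val g := rfl
@[simp] theorem val_shl (a b : WExp) : (bin .shl a b).val g = a.val g <<< b.val g := rfl

@[simp] theorem ok_reg (r : ℕ) : (reg r).Ok B g ↔ r < 32 ∧ g r < B := Iff.rfl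
@[simp] theorem ok_zero : (0 : WExp).Ok B g ↔ 0 < B := Iff.rfl
@[simp] theorem ok_one : (1 : WExp).Ok B g ↔ 1 < B := Iff.rfl
@[simp] theorem ok_two : (2 : WExp).Ok B g ↔ 2 < B := Iff.rfl
@[simp] theorem ok_three : (3 : WExp).Ok B g ↔ 3 < B := Iff.rfl
@[simp] theorem ok_add (a b : WExp) :
    (a + b).Ok B g ↔ a.Ok B g ∧ b.Ok B g ∧ a.val g + b.val g < B := Iff.rfl
@[simp] theorem ok_mul (a b : WExp) :
    (a * b).Ok B g ↔ a.Ok B g ∧ b.Ok B g ∧ a.val g * b.val g < B := Iff.rfl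
@[simp] theorem ok_shl (a b : WExp) :
    (bin .shl a b).Ok B g ↔ a.Ok B g ∧ b.Ok B g ∧ a.val g <<< b.val g < B := Iff.rfl
@[simp] theorem ok_xor (a b : WExp) :
    (bin .xor a b).Ok B g ↔ a.Ok B g ∧ b.Ok B g ∧ a.val g ^^^ b.val g < B := Iff.rfl

theorem Ok.val_lt {e : WExp} (h : e.Ok B g) : e.val g < B := by
  cases e with
  | reg r => exact h.2
  | lit k => exact h
  | bin o a b => exact h.2.2

-- Truncated subtraction, like division and remainder below, never exceeds its first operand, so no
-- separate overflow condition arises.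
@[simp] theorem ok_sub (a b : WExp) : (a - b).Ok B g ↔ a.Ok B g ∧ b.Ok B g :=
  ⟨fun h => ⟨h.1, h.2.1⟩, fun h => ⟨h.1, h.2, (Nat.sub_le _ _).trans_lt h.1.val_lt⟩⟩
@[simp] theorem ok_div (a b : WExp) : (a / b).Ok B g ↔ a.Ok B g ∧ b.Ok B g :=
  ⟨fun h => ⟨h.1, h.2.1⟩, fun h => ⟨h.1, h.2, (Nat.div_le_self _ _).trans_lt h.1.val_lt⟩⟩
@[simp] theorem ok_mod (a b : WExp) : (a % b).Ok B g ↔ a.Ok B g ∧ b.Ok B g :=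
  ⟨fun h => ⟨h.1, h.2.1⟩, fun h => ⟨h.1, h.2, (Nat.mod_le _ _).trans_lt h.1.val_lt⟩⟩

theorem loopFree_compile (e : WExp) (d : ℕ) : (e.compile d).LoopFree := by
  induction e generalizing d with
  | reg | lit => trivial
  | bin o a b iha ihb => exact ⟨iha _, ihb _, trivial⟩

theorem storeFree_compile (e : WExp) (d : ℕ) : (e.compile d).StoreFree := by
  induction e generalizing d with
  | reg | lit => trivial
  | bin o a b iha ihb => exact ⟨iha _, ihb _, trivial⟩

/-- Preservation of the registers below `d` carries the induction: the left operand, kept in `d`,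
survives the evaluation of the right one from `d + 1` on. -/
theorem exec_compile {α : Type u} [LinearOrder α] {w : ℕ} (e : WExp) {d : ℕ} (hd : 32 ≤ d)
    (s : State α) (hs : ∀ r < 32, s.word r = g r) (he : e.Ok (2 ^ w) g) :
    ∃ s' t m, Exec w (e.compile d) s s' t m ∧ s'.word d = e.val g ∧
      (∀ r < d, s'.word r = s.word r) ∧ s'.elt = s.elt ∧ s'.arr = s.arr := by
  induction e generalizing d s with
  | reg r =>
    have hr : s.word r = g r := hs r he.1
    have hv : WordOp.or.eval (s.word r) (s.word r) = g r := by simp [WordOp.eval, hr]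
    refine ⟨_, _, _, .op s d .or r r (by rw [hv]; exact he.2), ?_, ?_, rfl, rfl⟩
    · simp [hv, val]
    · intro r hr; simp [hr.ne]
  | lit k =>
    refine ⟨_, _, _, .const s d k he, ?_, ?_, rfl, rfl⟩
    · simp [val]
    · intro r hr; simp [hr.ne]
  | bin o a b iha ihb =>
    obtain ⟨s₁, t₁, m₁, h₁, hv₁, hw₁, he₁, ha₁⟩ := iha hd s hs he.1
    obtain ⟨s₂, t₂, m₂, h₂, hv₂, hw₂, he₂, ha₂⟩ := ihb (d := d + 1) (by omega) s₁
      (fun r hr => (hw₁ r (by omega)).trans (hs r hr)) he.2.1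
    have hv₁' : s₂.word d = a.val g := (hw₂ d (by omega)).trans hv₁
    refine ⟨_, _, _, .seq _ _ _ _ _ _ _ _ _ h₁ (.seq _ _ _ _ _ _ _ _ _ h₂
      (.op s₂ d o d (d + 1) (by rw [hv₁', hv₂]; exact he.2.2))), ?_, ?_, ?_, ?_⟩
    · simp [hv₁', hv₂, val]
    · intro r hr; simp [hr.ne, hw₂ r (by omega), hw₁ r hr]
    · simp [he₂, he₁]
    · simp [ha₂, ha₁]

end WExp

/-! ## Commands -/

namespace Prog

def assign (d : ℕ) (e : WExp) : Prog := .seq (e.compile 32) (.op d .or 32 32)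

/-- Exchange the contents of two cells. -/
def swap (a b : WExp) : Prog :=
  .seq (.seq (a.compile 32) (b.compile 33))
    (.seq (.load 0 32) (.seq (.load 1 33) (.seq (.store 32 1) (.store 33 0))))

def ifLt (a b : WExp) (p q : Prog) : Prog :=
  .seq (.seq (a.compile 32) (b.compile 33)) (.ite (.wordLt 32 33) p q)

def ifEq (a b : WExp) (p q : Prog) : Prog :=
  .seq (.seq (a.compile 32) (b.compile 33)) (.ite (.wordEq 32 33) p q)

/-- Branch on the order of the contents of two cells. -/
def ifCell (a b : WExp) (p q : Prog) : Prog :=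
  .seq (.seq (a.compile 32) (b.compile 33))
    (.seq (.load 0 32) (.seq (.load 1 33) (.ite (.eltLt 0 1) p q)))

def whileLt (a b : WExp) (p : Prog) : Prog :=
  .seq (.seq (a.compile 32) (b.compile 33))
    (.loop (.wordLt 32 33) (.seq p (.seq (a.compile 32) (b.compile 33))))

def iterate (p : Prog) : ℕ → Prog
  | 0 => .skip
  | k + 1 => .seq (p.iterate k) p

@[simp] theorem loopFree_skip : Prog.skip.LoopFree := trivial
@[simp] theorem loopFree_seq (p q : Prog) : (seq p q).LoopFree ↔ p.LoopFree ∧ q.LoopFree := Iff.rfl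
@[simp] theorem loopFree_assign (d : ℕ) (e : WExp) : (assign d e).LoopFree :=
  ⟨e.loopFree_compile _, trivial⟩
@[simp] theorem loopFree_swap (a b : WExp) : (swap a b).LoopFree := by
  simp [swap, LoopFree, WExp.loopFree_compile]
@[simp] theorem loopFree_ifLt (a b : WExp) (p q : Prog) :
    (ifLt a b p q).LoopFree ↔ p.LoopFree ∧ q.LoopFree := by
  simp [ifLt, LoopFree, WExp.loopFree_compile]
@[simp] theorem loopFree_ifEq (a b : WExp) (p q : Prog) :
    (ifEq a b p q).LoopFree ↔ p.LoopFree ∧ q.LoopFree := by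
  simp [ifEq, LoopFree, WExp.loopFree_compile]
@[simp] theorem loopFree_ifCell (a b : WExp) (p q : Prog) :
    (ifCell a b p q).LoopFree ↔ p.LoopFree ∧ q.LoopFree := by
  simp [ifCell, LoopFree, WExp.loopFree_compile]
theorem LoopFree.iterate {p : Prog} (hp : p.LoopFree) (k : ℕ) : (p.iterate k).LoopFree := by
  induction k with
  | zero => trivial
  | succ k ih => exact ⟨ih, hp⟩

@[simp] theorem storeFree_skip : Prog.skip.StoreFree := trivial
@[simp] theorem storeFree_seq (p q : Prog) : (seq p q).StoreFree ↔ p.StoreFree ∧ q.StoreFree :=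
  Iff.rfl
@[simp] theorem storeFree_assign (d : ℕ) (e : WExp) : (assign d e).StoreFree :=
  ⟨e.storeFree_compile _, trivial⟩
@[simp] theorem storeFree_ifLt (a b : WExp) (p q : Prog) :
    (ifLt a b p q).StoreFree ↔ p.StoreFree ∧ q.StoreFree := by
  simp [ifLt, StoreFree, WExp.storeFree_compile]
@[simp] theorem storeFree_ifEq (a b : WExp) (p q : Prog) :
    (ifEq a b p q).StoreFree ↔ p.StoreFree ∧ q.StoreFree := by
  simp [ifEq, StoreFree, WExp.storeFree_compile]
@[simp] theorem storeFree_ifCell (a b : WExp) (p q : Prog) :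
    (ifCell a b p q).StoreFree ↔ p.StoreFree ∧ q.StoreFree := by
  simp [ifCell, StoreFree, WExp.storeFree_compile]
theorem StoreFree.iterate {p : Prog} (hp : p.StoreFree) (k : ℕ) : (p.iterate k).StoreFree := by
  induction k with
  | zero => trivial
  | succ k ih => exact ⟨ih, hp⟩

end Prog

/-! ## Program logic -/

variable {α : Type u}

/-- The state `s` has word registers `g` (below `32`) and the array `f 0, …, f (n - 1)`, whose
elements are distinct. -/
structure Rel (n : ℕ) (s : State α) (g : ℕ → ℕ) (f : ℕ → α) : Prop where
  word : ∀ r < 32, s.word r = g r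
  arr : s.arr = (List.range n).map f
  nodup : s.arr.Nodup

variable {w n : ℕ} {p q : Prog} {Q Q' : (ℕ → ℕ) → (ℕ → α) → Prop} {g : ℕ → ℕ} {f : ℕ → α}

theorem Rel.injOn {s : State α} (h : Rel n s g f) : Set.InjOn f (Set.Iio n) := by
  have := h.nodup
  rw [h.arr, List.nodup_map_iff_inj_on List.nodup_range] at this
  intro i hi j hj hij
  exact this i (List.mem_range.2 hi) j (List.mem_range.2 hj) hij

theorem Rel.getElem? {s : State α} (h : Rel n s g f) {i : ℕ} (hi : i < n) :
    s.arr[i]? = some (f i) := by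
  simp [h.arr, hi]

/-- The registers from `32` on do not matter. -/
theorem Rel.congr {s s' : State α} (h : Rel n s g f) (hw : ∀ r < 32, s'.word r = s.word r)
    (ha : s'.arr = s.arr) : Rel n s' g f :=
  ⟨fun r hr => (hw r hr).trans (h.word r hr), ha.trans h.arr, ha ▸ h.nodup⟩

theorem perm_map_range_swap (f : ℕ → α) {i j n : ℕ} (hi : i < n) (hj : j < n) :
    ((List.range n).map (f ∘ Equiv.swap i j)).Perm ((List.range n).map f) := by
  rw [← List.map_map]
  refine List.Perm.map f ?_
  refine (List.perm_ext_iff_of_nodup (List.nodup_range.map (Equiv.injective _))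
    List.nodup_range).2 fun a => ?_
  simp only [List.mem_map, List.mem_range]
  have key : ∀ b, b < n → Equiv.swap i j b < n := fun b hb => by
    rw [Equiv.swap_apply_def]; split_ifs <;> assumption
  exact ⟨by rintro ⟨b, hb, rfl⟩; exact key b hb,
    fun ha => ⟨Equiv.swap i j a, key a ha, Equiv.swap_apply_self i j a⟩⟩

theorem map_range_set_set (f : ℕ → α) {i j n : ℕ} :
    (((List.range n).map f).set i (f j)).set j (f i) =
      (List.range n).map (f ∘ Equiv.swap i j) := by
  refine List.ext_getElem (by simp) fun k hk hk' => ?_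
  simp only [List.getElem_set, List.getElem_map, List.getElem_range, Function.comp,
    Equiv.swap_apply_def]
  grind

variable [LinearOrder α]

/-- Started with registers `g` and cells `f`, the program `p` permutes the cells and halts in at
most `T` steps with `Q`. -/
def WPT (w n : ℕ) (p : Prog) (T : ℕ) (Q : (ℕ → ℕ) → (ℕ → α) → Prop) (g : ℕ → ℕ)
    (f : ℕ → α) : Prop :=
  ∀ s, Rel n s g f → ∃ s' t m g' f', Exec w p s s' t m ∧ t ≤ T ∧ Rel n s' g' f' ∧
    s'.arr.Perm s.arr ∧ Q g' f'

/-- The same without a time bound. -/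
def WP (w n : ℕ) (p : Prog) (Q : (ℕ → ℕ) → (ℕ → α) → Prop) (g : ℕ → ℕ) (f : ℕ → α) : Prop :=
  ∀ s, Rel n s g f → ∃ s' t m g' f', Exec w p s s' t m ∧ Rel n s' g' f' ∧
    s'.arr.Perm s.arr ∧ Q g' f'

theorem WPT.mono {T T' : ℕ} (h : WPT w n p T Q g f) (hT : T ≤ T')
    (hQ : ∀ g' f', Q g' f' → Q' g' f') : WPT w n p T' Q' g f := by
  intro s hs
  obtain ⟨s', t, m, g', f', h₁, h₂, h₃, h₄, h₅⟩ := h s hs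
  exact ⟨s', t, m, g', f', h₁, h₂.trans hT, h₃, h₄, hQ _ _ h₅⟩

theorem WPT.seq {T₁ T₂ : ℕ} (h : WPT w n p T₁ (fun g f => WPT w n q T₂ Q g f) g f) :
    WPT w n (.seq p q) (T₁ + T₂) Q g f := by
  intro s hs
  obtain ⟨s', t, m, g', f', h₁, h₂, h₃, h₄, h₅⟩ := h s hs
  obtain ⟨s'', t', m', g'', f'', k₁, k₂, k₃, k₄, k₅⟩ := h₅ s' h₃
  exact ⟨s'', _, _, g'', f'', .seq _ _ _ _ _ _ _ _ _ h₁ k₁, by omega, k₃, k₄.trans h₄, k₅⟩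

theorem WP.timed (h : WP w n p Q g f) (hp : p.LoopFree) : WPT w n p p.size Q g f := by
  intro s hs
  obtain ⟨s', t, m, g', f', h₁, h₃, h₄, h₅⟩ := h s hs
  exact ⟨s', t, m, g', f', h₁, h₁.time_le_size hp, h₃, h₄, h₅⟩

/-- Makes the distinctness of the elements available inside a correctness proof, where a weak
comparison has to be turned into a strict one. -/
theorem WP.of_injOn (h : Set.InjOn f (Set.Iio n) → WP w n p Q g f) : WP w n p Q g f :=
  fun s hs => h hs.injOn s hs

theorem WP.mono (h : WP w n p Q g f) (hQ : ∀ g' f', Q g' f' → Q' g' f') : WP w n p Q' g f := by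
  intro s hs
  obtain ⟨s', t, m, g', f', h₁, h₃, h₄, h₅⟩ := h s hs
  exact ⟨s', t, m, g', f', h₁, h₃, h₄, hQ _ _ h₅⟩

theorem WP.skip (h : Q g f) : WP w n .skip Q g f :=
  fun s hs => ⟨s, _, _, g, f, .skip s, hs, .refl _, h⟩

theorem WP.seq (h : WP w n p (fun g f => WP w n q Q g f) g f) : WP w n (.seq p q) Q g f := by
  intro s hs
  obtain ⟨s', t, m, g', f', h₁, h₃, h₄, h₅⟩ := h s hs
  obtain ⟨s'', t', m', g'', f'', k₁, k₃, k₄, k₅⟩ := h₅ s' h₃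
  exact ⟨s'', _, _, g'', f'', .seq _ _ _ _ _ _ _ _ _ h₁ k₁, k₃, k₄.trans h₄, k₅⟩

theorem exec_compile_pair {a b : WExp} {s : State α} (hs : Rel n s g f) (ha : a.Ok (2 ^ w) g)
    (hb : b.Ok (2 ^ w) g) :
    ∃ s' t m, Exec w (.seq (a.compile 32) (b.compile 33)) s s' t m ∧ s'.word 32 = a.val g ∧
      s'.word 33 = b.val g ∧ Rel n s' g f ∧ s'.arr = s.arr := by
  obtain ⟨s₁, t₁, m₁, h₁, hv₁, hw₁, he₁, ha₁⟩ := a.exec_compile (d := 32) (by omega) s hs.word ha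
  have hs₁ := hs.congr hw₁ ha₁
  obtain ⟨s₂, t₂, m₂, h₂, hv₂, hw₂, he₂, ha₂⟩ := b.exec_compile (d := 33) (by omega) s₁ hs₁.word hb
  exact ⟨s₂, _, _, .seq _ _ _ _ _ _ _ _ _ h₁ h₂, (hw₂ 32 (by omega)).trans hv₁, hv₂,
    hs₁.congr (fun r hr => hw₂ r (by omega)) ha₂, ha₂.trans ha₁⟩

theorem WP.assign {d : ℕ} {e : WExp} (hd : d < 32) (he : e.Ok (2 ^ w) g)
    (h : Q (Function.update g d (e.val g)) f) : WP w n (.assign d e) Q g f := by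
  intro s hs
  obtain ⟨s₁, t₁, m₁, h₁, hv₁, hw₁, he₁, ha₁⟩ := e.exec_compile (d := 32) le_rfl s hs.word he
  have hv : WordOp.or.eval (s₁.word 32) (s₁.word 32) = e.val g := by simp [WordOp.eval, hv₁]
  refine ⟨_, _, _, _, _, .seq _ _ _ _ _ _ _ _ _ h₁
    (.op s₁ d .or 32 32 (by rw [hv]; exact he.val_lt)), ?_, ?_, h⟩
  · refine ⟨fun r hr => ?_, ?_, ?_⟩
    · rcases eq_or_ne r d with rfl | hrd
      · simp [hv]
      · simp [hrd, hw₁ r hr, hs.word r hr]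
    · simp [ha₁, hs.arr]
    · simp [ha₁, hs.nodup]
  · simp [ha₁]

theorem WP.swap {a b : WExp} (ha : a.Ok (2 ^ w) g) (hb : b.Ok (2 ^ w) g) (han : a.val g < n)
    (hbn : b.val g < n) (h : Q g (f ∘ Equiv.swap (a.val g) (b.val g))) :
    WP w n (.swap a b) Q g f := by
  intro s hs
  obtain ⟨s₁, t₁, m₁, h₁, hva, hvb, hs₁, ha₁⟩ := exec_compile_pair hs ha hb
  have hlen : s₁.arr.length = n := by simp [hs₁.arr]
  refine ⟨_, _, _, _, _, .seq _ _ _ _ _ _ _ _ _ h₁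
    (.seq _ _ _ _ _ _ _ _ _ (.load s₁ 0 32 (f (a.val g)) (by rw [hva, hs₁.getElem? han]))
    (.seq _ _ _ _ _ _ _ _ _ (.load _ 1 33 (f (b.val g)) (by
      simp only; rw [hvb, hs₁.getElem? hbn]))
    (.seq _ _ _ _ _ _ _ _ _ (.store _ 32 1 (f (b.val g)) (by simp only; omega) (by simp))
    (.store _ 33 0 (f (a.val g)) (by simp; omega) (by simp))))), ?_, ?_, h⟩
  · refine ⟨hs₁.word, ?_, ?_⟩
    · simp only [hva, hvb, hs₁.arr, map_range_set_set]
    · simp only [hva, hvb, hs₁.arr, map_range_set_set]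
      rw [(perm_map_range_swap f han hbn).nodup_iff, ← hs₁.arr]
      exact hs₁.nodup
  · simp only [hva, hvb, hs₁.arr, map_range_set_set, hs.arr]
    exact perm_map_range_swap f han hbn

theorem WP.ifLt {a b : WExp} (ha : a.Ok (2 ^ w) g) (hb : b.Ok (2 ^ w) g)
    (h₁ : a.val g < b.val g → WP w n p Q g f) (h₂ : b.val g ≤ a.val g → WP w n q Q g f) :
    WP w n (.ifLt a b p q) Q g f := by
  intro s hs
  obtain ⟨s₁, t₁, m₁, e₁, hva, hvb, hs₁, ha₁⟩ := exec_compile_pair hs ha hb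
  by_cases hab : a.val g < b.val g
  · obtain ⟨s', t, m, g', f', k₁, k₂, k₃, k₄⟩ := h₁ hab s₁ hs₁
    exact ⟨s', _, _, g', f', .seq _ _ _ _ _ _ _ _ _ e₁
      (.iteTrue _ _ _ _ _ _ _ (by simp [Test.eval, hva, hvb, hab]) k₁), k₂, ha₁ ▸ k₃, k₄⟩
  · obtain ⟨s', t, m, g', f', k₁, k₂, k₃, k₄⟩ := h₂ (not_lt.1 hab) s₁ hs₁
    exact ⟨s', _, _, g', f', .seq _ _ _ _ _ _ _ _ _ e₁
      (.iteFalse _ _ _ _ _ _ _ (by simpa [Test.eval, hva, hvb] using hab) k₁), k₂, ha₁ ▸ k₃, k₄⟩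

theorem WP.ifEq {a b : WExp} (ha : a.Ok (2 ^ w) g) (hb : b.Ok (2 ^ w) g)
    (h₁ : a.val g = b.val g → WP w n p Q g f) (h₂ : a.val g ≠ b.val g → WP w n q Q g f) :
    WP w n (.ifEq a b p q) Q g f := by
  intro s hs
  obtain ⟨s₁, t₁, m₁, e₁, hva, hvb, hs₁, ha₁⟩ := exec_compile_pair hs ha hb
  by_cases hab : a.val g = b.val g
  · obtain ⟨s', t, m, g', f', k₁, k₂, k₃, k₄⟩ := h₁ hab s₁ hs₁
    exact ⟨s', _, _, g', f', .seq _ _ _ _ _ _ _ _ _ e₁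
      (.iteTrue _ _ _ _ _ _ _ (by simp [Test.eval, hva, hvb, hab]) k₁), k₂, ha₁ ▸ k₃, k₄⟩
  · obtain ⟨s', t, m, g', f', k₁, k₂, k₃, k₄⟩ := h₂ hab s₁ hs₁
    exact ⟨s', _, _, g', f', .seq _ _ _ _ _ _ _ _ _ e₁
      (.iteFalse _ _ _ _ _ _ _ (by simp [Test.eval, hva, hvb, hab]) k₁), k₂, ha₁ ▸ k₃, k₄⟩

theorem WP.ifCell {a b : WExp} (ha : a.Ok (2 ^ w) g) (hb : b.Ok (2 ^ w) g) (han : a.val g < n)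
    (hbn : b.val g < n) (h₁ : f (a.val g) < f (b.val g) → WP w n p Q g f)
    (h₂ : f (b.val g) ≤ f (a.val g) → WP w n q Q g f) : WP w n (.ifCell a b p q) Q g f := by
  intro s hs
  obtain ⟨s₁, t₁, m₁, e₁, hva, hvb, hs₁, ha₁⟩ := exec_compile_pair hs ha hb
  have l₁ := Exec.load (w := w) s₁ 0 32 (f (a.val g)) (by rw [hva, hs₁.getElem? han])
  have l₂ := Exec.load (w := w) { s₁ with elt := Function.update s₁.elt 0 (some (f (a.val g))) }
    1 33 (f (b.val g)) (by simp only; rw [hvb, hs₁.getElem? hbn])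
  by_cases hab : f (a.val g) < f (b.val g)
  · obtain ⟨s', t, m, g', f', k₁, k₂, k₃, k₄⟩ := h₁ hab
      ⟨s₁.word, Function.update (Function.update s₁.elt 0 (some (f (a.val g)))) 1
        (some (f (b.val g))), s₁.arr⟩ ⟨hs₁.word, hs₁.arr, hs₁.nodup⟩
    exact ⟨s', _, _, g', f', .seq _ _ _ _ _ _ _ _ _ e₁ (.seq _ _ _ _ _ _ _ _ _ l₁
      (.seq _ _ _ _ _ _ _ _ _ l₂
      (.iteTrue _ _ _ _ _ _ _ (by simp [Test.eval, hab]) k₁))), k₂, ha₁ ▸ k₃, k₄⟩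
  · obtain ⟨s', t, m, g', f', k₁, k₂, k₃, k₄⟩ := h₂ (not_lt.1 hab)
      ⟨s₁.word, Function.update (Function.update s₁.elt 0 (some (f (a.val g)))) 1
        (some (f (b.val g))), s₁.arr⟩ ⟨hs₁.word, hs₁.arr, hs₁.nodup⟩
    exact ⟨s', _, _, g', f', .seq _ _ _ _ _ _ _ _ _ e₁ (.seq _ _ _ _ _ _ _ _ _ l₁
      (.seq _ _ _ _ _ _ _ _ _ l₂
      (.iteFalse _ _ _ _ _ _ _ (by simpa [Test.eval] using hab) k₁))), k₂, ha₁ ▸ k₃, k₄⟩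

/-- A loop with the invariant `I`, whose first argument bounds the number of rounds to go. -/
theorem WPT.whileLt {a b : WExp} (I : ℕ → (ℕ → ℕ) → (ℕ → α) → Prop) (hp : p.LoopFree)
    (h : ∀ k g f, I k g f → a.Ok (2 ^ w) g ∧ b.Ok (2 ^ w) g ∧
      (a.val g < b.val g → WP w n p (fun g' f' => ∃ k' < k, I k' g' f') g f) ∧
      (b.val g ≤ a.val g → Q g f)) {k : ℕ} (hI : I k g f) :
    WPT w n (.whileLt a b p) ((k + 1) * (Prog.whileLt a b p).size) Q g f := by
  -- The bare loop expects both operands of its test in the registers 32 and 33; they are evaluated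
  -- before the loop and again at the end of each round.
  have key : ∀ k g f s, I k g f → Rel n s g f → s.word 32 = a.val g → s.word 33 = b.val g →
      ∃ s' t m g' f', Exec w (.loop (.wordLt 32 33)
        (.seq p (.seq (a.compile 32) (b.compile 33)))) s s' t m ∧
        t ≤ k * (Prog.whileLt a b p).size + 1 ∧ Rel n s' g' f' ∧ s'.arr.Perm s.arr ∧ Q g' f' := by
    intro k
    induction k using Nat.strong_induction_on with
    | _ k ih =>
    intro g f s hI hs hva hvb
    obtain ⟨ha, hb, h₁, h₂⟩ := h k g f hI
    by_cases hab : a.val g < b.val g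
    · obtain ⟨s₁, t₁, m₁, g₁, f₁, e₁, hs₁, hp₁, k', hk', hI'⟩ := h₁ hab s hs
      obtain ⟨ha', hb', -, -⟩ := h k' g₁ f₁ hI'
      obtain ⟨s₂, t₂, m₂, e₂, hva₂, hvb₂, hs₂, ha₂⟩ := exec_compile_pair hs₁ ha' hb'
      obtain ⟨s₃, t₃, m₃, g₃, f₃, e₃, ht₃, hs₃, hp₃, hQ⟩ := ih k' hk' g₁ f₁ s₂ hI' hs₂ hva₂ hvb₂
      have b₁ := e₁.time_le_size hp
      have b₂ := e₂.time_le_size ⟨a.loopFree_compile _, b.loopFree_compile _⟩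
      refine ⟨s₃, _, _, g₃, f₃, .loopTrue _ _ _ _ _ _ _ _ _
        (by simp [Test.eval, hva, hvb, hab]) (.seq _ _ _ _ _ _ _ _ _ e₁ e₂) e₃, ?_, hs₃,
        hp₃.trans (ha₂ ▸ hp₁), hQ⟩
      have : (k' + 1) * (Prog.whileLt a b p).size ≤ k * (Prog.whileLt a b p).size :=
        Nat.mul_le_mul_right _ hk'
      simp only [Prog.whileLt, Prog.size] at this ht₃ b₂ ⊢
      nlinarith
    · exact ⟨s, 1, 0, g, f, .loopFalse _ _ _ (by simpa [Test.eval, hva, hvb] using hab), by omega,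
        hs, .refl _, h₂ (not_lt.1 hab)⟩
  intro s hs
  obtain ⟨ha, hb, -, -⟩ := h k g f hI
  obtain ⟨s₂, t₂, m₂, e₂, hva₂, hvb₂, hs₂, ha₂⟩ := exec_compile_pair hs ha hb
  obtain ⟨s₃, t₃, m₃, g₃, f₃, e₃, ht₃, hs₃, hp₃, hQ⟩ := key k g f s₂ hI hs₂ hva₂ hvb₂
  have b₂ := e₂.time_le_size ⟨a.loopFree_compile _, b.loopFree_compile _⟩
  refine ⟨s₃, _, _, g₃, f₃, .seq _ _ _ _ _ _ _ _ _ e₂ e₃, ?_, hs₃, ha₂ ▸ hp₃, hQ⟩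
  simp only [Prog.whileLt, Prog.size] at ht₃ b₂ ⊢
  nlinarith

theorem WP.iterate (I : ℕ → (ℕ → ℕ) → (ℕ → α) → Prop) (m : ℕ)
    (h : ∀ k < m, ∀ g f, I k g f → WP w n p (I (k + 1)) g f) (h₀ : I 0 g f) :
    WP w n (p.iterate m) (I m) g f := by
  induction m with
  | zero => exact WP.skip h₀
  | succ k ih =>
    exact WP.seq ((ih fun j hj => h j (by omega)).mono fun g' f' h' => h k (by omega) g' f' h')

end

/-! ### Nodes, links and trees inside the array. -/

section

variable {α : Type u}

/-! ## Nodes of an array of cells -/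

def Node.Same (a b : Node α) : Prop := ∀ y, y ∈ a.elems ↔ y ∈ b.elems

theorem Node.Same.trans {a b c : Node α} (h : a.Same b) (h' : b.Same c) : a.Same c :=
  fun y => (h y).trans (h' y)

theorem Node.Same.refl (a : Node α) : a.Same a := fun _ => Iff.rfl

theorem comp_swap_left (f : ℕ → α) {i j : ℕ} : (f ∘ Equiv.swap i j) i = f j := by simp

theorem comp_swap_right (f : ℕ → α) {i j : ℕ} : (f ∘ Equiv.swap i j) j = f i := by simp

theorem comp_swap_off (f : ℕ → α) {i j k : ℕ} (hi : k ≠ i) (hj : k ≠ j) :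
    (f ∘ Equiv.swap i j) k = f k := by
  simp [Equiv.swap_apply_of_ne_of_ne hi hj]

def nd (f : ℕ → α) (k : ℕ) : Node α := (f (3 * k), f (3 * k + 1), f (3 * k + 2))

theorem mem_elems_nd {f : ℕ → α} {k : ℕ} {y : α} :
    y ∈ (nd f k).elems ↔ ∃ j, j / 3 = k ∧ f j = y := by
  simp only [nd, Node.elems, List.mem_cons, List.not_mem_nil, or_false]
  constructor
  · rintro (rfl | rfl | rfl)
    exacts [⟨3 * k, by omega, rfl⟩, ⟨3 * k + 1, by omega, rfl⟩, ⟨3 * k + 2, by omega, rfl⟩]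
  · rintro ⟨j, rfl, rfl⟩
    have : j = 3 * (j / 3) ∨ j = 3 * (j / 3) + 1 ∨ j = 3 * (j / 3) + 2 := by omega
    rcases this with h | h | h
    · left; rw [← h]
    · right; left; rw [← h]
    · right; right; rw [← h]

theorem nd_congr {f f' : ℕ → α} {k : ℕ} (h : ∀ j, j / 3 = k → f' j = f j) :
    nd f' k = nd f k := by
  simp only [nd]
  rw [h _ (by omega), h _ (by omega), h _ (by omega)]

theorem nd_congr_off {f f' : ℕ → α} {k k' : ℕ}
    (h : ∀ j, j / 3 ≠ k → j / 3 ≠ k' → f' j = f j) (m : ℕ) (hm : m ≠ k) (hm' : m ≠ k') :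
    nd f' m = nd f m :=
  nd_congr fun j hj => h j (by omega) (by omega)

variable [LinearOrder α]

theorem Node.key_mem (a : Node α) : a.key ∈ a.elems := by
  obtain ⟨x, y, z⟩ := a
  simp only [Node.key, Node.elems, List.mem_cons, List.not_mem_nil, or_false]
  rcases min_choice x (min y z) with h | h
  · exact .inl h
  · rw [h]
    exact .inr (min_choice y z)

theorem Node.key_le (a : Node α) : ∀ y ∈ a.elems, a.key ≤ y := by
  obtain ⟨x, y, z⟩ := a
  simp [Node.key, Node.elems]

theorem Node.Same.key_eq {a b : Node α} (h : a.Same b) : a.key = b.key :=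
  le_antisymm (a.key_le _ ((h _).2 b.key_mem)) (b.key_le _ ((h _).1 a.key_mem))

theorem Node.state_eq_isRoot_iff {a : Node α} :
    a.state = .isRoot ↔ a.1 ≤ a.2.1 ∧ a.1 ≤ a.2.2 := by
  obtain ⟨x, y, z⟩ := a
  simp only [Node.state, Node.key]
  grind

theorem Node.state_eq_ownMin_iff {a : Node α} :
    a.state = .ownMin ↔ a.2.1 < a.1 ∧ a.2.1 ≤ a.2.2 := by
  obtain ⟨x, y, z⟩ := a
  simp only [Node.state, Node.key]
  grind

theorem Node.state_eq_smallerMin_iff {a : Node α} :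
    a.state = .smallerMin ↔ a.2.2 < a.1 ∧ a.2.2 < a.2.1 := by
  obtain ⟨x, y, z⟩ := a
  simp only [Node.state, Node.key]
  grind

theorem Node.key_eq_of_isRoot {a : Node α} (h : a.state = .isRoot) : a.key = a.1 := by
  rw [Node.state_eq_isRoot_iff] at h
  simp [Node.key, h]

/-! ## Commands on nodes -/

namespace Prog

/-- Bring a node into the state "root". -/
def norm (e : WExp) : Prog :=
  .seq (ifCell (3 * e + 1) (3 * e) (swap (3 * e) (3 * e + 1)) .skip)
    (ifCell (3 * e + 2) (3 * e) (swap (3 * e) (3 * e + 2)) .skip)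

def swapNodes (e e' : WExp) : Prog :=
  .seq (swap (3 * e) (3 * e')) (.seq (swap (3 * e + 1) (3 * e' + 1))
    (swap (3 * e + 2) (3 * e' + 2)))

/-- Test for the state "root". -/
def ifRoot (e : WExp) (p q : Prog) : Prog :=
  ifCell (3 * e + 1) (3 * e) q (ifCell (3 * e + 2) (3 * e) q p)

/-- Test for the state "minimum among strictly smaller subtrees". -/
def ifSmallerMin (e : WExp) (p q : Prog) : Prog :=
  ifCell (3 * e + 2) (3 * e) (ifCell (3 * e + 2) (3 * e + 1) p q) q

/-- Link the trees of equal size that have the roots `e` and `e'`. -/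
def link (e e' : WExp) : Prog :=
  .seq (norm e) (.seq (norm e') (ifCell (3 * e) (3 * e') (swap (3 * e') (3 * e' + 1))
    (.seq (swapNodes e e') (swap (3 * e') (3 * e' + 2)))))

/-- Undo a link of the trees that start at the nodes `e` and `e'`. -/
def unlink (e e' : WExp) : Prog :=
  .seq (ifSmallerMin e' (swapNodes e e') .skip) (.seq (norm e) (norm e'))

@[simp] theorem loopFree_norm (e : WExp) : (norm e).LoopFree := by simp [norm]
@[simp] theorem loopFree_swapNodes (e e' : WExp) : (swapNodes e e').LoopFree := by
  simp [swapNodes]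
@[simp] theorem loopFree_ifRoot (e : WExp) (p q : Prog) :
    (ifRoot e p q).LoopFree ↔ p.LoopFree ∧ q.LoopFree := by
  simp [ifRoot]; tauto
@[simp] theorem storeFree_ifRoot (e : WExp) (p q : Prog) :
    (ifRoot e p q).StoreFree ↔ p.StoreFree ∧ q.StoreFree := by
  simp [ifRoot]; tauto
@[simp] theorem loopFree_ifSmallerMin (e : WExp) (p q : Prog) :
    (ifSmallerMin e p q).LoopFree ↔ p.LoopFree ∧ q.LoopFree := by
  simp [ifSmallerMin]
@[simp] theorem loopFree_link (e e' : WExp) : (link e e').LoopFree := by simp [link]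
@[simp] theorem loopFree_unlink (e e' : WExp) : (unlink e e').LoopFree := by simp [unlink]

end Prog

variable {w n : ℕ} {P R : Prog} {Q : (ℕ → ℕ) → (ℕ → α) → Prop} {g : ℕ → ℕ} {f : ℕ → α}
  {e e' : WExp}

theorem WExp.Ok.cells {B : ℕ} (h : (3 * e + 2).Ok B g) :
    (3 * e).Ok B g ∧ (3 * e + 1).Ok B g := by
  simp at h ⊢
  grind

/-- Two compare-and-exchange steps bring the smallest of the three elements into the first cell; the
four branches share one script. -/
theorem WP.norm {k : ℕ} (hk : e.val g = k) (he : (3 * e + 2).Ok (2 ^ w) g) (hn : 3 * k + 2 < n)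
    (h : ∀ f', (∀ j, j / 3 ≠ k → f' j = f j) → (nd f' k).Same (nd f k) →
      (nd f' k).state = .isRoot → Q g f') : WP w n (.norm e) Q g f := by
  obtain ⟨h₀, h₁⟩ := he.cells
  have v₀ : (3 * e).val g = 3 * k := by simp [hk]
  have v₁ : (3 * e + 1).val g = 3 * k + 1 := by simp [hk]
  have v₂ : (3 * e + 2).val g = 3 * k + 2 := by simp [hk]
  simp only [Node.state_eq_isRoot_iff, Node.Same, nd, Node.elems, List.mem_cons, List.not_mem_nil,
    or_false] at h
  refine .seq (.ifCell h₁ h₀ (by omega) (by omega)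
    (fun c => .swap h₀ h₁ (by omega) (by omega) ?_) (fun c => .skip ?_))
  all_goals
    refine .ifCell he h₀ (by omega) (by omega)
      (fun c' => .swap h₀ he (by omega) (by omega) ?_) (fun c' => .skip ?_)
  all_goals
    rw [v₀, v₁] at c
    rw [v₀, v₂] at c'
    try simp only [v₀, v₁, v₂] at c c' ⊢
    apply h
    · intro j hj
      repeat rw [comp_swap_off _ (by omega) (by omega)]
      try rfl
    · intro y
      first
        | exact Iff.rfl
        | (simp [Equiv.swap_apply_def]; try tauto)
    · try simp [Equiv.swap_apply_def] at c c' ⊢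
      grind

theorem WP.swapNodes {k k' : ℕ} (hk : e.val g = k) (hk' : e'.val g = k')
    (he : (3 * e + 2).Ok (2 ^ w) g) (he' : (3 * e' + 2).Ok (2 ^ w) g) (hn : 3 * k + 2 < n)
    (hn' : 3 * k' + 2 < n) (_hkk : k ≠ k')
    (h : ∀ f', (∀ j, j / 3 ≠ k → j / 3 ≠ k' → f' j = f j) → nd f' k = nd f k' →
      nd f' k' = nd f k → Q g f') : WP w n (.swapNodes e e') Q g f := by
  obtain ⟨h₀, h₁⟩ := he.cells
  obtain ⟨h₀', h₁'⟩ := he'.cells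
  have v₀ : (3 * e).val g = 3 * k := by simp [hk]
  have v₁ : (3 * e + 1).val g = 3 * k + 1 := by simp [hk]
  have v₂ : (3 * e + 2).val g = 3 * k + 2 := by simp [hk]
  have v₀' : (3 * e').val g = 3 * k' := by simp [hk']
  have v₁' : (3 * e' + 1).val g = 3 * k' + 1 := by simp [hk']
  have v₂' : (3 * e' + 2).val g = 3 * k' + 2 := by simp [hk']
  refine .seq (.swap h₀ h₀' (by omega) (by omega) (.seq (.swap h₁ h₁' (by omega) (by omega)
    (.swap he he' (by omega) (by omega) ?_))))
  simp only [v₀, v₁, v₂, v₀', v₁', v₂']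
  apply h
  · intro j hj hj'
    repeat rw [comp_swap_off _ (by omega) (by omega)]
  · refine Prod.ext ?_ (Prod.ext ?_ ?_)
    · dsimp only [nd]
      rw [comp_swap_off _ (by omega) (by omega), comp_swap_off _ (by omega) (by omega),
        comp_swap_left]
    · dsimp only [nd]
      rw [comp_swap_off _ (by omega) (by omega), comp_swap_left,
        comp_swap_off _ (by omega) (by omega)]
    · dsimp only [nd]
      rw [comp_swap_left, comp_swap_off _ (by omega) (by omega),
        comp_swap_off _ (by omega) (by omega)]
  · refine Prod.ext ?_ (Prod.ext ?_ ?_)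
    · dsimp only [nd]
      rw [comp_swap_off _ (by omega) (by omega), comp_swap_off _ (by omega) (by omega),
        comp_swap_right]
    · dsimp only [nd]
      rw [comp_swap_off _ (by omega) (by omega), comp_swap_right,
        comp_swap_off _ (by omega) (by omega)]
    · dsimp only [nd]
      rw [comp_swap_right, comp_swap_off _ (by omega) (by omega),
        comp_swap_off _ (by omega) (by omega)]

theorem WP.ifRoot {k : ℕ} (hk : e.val g = k) (he : (3 * e + 2).Ok (2 ^ w) g) (hn : 3 * k + 2 < n)
    (h₁ : (nd f k).state = .isRoot → WP w n P Q g f)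
    (h₂ : (nd f k).state ≠ .isRoot → WP w n R Q g f) : WP w n (.ifRoot e P R) Q g f := by
  obtain ⟨o₀, o₁⟩ := he.cells
  subst hk
  simp only [ne_eq, Node.state_eq_isRoot_iff, nd] at h₁ h₂
  refine .ifCell o₁ o₀ (by simp; omega) (by simp; omega) (fun c => h₂ ?_) (fun c =>
    .ifCell he o₀ (by simp; omega) (by simp; omega) (fun c' => h₂ ?_) (fun c' => h₁ ?_)) <;>
  simp_all

theorem WP.ifSmallerMin {k : ℕ} (hk : e.val g = k) (he : (3 * e + 2).Ok (2 ^ w) g)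
    (hn : 3 * k + 2 < n) (h₁ : (nd f k).state = .smallerMin → WP w n P Q g f)
    (h₂ : (nd f k).state ≠ .smallerMin → WP w n R Q g f) :
    WP w n (.ifSmallerMin e P R) Q g f := by
  obtain ⟨o₀, o₁⟩ := he.cells
  subst hk
  simp only [ne_eq, Node.state_eq_smallerMin_iff, nd] at h₁ h₂
  refine .ifCell he o₀ (by simp; omega) (by simp; omega) (fun c =>
    .ifCell he o₁ (by simp; omega) (by simp; omega) (fun c' => h₁ ?_) (fun c' => h₂ ?_))
    (fun c => h₂ ?_) <;>
  simp_all

/-- The effect of a link on the nodes `p` and `q`. -/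
def Linked (a a' : ℕ → Node α) (p q : ℕ) : Prop :=
  (a' p).state = .isRoot ∧
    (((a p).key ≤ (a q).key ∧ (a' p).Same (a p) ∧ (a' q).Same (a q) ∧ (a' q).state = .ownMin) ∨
    ((a q).key ≤ (a p).key ∧ (a' p).Same (a q) ∧ (a' q).Same (a p) ∧
      (a' q).state = .smallerMin))

/-- The effect of undoing a link on the nodes `p` and `q`. -/
def Unlinked (a a' : ℕ → Node α) (p q : ℕ) : Prop :=
  (a' p).state = .isRoot ∧ (a' q).state = .isRoot ∧
    (((a q).state ≠ .smallerMin ∧ (a' p).Same (a p) ∧ (a' q).Same (a q)) ∨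
    ((a q).state = .smallerMin ∧ (a' p).Same (a q) ∧ (a' q).Same (a p)))

/-- Once both nodes are in state "root", their keys are their first cells, and one comparison
decides. Moving the first element of the child into its second or third cell then writes the new
state. -/
theorem WP.link_nodes {k k' : ℕ} (hk : e.val g = k) (hk' : e'.val g = k')
    (he : (3 * e + 2).Ok (2 ^ w) g) (he' : (3 * e' + 2).Ok (2 ^ w) g) (hn : 3 * k + 2 < n)
    (hn' : 3 * k' + 2 < n) (hkk : k ≠ k')
    (h : ∀ f', (∀ j, j / 3 ≠ k → j / 3 ≠ k' → f' j = f j) → Linked (nd f) (nd f') k k' → Q g f') :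
    WP w n (.link e e') Q g f := by
  have h₀ := he.cells.1
  obtain ⟨h₀', h₁'⟩ := he'.cells
  have v₀ : (3 * e).val g = 3 * k := by simp [hk]
  have v₀' : (3 * e').val g = 3 * k' := by simp [hk']
  have v₁' : (3 * e' + 1).val g = 3 * k' + 1 := by simp [hk']
  have v₂' : (3 * e' + 2).val g = 3 * k' + 2 := by simp [hk']
  refine .seq (.norm hk he hn fun f₁ off₁ same₁ root₁ => .seq (.norm hk' he' hn'
    fun f₂ off₂ same₂ root₂ => .of_injOn fun inj => ?_))
  have e₁ : nd f₁ k' = nd f k' := nd_congr fun j hj => off₁ j (by omega)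
  have e₂ : nd f₂ k = nd f₁ k := nd_congr fun j hj => off₂ j (by omega)
  rw [e₁] at same₂
  rw [← e₂] at same₁ root₁
  have ky₁ := Node.key_eq_of_isRoot root₁
  have ky₂ := Node.key_eq_of_isRoot root₂
  rw [same₁.key_eq] at ky₁
  rw [same₂.key_eq] at ky₂
  -- The states `ownMin` and `smallerMin` require strict inequalities between cells of a node, while
  -- the state "root" yields weak ones only.
  have ne₁ : f₂ (3 * k') ≠ f₂ (3 * k' + 1) := fun h => by
    have := inj (by simp; omega) (by simp; omega) h; omega
  have ne₂ : f₂ (3 * k) ≠ f₂ (3 * k + 1) := fun h => by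
    have := inj (by simp; omega) (by simp; omega) h; omega
  have ne₃ : f₂ (3 * k) ≠ f₂ (3 * k + 2) := fun h => by
    have := inj (by simp; omega) (by simp; omega) h; omega
  refine .ifCell h₀ h₀' (by omega) (by omega)
    (fun c => .swap h₀' h₁' (by omega) (by omega) ?_)
    (fun c => .seq (.swapNodes hk hk' he he' hn hn' hkk fun f₃ off₃ s₁ s₂ =>
      .swap h₀' he' (by omega) (by omega) ?_))
  · rw [v₀, v₀'] at c
    simp only [v₀', v₁']
    set f₃ := f₂ ∘ Equiv.swap (3 * k') (3 * k' + 1) with hf₃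
    have off₃ : ∀ j, j / 3 ≠ k' → f₃ j = f₂ j := by
      intro j hj
      simp only [hf₃, Function.comp, Equiv.swap_apply_def]
      split_ifs <;> first | rfl | omega
    have e₃ : nd f₃ k = nd f₂ k := nd_congr fun j hj => off₃ j (by omega)
    have e₄ : nd f₃ k' = (f₂ (3 * k' + 1), f₂ (3 * k'), f₂ (3 * k' + 2)) := by
      simp [nd, hf₃, Equiv.swap_apply_def]
    refine h _ (fun j hj hj' => ?_) ⟨by rw [e₃]; exact root₁, .inl ⟨?_, ?_, ?_, ?_⟩⟩
    · rw [off₃ j hj', off₂ j hj', off₁ j hj]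
    · rw [ky₁, ky₂]; exact c.le
    · rw [e₃]; exact same₁
    · refine Node.Same.trans (fun y => ?_) same₂
      rw [e₄]
      simp only [nd, Node.elems, List.mem_cons, List.not_mem_nil, or_false]
      tauto
    · rw [e₄, Node.state_eq_ownMin_iff]
      rw [Node.state_eq_isRoot_iff] at root₂
      exact ⟨lt_of_le_of_ne root₂.1 ne₁, root₂.2⟩
  · rw [v₀, v₀'] at c
    simp only [v₀', v₂']
    set f₄ := f₃ ∘ Equiv.swap (3 * k') (3 * k' + 2) with hf₄
    have off₄ : ∀ j, j / 3 ≠ k' → f₄ j = f₃ j := by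
      intro j hj
      simp only [hf₄, Function.comp, Equiv.swap_apply_def]
      split_ifs <;> first | rfl | omega
    have e₃ : nd f₄ k = nd f₂ k' := (nd_congr fun j hj => off₄ j (by omega)).trans s₁
    have e₄ : nd f₄ k' = (f₂ (3 * k + 2), f₂ (3 * k + 1), f₂ (3 * k)) := by
      simp only [nd, Prod.mk.injEq] at s₂
      simp [nd, hf₄, Equiv.swap_apply_def, s₂]
    refine h _ (fun j hj hj' => ?_) ⟨by rw [e₃]; exact root₂, .inr ⟨?_, ?_, ?_, ?_⟩⟩
    · rw [off₄ j hj', off₃ j hj hj', off₂ j hj', off₁ j hj]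
    · rw [ky₁, ky₂]; exact c
    · rw [e₃]; exact same₂
    · refine Node.Same.trans (fun y => ?_) same₁
      rw [e₄]
      simp only [nd, Node.elems, List.mem_cons, List.not_mem_nil, or_false]
      tauto
    · rw [e₄, Node.state_eq_smallerMin_iff]
      rw [Node.state_eq_isRoot_iff] at root₁
      exact ⟨lt_of_le_of_ne root₁.2 ne₃, lt_of_le_of_ne root₁.1 ne₂⟩

theorem WP.unlink_nodes {k k' : ℕ} (hk : e.val g = k) (hk' : e'.val g = k')
    (he : (3 * e + 2).Ok (2 ^ w) g) (he' : (3 * e' + 2).Ok (2 ^ w) g) (hn : 3 * k + 2 < n)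
    (hn' : 3 * k' + 2 < n) (hkk : k ≠ k')
    (h : ∀ f', (∀ j, j / 3 ≠ k → j / 3 ≠ k' → f' j = f j) →
      Unlinked (nd f) (nd f') k k' → Q g f') :
    WP w n (.unlink e e') Q g f := by
  have key : ∀ f₁ : ℕ → α, (∀ j, j / 3 ≠ k → j / 3 ≠ k' → f₁ j = f j) →
      (((nd f k').state ≠ .smallerMin ∧ nd f₁ k = nd f k ∧ nd f₁ k' = nd f k') ∨
      ((nd f k').state = .smallerMin ∧ nd f₁ k = nd f k' ∧ nd f₁ k' = nd f k)) →
      WP w n (.seq (.norm e) (.norm e')) Q g f₁ := by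
    intro f₁ off hf₁
    refine .seq (.norm hk he hn fun f₂ off₂ same₂ root₂ => .norm hk' he' hn'
      fun f₃ off₃ same₃ root₃ => h f₃ (fun j hj hj' => ?_) ?_)
    · rw [off₃ j hj', off₂ j hj, off j hj hj']
    have e₁ : nd f₂ k' = nd f₁ k' := nd_congr fun j hj => off₂ j (by omega)
    have e₂ : nd f₃ k = nd f₂ k := nd_congr fun j hj => off₃ j (by omega)
    rw [e₁] at same₃
    rw [← e₂] at same₂ root₂
    refine ⟨root₂, root₃, hf₁.imp ?_ ?_⟩
    · rintro ⟨h₁, h₂, h₃⟩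
      rw [h₂] at same₂; rw [h₃] at same₃; exact ⟨h₁, same₂, same₃⟩
    · rintro ⟨h₁, h₂, h₃⟩
      rw [h₂] at same₂; rw [h₃] at same₃; exact ⟨h₁, same₂, same₃⟩
  exact .seq (.ifSmallerMin hk' he' hn'
    (fun c => .swapNodes hk hk' he he' hn hn' hkk fun f₁ off h₁ h₂ => key f₁ off (.inr ⟨c, h₁, h₂⟩))
    (fun c => .skip (key f (fun _ _ _ => rfl) (.inl ⟨c, rfl, rfl⟩))))

end

section

variable {α : Type u} [LinearOrder α]

/-! ## Relaxed binomial trees in an array of nodes -/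

/-- `x` is a lower bound for all elements of the nodes from `lo` to `hi - 1`. -/
def Below (x : α) (a : ℕ → Node α) (lo hi : ℕ) : Prop :=
  ∀ k, lo ≤ k → k < hi → ∀ y ∈ (a k).elems, x ≤ y

theorem Below.congr {x : α} {a a' : ℕ → Node α} {lo hi : ℕ} (h : Below x a lo hi)
    (ha : ∀ k, lo ≤ k → k < hi → a' k = a k) : Below x a' lo hi := fun k h₁ h₂ => by
  rw [ha k h₁ h₂]; exact h k h₁ h₂

/-- The nodes from `p` on form a binomial tree of size `2 ^ i` with the relaxed order at all nodes
except the root. -/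
def RlxAt (a : ℕ → Node α) : ℕ → ℕ → Prop
  | 0, _ => True
  | i + 1, p => RlxAt a i p ∧ RlxAt a i (p + 2 ^ i) ∧
      (((a (p + 2 ^ i)).state = .ownMin ∧
          Below (a (p + 2 ^ i)).key a (p + 2 ^ i) (p + 2 ^ i + 2 ^ i)) ∨
        ((a (p + 2 ^ i)).state = .smallerMin ∧
          Below (a (p + 2 ^ i)).key a (p + 1) (p + 2 ^ i)))

/-- In addition the root is minimal. -/
def MinAt (a : ℕ → Node α) (i p : ℕ) : Prop :=
  RlxAt a i p ∧ Below (a p).key a p (p + 2 ^ i)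

def RBTAt (a : ℕ → Node α) (i p : ℕ) : Prop :=
  MinAt a i p ∧ (a p).state = .isRoot

variable {a a' : ℕ → Node α} {i p q : ℕ}

theorem RlxAt.congr (h : RlxAt a i p) (ha : ∀ k, p < k → k < p + 2 ^ i → a' k = a k) :
    RlxAt a' i p := by
  induction i generalizing p with
  | zero => trivial
  | succ i ih =>
    have hpos : 0 < 2 ^ i := by positivity
    rw [pow_succ] at ha
    obtain ⟨h₁, h₂, h₃⟩ := h
    refine ⟨ih h₁ fun k _ _ => ha k (by omega) (by omega),
      ih h₂ fun k _ _ => ha k (by omega) (by omega), ?_⟩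
    rw [ha (p + 2 ^ i) (by omega) (by omega)]
    exact h₃.imp (fun h => ⟨h.1, h.2.congr fun k _ _ => ha k (by omega) (by omega)⟩)
      (fun h => ⟨h.1, h.2.congr fun k _ _ => ha k (by omega) (by omega)⟩)

theorem MinAt.congr (h : MinAt a i p) (ha : ∀ k, p ≤ k → k < p + 2 ^ i → a' k = a k) :
    MinAt a' i p := by
  refine ⟨h.1.congr fun k _ _ => ha k (by omega) (by omega), ?_⟩
  rw [ha p le_rfl (by simp)]
  exact h.2.congr ha

theorem RBTAt.congr (h : RBTAt a i p) (ha : ∀ k, p ≤ k → k < p + 2 ^ i → a' k = a k) :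
    RBTAt a' i p :=
  ⟨h.1.congr ha, by rw [ha p le_rfl (by simp)]; exact h.2⟩

theorem minAt_zero (a : ℕ → Node α) (p : ℕ) : MinAt a 0 p := by
  refine ⟨trivial, fun k h₁ h₂ y hy => ?_⟩
  obtain rfl : k = p := by omega
  exact (a k).key_le y hy

/-- A node that is exchanged with one from another tree keeps a tree minimal if it is small. -/
theorem RlxAt.minAt (h : RlxAt a i p) (ha : ∀ k, p < k → k < p + 2 ^ i → a' k = a k)
    (hb : Below (a' p).key a (p + 1) (p + 2 ^ i)) : MinAt a' i p := by
  refine ⟨h.congr ha, fun k h₁ h₂ y hy => ?_⟩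
  rcases h₁.eq_or_lt with rfl | h₁
  · exact (a' p).key_le y hy
  · rw [ha k h₁ h₂] at hy
    exact hb k h₁ h₂ y hy

/-- The states of the two roots do not matter, because linking overwrites them; hence `MinAt`
suffices for the parts and `RBTAt` results for the whole. -/
theorem MinAt.link (hp : MinAt a i p) (hq : MinAt a i (p + 2 ^ i))
    (h : Linked a a' p (p + 2 ^ i)) (off : ∀ k, k ≠ p → k ≠ p + 2 ^ i → a' k = a k) :
    RBTAt a' (i + 1) p := by
  have hpos : 0 < 2 ^ i := by positivity
  obtain ⟨root, h⟩ := h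
  have rp : RlxAt a' i p := hp.1.congr fun k _ _ => off k (by omega) (by omega)
  have rq : RlxAt a' i (p + 2 ^ i) := hq.1.congr fun k _ _ => off k (by omega) (by omega)
  have key : ∀ x, x ≤ (a p).key → x ≤ (a (p + 2 ^ i)).key →
      ∀ k, k ≠ p → k ≠ p + 2 ^ i → p ≤ k → k < p + 2 ^ (i + 1) →
        ∀ y ∈ (a' k).elems, x ≤ y := by
    intro x xp xq k kp kq hk hk' y hy
    rw [off k kp kq] at hy
    rw [pow_succ] at hk'
    rcases lt_or_ge k (p + 2 ^ i) with hlt | hge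
    · exact xp.trans (hp.2 k hk hlt y hy)
    · exact xq.trans (hq.2 k hge (by omega) y hy)
  refine ⟨⟨⟨rp, rq, ?_⟩, ?_⟩, root⟩
  · rcases h with ⟨hle, sp, sq, hs⟩ | ⟨hle, sp, sq, hs⟩
    · refine .inl ⟨hs, fun k h₁ h₂ y hy => ?_⟩
      rw [sq.key_eq]
      rcases h₁.eq_or_lt with rfl | h₁
      · exact Node.key_le _ _ ((sq y).1 hy)
      · rw [off k (by omega) (by omega)] at hy
        exact hq.2 k h₁.le h₂ y hy
    -- The child now has the former key of node `p`, which bounds the left tree. It need not bound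
    -- its own subtree, which is why the third state exists.
    · refine .inr ⟨hs, fun k h₁ h₂ y hy => ?_⟩
      rw [sq.key_eq]
      rw [off k (by omega) (by omega)] at hy
      exact hp.2 k (by omega) h₂ y hy
  · intro k h₁ h₂ y hy
    by_cases kp : k = p
    · subst kp; exact (a' k).key_le y hy
    rcases h with ⟨hle, sp, sq, hs⟩ | ⟨hle, sp, sq, hs⟩
    · rw [sp.key_eq]
      by_cases kq : k = p + 2 ^ i
      · subst kq; exact hle.trans (Node.key_le _ _ ((sq y).1 hy))
      · exact key _ le_rfl hle k kp kq h₁ h₂ y hy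
    · rw [sp.key_eq]
      by_cases kq : k = p + 2 ^ i
      · subst kq; exact hle.trans (Node.key_le _ _ ((sq y).1 hy))
      · exact key _ hle le_rfl k kp kq h₁ h₂ y hy

/-- The child of largest rank, if it is not exchanged with the root. -/
theorem RlxAt.minAt_of_ne (h : RlxAt a (i + 1) p) (hs : (a (p + 2 ^ i)).state ≠ .smallerMin) :
    MinAt a i (p + 2 ^ i) :=
  ⟨h.2.1, (h.2.2.resolve_right fun h' => hs h'.1).2⟩

/-- The rest of the tree, if the child of largest rank replaces the root. -/
theorem RlxAt.minAt_of_eq (h : RlxAt a (i + 1) p) (hs : (a (p + 2 ^ i)).state = .smallerMin)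
    (hp : (a' p).Same (a (p + 2 ^ i))) (ha : ∀ k, p < k → k < p + 2 ^ i → a' k = a k) :
    MinAt a' i p := by
  refine h.1.minAt ha ?_
  rw [hp.key_eq]
  exact (h.2.2.resolve_left fun h' => by simp [hs] at h').2

/-- A last child in state `smallerMin` bounds the left half without its root, so it can head that
half, and the old root, minimal in the whole tree, can head the right half. In the other case both
halves are already headed by their minima. -/
theorem MinAt.unlink (hp : MinAt a (i + 1) p) (h : Unlinked a a' p (p + 2 ^ i))
    (off : ∀ k, k ≠ p → k ≠ p + 2 ^ i → a' k = a k) :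
    RBTAt a' i p ∧ RBTAt a' i (p + 2 ^ i) := by
  have hpos : 0 < 2 ^ i := by positivity
  obtain ⟨hr, hb⟩ := hp
  rw [pow_succ] at hb
  obtain ⟨rp, rq, h⟩ := h
  rcases h with ⟨hs, sp, sq⟩ | ⟨hs, sp, sq⟩
  · refine ⟨⟨hr.1.minAt (fun k _ _ => off k (by omega) (by omega)) ?_, rp⟩,
      hr.2.1.minAt (fun k _ _ => off k (by omega) (by omega)) ?_, rq⟩
    · rw [sp.key_eq]
      exact fun k h₁ h₂ => hb k (by omega) (by omega)
    · rw [sq.key_eq]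
      exact fun k h₁ h₂ => (hr.minAt_of_ne hs).2 k (by omega) h₂
  · refine ⟨⟨hr.minAt_of_eq hs sp (fun k _ _ => off k (by omega) (by omega)), rp⟩,
      hr.2.1.minAt (fun k _ _ => off k (by omega) (by omega)) ?_, rq⟩
    rw [sq.key_eq]
    exact fun k h₁ h₂ => hb k (by omega) (by omega)

variable {w n : ℕ} {Q : (ℕ → ℕ) → (ℕ → α) → Prop} {g : ℕ → ℕ} {f : ℕ → α} {e e' : WExp}

theorem WP.link (hp : e.val g = p) (hq : e'.val g = p + 2 ^ i)
    (he : (3 * e + 2).Ok (2 ^ w) g) (he' : (3 * e' + 2).Ok (2 ^ w) g)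
    (hn : 3 * (p + 2 ^ i) + 2 < n) (h₁ : MinAt (nd f) i p) (h₂ : MinAt (nd f) i (p + 2 ^ i))
    (h : ∀ f', (∀ j, j / 3 ≠ p → j / 3 ≠ p + 2 ^ i → f' j = f j) → RBTAt (nd f') (i + 1) p →
      Q g f') : WP w n (.link e e') Q g f :=
  have hpos := Nat.two_pow_pos i
  .link_nodes hp hq he he' (by omega) hn (by simp) fun f' off hl =>
    h f' off (h₁.link h₂ hl (nd_congr_off off))

theorem WP.unlink (hp : e.val g = p) (hq : e'.val g = p + 2 ^ i)
    (he : (3 * e + 2).Ok (2 ^ w) g) (he' : (3 * e' + 2).Ok (2 ^ w) g)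
    (hn : 3 * (p + 2 ^ i) + 2 < n) (h₁ : MinAt (nd f) (i + 1) p)
    (h : ∀ f', (∀ j, j / 3 ≠ p → j / 3 ≠ p + 2 ^ i → f' j = f j) → RBTAt (nd f') i p →
      RBTAt (nd f') i (p + 2 ^ i) → Q g f') : WP w n (.unlink e e') Q g f :=
  have hpos := Nat.two_pow_pos i
  .unlink_nodes hp hq he he' (by omega) hn (by simp) fun f' off hl =>
    have := h₁.unlink hl (nd_congr_off off)
    h f' off this.1 this.2

/-! ## Paths to a subtree -/

/-- The subtree of size `2 ^ j` at node `h` is a part of a tree of size `2 ^ I` at node `p` such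
that the subtrees with which it is linked on the way up are in order. -/
inductive Path (a : ℕ → Node α) (I p : ℕ) : ℕ → ℕ → Prop
  | base : Path a I p I p
  | left {j h : ℕ} : Path a I p (j + 1) h → MinAt a j (h + 2 ^ j) → Path a I p j h
  | right {j h : ℕ} : Path a I p (j + 1) h → MinAt a j h → Path a I p j (h + 2 ^ j)

variable {I j h : ℕ}

/-- The parity of the multiplier tells a left half from a right half; the way up is later recovered
from the offset by this. -/
theorem Path.bounds (hp : Path a I p j h) : j ≤ I ∧ ∃ m, h = p + m * 2 ^ j ∧
    h + 2 ^ j ≤ p + 2 ^ I := by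
  induction hp with
  | base => exact ⟨le_rfl, 0, by simp⟩
  | @left j h _ _ ih =>
    obtain ⟨h₁, m, h₂, h₃⟩ := ih
    rw [pow_succ] at h₂ h₃
    exact ⟨by omega, 2 * m, by rw [h₂]; ring, by omega⟩
  | @right j h _ _ ih =>
    obtain ⟨h₁, m, h₂, h₃⟩ := ih
    rw [pow_succ] at h₂ h₃
    exact ⟨by omega, 2 * m + 1, by rw [h₂]; ring, by omega⟩

/-- A path constrains only nodes outside the subtree to which it leads, so this subtree may be
altered freely. -/
theorem Path.congr (hp : Path a I p j h)
    (ha : ∀ k, p ≤ k → k < p + 2 ^ I → k < h ∨ h + 2 ^ j ≤ k → a' k = a k) :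
    Path a' I p j h := by
  induction hp with
  | base => exact .base
  | @left j h hp hm ih =>
    obtain ⟨h₁, m, h₂, h₃⟩ := hp.bounds
    have : p ≤ h := by rw [h₂]; exact Nat.le_add_right _ _
    rw [pow_succ] at h₃ ih
    exact .left (ih fun k _ _ _ => ha k (by omega) (by omega) (by omega))
      (hm.congr fun k _ _ => ha k (by omega) (by omega) (by omega))
  | @right j h hp hm ih =>
    obtain ⟨h₁, m, h₂, h₃⟩ := hp.bounds
    have : p ≤ h := by rw [h₂]; exact Nat.le_add_right _ _
    rw [pow_succ] at h₃ ih
    exact .right (ih fun k _ _ _ => ha k (by omega) (by omega) (by omega))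
      (hm.congr fun k _ _ => ha k (by omega) (by omega) (by omega))

/-! ## Forests in an array of nodes -/

/-- The number of nodes of a forest whose trees have the sizes `2 ^ i`, `i ∈ L`. -/
def weight (L : List ℕ) : ℕ := (L.map (2 ^ ·)).sum

@[simp] theorem weight_nil : weight [] = 0 := rfl
@[simp] theorem weight_cons (i : ℕ) (L : List ℕ) : weight (i :: L) = 2 ^ i + weight L := rfl
@[simp] theorem weight_append (L L' : List ℕ) : weight (L ++ L') = weight L + weight L' := by
  simp [weight]

/-- From node `p` on there are relaxed binomial trees of the sizes `2 ^ i`, `i ∈ L`. -/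
def ForestAt (a : ℕ → Node α) : ℕ → List ℕ → Prop
  | _, [] => True
  | p, i :: L => RBTAt a i p ∧ ForestAt a (p + 2 ^ i) L

theorem forestAt_append {A B : List ℕ} :
    ForestAt a p (A ++ B) ↔ ForestAt a p A ∧ ForestAt a (p + weight A) B := by
  induction A generalizing p with
  | nil => simp [ForestAt]
  | cons i A ih => simp [ForestAt, ih, and_assoc, add_assoc]

theorem ForestAt.congr {L : List ℕ} (h : ForestAt a p L)
    (ha : ∀ k, p ≤ k → k < p + weight L → a' k = a k) : ForestAt a' p L := by
  induction L generalizing p with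
  | nil => trivial
  | cons i L ih =>
    rw [weight_cons] at ha
    have hpos := Nat.two_pow_pos i
    exact ⟨h.1.congr fun k _ _ => ha k (by omega) (by omega),
      ih h.2 fun k _ _ => ha k (by omega) (by omega)⟩

/-- Replace some consecutive trees of a forest. -/
theorem ForestAt.replace {A B L L' : List ℕ} (h : ForestAt a 0 (A ++ (L ++ B)))
    (hw : weight L' = weight L) (hL : ForestAt a' (weight A) L')
    (ha : ∀ k, k < weight A ∨ weight A + weight L ≤ k → k < weight (A ++ (L ++ B)) →
      a' k = a k) : ForestAt a' 0 (A ++ (L' ++ B)) := by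
  simp only [forestAt_append, zero_add, weight_append] at h ha ⊢
  refine ⟨h.1.congr fun k _ _ => ha k (by omega) (by omega), hL, ?_⟩
  rw [hw]
  exact h.2.2.congr fun k _ _ => ha k (by omega) (by omega)

end

/-! ### Arithmetic of the canonical shape. -/

section

/-! ## The canonical sizes -/

/-- The rank of the first tree of the canonical forest with `N` nodes: the largest `i` with
`3 * 2 ^ i ≤ 2 * N`, if there is one. -/
def topRank (N : ℕ) : ℕ := Nat.log 2 (2 * N / 3)

theorem two_pow_topRank_le {N : ℕ} (hN : 0 < N) : 2 ^ topRank N ≤ N := by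
  rcases Nat.eq_zero_or_pos (2 * N / 3) with h | h
  · rw [topRank, h]; simpa using Nat.one_le_iff_ne_zero.2 hN.ne'
  · have := Nat.pow_log_le_self 2 h.ne'
    rw [topRank]; omega

theorem lt_three_mul_two_pow_topRank (N : ℕ) : N < 3 * 2 ^ topRank N := by
  have := Nat.lt_pow_succ_log_self (b := 2) (by norm_num) (2 * N / 3)
  rw [pow_succ] at this
  rw [topRank]; omega

theorem topRank_eq {N i : ℕ} (h : i = 0 ∨ 3 * 2 ^ i ≤ 2 * N) (h' : N < 3 * 2 ^ i) :
    topRank N = i := by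
  rcases h with rfl | h
  · exact Nat.log_of_lt (by omega)
  · exact Nat.log_eq_of_pow_le_of_lt_pow (by omega) (by rw [pow_succ]; omega)

theorem three_mul_two_pow_topRank_le (N : ℕ) : topRank N = 0 ∨ 3 * 2 ^ topRank N ≤ 2 * N := by
  rcases Nat.eq_zero_or_pos (2 * N / 3) with h | h
  · left; rw [topRank, h]; rfl
  · right
    have := Nat.pow_log_le_self 2 h.ne'
    rw [topRank]; omega

/-- The canonical ranks of the trees of a forest with `N` nodes. -/
def shape (N : ℕ) : List ℕ :=
  if h : 0 < N then topRank N :: shape (N - 2 ^ topRank N) else []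
termination_by N
decreasing_by have := Nat.two_pow_pos (topRank N); omega

@[simp] theorem shape_zero : shape 0 = [] := by rw [shape]; simp

theorem shape_of_pos {N : ℕ} (h : 0 < N) :
    shape N = topRank N :: shape (N - 2 ^ topRank N) := by
  conv_lhs => rw [shape]
  rw [dif_pos h]

theorem shape_eq_cons {N i : ℕ} (hN : 0 < N) (h : i = 0 ∨ 3 * 2 ^ i ≤ 2 * N)
    (h' : N < 3 * 2 ^ i) : shape N = i :: shape (N - 2 ^ i) := by
  rw [shape_of_pos hN, topRank_eq h h']

@[simp] theorem weight_shape (N : ℕ) : weight (shape N) = N := by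
  induction N using Nat.strong_induction_on with
  | _ N ih =>
    rcases Nat.eq_zero_or_pos N with rfl | hN
    · simp
    · have := Nat.two_pow_pos (topRank N)
      have := two_pow_topRank_le hN
      rw [shape_of_pos hN, weight_cons, ih _ (by omega)]
      omega

theorem le_topRank_of_mem {N i : ℕ} (h : i ∈ shape N) : i ≤ topRank N := by
  induction N using Nat.strong_induction_on with
  | _ N ih =>
    rcases Nat.eq_zero_or_pos N with rfl | hN
    · simp at h
    · rw [shape_of_pos hN] at h
      rcases List.mem_cons.1 h with rfl | h
      · exact le_rfl
      · have := Nat.two_pow_pos (topRank N)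
        refine (ih _ (by omega) h).trans ?_
        exact Nat.log_mono_right (by omega)

theorem pairwise_shape (N : ℕ) : (shape N).Pairwise (· ≥ ·) := by
  induction N using Nat.strong_induction_on with
  | _ N ih =>
    rcases Nat.eq_zero_or_pos N with rfl | hN
    · simp
    · have := Nat.two_pow_pos (topRank N)
      rw [shape_of_pos hN, List.pairwise_cons]
      refine ⟨fun i hi => (le_topRank_of_mem hi).trans ?_, ih _ (by omega)⟩
      exact Nat.log_mono_right (by omega)

theorem count_mul_two_pow_le_weight (i : ℕ) (L : List ℕ) : L.count i * 2 ^ i ≤ weight L := by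
  induction L with
  | nil => simp
  | cons j L ih =>
    rw [weight_cons, List.count_cons]
    split_ifs with h
    · obtain rfl : j = i := by simpa using h
      rw [add_mul]; omega
    · exact ih.trans (Nat.le_add_left _ _)

/-- When the first tree of rank `i` is taken, fewer than 3·2^i nodes remain, which leaves no room
for three such trees. -/
theorem count_shape_le (i N : ℕ) : (shape N).count i ≤ 2 := by
  induction N using Nat.strong_induction_on with
  | _ N ih =>
    rcases Nat.eq_zero_or_pos N with rfl | hN
    · simp
    · by_cases h : topRank N = i
      · have h₁ := lt_three_mul_two_pow_topRank N
        have h₂ := count_mul_two_pow_le_weight i (shape N)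
        rw [weight_shape] at h₂
        rw [h] at h₁
        have := lt_of_mul_lt_mul_right (h₂.trans_lt h₁) (Nat.zero_le _)
        omega
      · have := Nat.two_pow_pos (topRank N)
        rw [shape_of_pos hN, List.count_cons_of_ne h]
        exact ih _ (by omega)

/-- The case in which no link is due. Both 2^(v+1) and 2^(v+1) - 1 nodes start with a tree of rank
`v`; stripping it leads to the exponent `v`. -/
theorem shape_two_pow (v : ℕ) : shape (2 ^ v) = shape (2 ^ v - 1) ++ [0] := by
  induction v with
  | zero => rw [shape_eq_cons (i := 0)] <;> simp
  | succ v ih =>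
    have hv := Nat.two_pow_pos v
    have hv' : v = 0 ∨ 2 ≤ 2 ^ v := by
      rcases v with _ | v
      · simp
      · right; rw [pow_succ]; have := Nat.two_pow_pos v; omega
    rw [pow_succ]
    rw [shape_eq_cons (i := v) (N := 2 ^ v * 2) (by omega) (by omega) (by omega),
      shape_eq_cons (i := v) (N := 2 ^ v * 2 - 1) (by omega) (by omega) (by omega)]
    rw [show 2 ^ v * 2 - 2 ^ v = 2 ^ v by omega,
      show 2 ^ v * 2 - 1 - 2 ^ v = 2 ^ v - 1 by omega, ih, List.cons_append]

/-- When the number of nodes becomes `N`, two trees of size `2 ^ v` have to be linked, where `2 ^ v`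
is the largest power of two that divides `N`, unless `N` is a power of two. -/
theorem shape_increment (v m : ℕ) (hm : 1 ≤ m) : ∃ A B,
    shape (2 ^ v * (2 * m + 1)) = A ++ ([v + 1] ++ B) ∧
      shape (2 ^ v * (2 * m + 1) - 1) ++ [0] = A ++ ([v, v] ++ B) ∧
      weight A + 3 * 2 ^ v = 2 ^ v * (2 * m + 1) := by
  induction m using Nat.strong_induction_on with
  | _ m ih =>
    have hv := Nat.two_pow_pos v
    rcases hm.eq_or_lt with rfl | hm
    · have hv' : v = 0 ∨ 2 ≤ 2 ^ v := by
        rcases v with _ | v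
        · simp
        · right; rw [pow_succ]; have := Nat.two_pow_pos v; omega
      refine ⟨[], shape (2 ^ v), ?_, ?_, by simp; omega⟩
      · rw [shape_eq_cons (i := v + 1) (by positivity) (by rw [pow_succ]; omega)
          (by rw [pow_succ]; omega)]
        rw [show 2 ^ v * (2 * 1 + 1) - 2 ^ (v + 1) = 2 ^ v by rw [pow_succ]; omega]
        rfl
      · rw [shape_eq_cons (i := v) (by omega) (by omega) (by omega),
          show 2 ^ v * (2 * 1 + 1) - 1 - 2 ^ v = 2 ^ v * 2 - 1 by omega,
          shape_eq_cons (i := v) (N := 2 ^ v * 2 - 1) (by omega) (by omega) (by omega),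
          show 2 ^ v * 2 - 1 - 2 ^ v = 2 ^ v - 1 by omega, shape_two_pow]
        rfl
    · set N := 2 ^ v * (2 * m + 1) with hN
      -- For m ≥ 2 the forests with N and with N - 1 nodes start with the same tree, of rank above
      -- `v`. Removing it keeps the form 2^v·(odd number) and decreases m. The base case is N =
      -- 3·2^v.
      have hN₅ : 5 * 2 ^ v ≤ N := by rw [hN]; nlinarith
      have hlt := lt_three_mul_two_pow_topRank N
      have htop : v < topRank N := by
        by_contra h
        have := Nat.pow_le_pow_right (n := 2) (by norm_num) (not_lt.1 h)
        omega
      obtain ⟨s, hs⟩ : ∃ s, topRank N = v + 1 + s := ⟨topRank N - (v + 1), by omega⟩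
      have hle := (three_mul_two_pow_topRank_le N).resolve_left (by omega)
      have hpow : 2 ^ topRank N = 2 ^ v * (2 * 2 ^ s) := by rw [hs]; ring
      have hc : 3 * 2 ^ s ≤ 2 * m + 1 := by
        have : 2 ^ v * (6 * 2 ^ s) ≤ 2 ^ v * (2 * (2 * m + 1)) := by rw [hpow] at hle; nlinarith
        have := le_of_mul_le_mul_left this hv
        omega
      -- A gain of one by parity if s > 0, and by m ≥ 2 if s = 0. It ensures that N - 1 nodes still
      -- reach the threshold for the same first tree.
      have hc' : 3 * 2 ^ s ≤ 2 * m := by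
        rcases s with _ | s
        · simp; omega
        · rw [pow_succ] at hc ⊢; omega
      have hs' := Nat.two_pow_pos s
      have hle' : 3 * 2 ^ topRank N ≤ 2 * (N - 1) := by
        have : 2 ^ v * (3 * 2 ^ s) ≤ 2 ^ v * (2 * m) := Nat.mul_le_mul_left _ hc'
        have h₁ : N = 2 ^ v * (2 * m) + 2 ^ v := by rw [hN]; ring
        have h₂ : 3 * 2 ^ topRank N = 2 * (2 ^ v * (3 * 2 ^ s)) := by rw [hpow]; ring
        omega
      obtain ⟨A, B, h₁, h₂, h₃⟩ := ih (m - 2 ^ s) (by omega) (by omega)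
      have hrest : N - 2 ^ topRank N = 2 ^ v * (2 * (m - 2 ^ s) + 1) := by
        obtain ⟨d, hd⟩ : ∃ d, m = 2 ^ s + d := ⟨m - 2 ^ s, by omega⟩
        have : N = 2 ^ topRank N + 2 ^ v * (2 * d + 1) := by rw [hN, hpow, hd]; ring
        rw [hd, Nat.add_sub_cancel_left]; omega
      refine ⟨topRank N :: A, B, ?_, ?_, ?_⟩
      · rw [shape_of_pos (by omega), hrest, h₁]; rfl
      · rw [shape_eq_cons (N := N - 1) (by omega) (.inr hle') (by omega),
          show N - 1 - 2 ^ topRank N = N - 2 ^ topRank N - 1 by omega, hrest, List.cons_append, h₂]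
        rfl
      · rw [weight_cons, add_assoc, h₃, ← hrest]
        have := two_pow_topRank_le (N := N) (by omega)
        omega

/-- Subtracting one flips the lowest set bit and the zeros below it, and nothing else. -/
theorem xor_pred (v m : ℕ) :
    (2 ^ v * (2 * m + 1)) ^^^ (2 ^ v * (2 * m + 1) - 1) = 2 ^ (v + 1) - 1 := by
  induction v with
  | zero =>
    refine Nat.eq_of_testBit_eq fun i => ?_
    rcases i with _ | i
    · simp
    · have h₁ : (2 ^ 0 * (2 * m + 1)) / 2 = m := by omega
      have h₂ : (2 ^ 0 * (2 * m + 1) - 1) / 2 = m := by omega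
      rw [Nat.testBit_succ, Nat.xor_div_two, h₁, h₂]
      simp [Nat.testBit_succ]
  | succ v ih =>
    have h := Nat.two_pow_pos v
    have h' : 0 < 2 ^ v * (2 * m + 1) := by positivity
    have e : 2 ^ (v + 1) * (2 * m + 1) = 2 * (2 ^ v * (2 * m + 1)) := by ring
    have e' : 2 ^ (v + 1) = 2 * 2 ^ v := by ring
    rw [e, pow_succ 2 (v + 1)]
    refine Nat.eq_of_testBit_eq fun i => ?_
    rcases i with _ | i
    · simp
      omega
    · have h₁ : (2 * (2 ^ v * (2 * m + 1)) - 1) / 2 = 2 ^ v * (2 * m + 1) - 1 := by omega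
      have h₂ : (2 ^ (v + 1) * 2 - 1) / 2 = 2 ^ (v + 1) - 1 := by omega
      rw [Nat.testBit_succ, Nat.testBit_succ, Nat.xor_div_two, h₁, h₂,
        Nat.mul_div_cancel_left _ (by norm_num), ih]

end

/-! ### The two operations on canonical forests. -/

section

variable {α : Type u} [LinearOrder α] {w n : ℕ} {Q : (ℕ → ℕ) → (ℕ → α) → Prop} {g : ℕ → ℕ}
  {f : ℕ → α}

/-! ## Insertion -/

/-- For `e = 2 ^ v * (2 * m + 1)` the power of two `2 ^ v`. -/
def WExp.lowBit (e : WExp) : WExp := (.bin .xor e (e - 1) + 1) / 2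

theorem exists_eq_two_pow_mul_two_mul_add_one {N : ℕ} (hN : 0 < N) :
    ∃ v m, N = 2 ^ v * (2 * m + 1) := by
  obtain ⟨v, r, hr, h⟩ := Nat.exists_eq_two_pow_mul_odd hN.ne'
  obtain ⟨m, rfl⟩ := hr
  exact ⟨v, m, h⟩

theorem WExp.val_lowBit {e : WExp} {v m : ℕ} (h : e.val g = 2 ^ v * (2 * m + 1)) :
    e.lowBit.val g = 2 ^ v := by
  have := Nat.two_pow_pos v
  simp only [lowBit, val_div, val_add, val_xor, val_sub, val_one, val_two, h, xor_pred, pow_succ]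
  omega

theorem WExp.ok_lowBit {e : WExp} {B : ℕ} (h : e.Ok B g) (hB : 2 * e.val g + 2 < B)
    (he : 0 < e.val g) : e.lowBit.Ok B g := by
  obtain ⟨v, m, hvm⟩ := exists_eq_two_pow_mul_two_mul_add_one he
  have := Nat.two_pow_pos v
  have : 2 ^ v ≤ e.val g := by rw [hvm]; nlinarith
  simp only [lowBit, ok_div, ok_add, ok_xor, ok_sub, ok_one, ok_two, val_xor, val_sub, val_one]
  refine ⟨⟨⟨h, ⟨h, ?_⟩, ?_⟩, ?_, ?_⟩, ?_⟩
  all_goals first | omega | (rw [hvm, xor_pred, pow_succ]; omega)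

def insertProg : Prog :=
  .ifEq (.reg 0 % 3) 0
    (.seq (.assign 1 (.reg 0 / 3)) (.seq (.norm (.reg 1 - 1))
      (.seq (.assign 2 (WExp.lowBit (.reg 1)))
        (.ifLt (.reg 1) (3 * .reg 2) .skip
          (.link (.reg 1 - 3 * .reg 2) (.reg 1 - 2 * .reg 2))))))
    .skip

/-- Reduce the number of nodes of the forest in the array by one if there is no buffer. -/
def shrinkProg : Prog :=
  .ifEq (.reg 0 % 3) 0
    (.seq (.assign 1 (.reg 0 / 3)) (.seq (.assign 2 (WExp.lowBit (.reg 1)))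
      (.ifLt (.reg 1) (3 * .reg 2) .skip
        (.unlink (.reg 1 - 3 * .reg 2) (.reg 1 - 2 * .reg 2)))))
    .skip

theorem rbtAt_singleton {a : ℕ → Node α} {k : ℕ} (h : (a k).state = .isRoot) :
    ForestAt a k [0] :=
  ⟨⟨minAt_zero a k, h⟩, trivial⟩

/-- Here `n` already counts the new element. The forest changes only if this element completes a
node. -/
theorem WP.insertProg (hg : g 0 = n) (hw : 100 * (n + 1) ≤ 2 ^ w) (hn : 0 < n)
    (hf : ForestAt (nd f) 0 (shape ((n - 1) / 3)))
    (h : ∀ g' f', ForestAt (nd f') 0 (shape (n / 3)) → Q g' f') :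
    WP w n insertProg Q g f := by
  generalize hB : 2 ^ w = B at hw
  refine .ifEq ?_ ?_ (fun c => ?_) (fun c => .skip (h _ _ ?_))
  · simp only [hB, WExp.ok_mod, WExp.ok_reg, WExp.ok_three]; omega
  · simp only [hB, WExp.ok_zero]; omega
  · simp only [WExp.val_mod, WExp.val_reg, WExp.val_three, WExp.val_zero, hg] at c
    obtain ⟨N, rfl⟩ : ∃ N, n = 3 * N := ⟨n / 3, by omega⟩
    rw [show (3 * N - 1) / 3 = N - 1 by omega] at hf
    rw [show 3 * N / 3 = N by omega] at h
    refine .seq (.assign (by norm_num) ?_ (.seq (.norm (k := N - 1) ?_ ?_ ?_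
      fun f₁ off₁ same₁ root₁ => ?_)))
    · simp only [hB, WExp.ok_div, WExp.ok_reg, WExp.ok_three]; omega
    · simp [hg]
    · rw [hB]; simp [hg]; omega
    · omega
    have hf₁ : ForestAt (nd f₁) 0 (shape (N - 1) ++ [0]) := by
      rw [forestAt_append]
      refine ⟨hf.congr fun k _ hk => nd_congr fun j hj => off₁ j ?_, ?_⟩
      · rw [weight_shape] at hk; omega
      · rw [weight_shape, zero_add]; exact rbtAt_singleton root₁
    obtain ⟨v, m, hvm⟩ := exists_eq_two_pow_mul_two_mul_add_one (N := N) (by omega)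
    have hv := Nat.two_pow_pos v
    have hvN : 2 ^ v ≤ N := by rw [hvm]; nlinarith
    set g₁ := Function.update g 1 ((WExp.reg 0 / 3).val g) with hg₁
    have g₁1 : g₁ 1 = N := by simp [hg₁, hg]
    have g₁0 : g₁ 0 = 3 * N := by simp [hg₁, hg]
    have hlow : (WExp.lowBit (.reg 1)).val g₁ = 2 ^ v := WExp.val_lowBit (g₁1.trans hvm)
    refine .seq (.assign (by norm_num) ?_ ?_)
    · rw [hB]
      refine WExp.ok_lowBit ?_ ?_ ?_ <;> simp only [WExp.ok_reg, WExp.val_reg, g₁1] <;> omega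
    rw [hlow]
    refine .ifLt ?_ ?_ (fun c => .skip (h _ _ ?_)) (fun c => ?_)
    · simp [hB, g₁1]; omega
    · simp only [hB, WExp.ok_mul, WExp.ok_reg, WExp.ok_three, WExp.val_three, WExp.val_reg,
        Function.update_self]
      omega
    · simp [g₁1] at c
      -- An odd cofactor other than 1 is at least 3, so N < 3·2^v detects that N is a power of two.
      obtain rfl : m = 0 := by
        by_contra hm
        have : 2 ^ v * 3 ≤ N := by rw [hvm]; exact Nat.mul_le_mul_left _ (by omega)
        omega
      rw [hvm]
      rw [hvm] at hf₁
      simpa [shape_two_pow] using hf₁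
    · simp [g₁1] at c
      have hm : 1 ≤ m := by
        rcases m with _ | m
        · omega
        · omega
      obtain ⟨A, B', h₁, h₂, h₃⟩ := shape_increment v m hm
      rw [← hvm] at h₁ h₂ h₃
      rw [h₂] at hf₁
      have hf₂ := hf₁
      simp only [forestAt_append, zero_add] at hf₂
      -- Behind the two trees to be linked there are exactly 2^v nodes.
      have hs : 2 ^ v + (2 ^ v + 0) + weight B' = 3 * 2 ^ v := by
        have := congrArg weight h₁
        simp [pow_succ] at this
        omega
      refine .link (p := weight A) (i := v) ?_ ?_ ?_ ?_ (by omega) hf₂.2.1.1.1 hf₂.2.1.2.1.1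
        fun f₂ off₂ hr => h _ _ ?_
      · simp [g₁1]; omega
      · simp [g₁1]; omega
      · rw [hB]; simp [g₁1]; omega
      · rw [hB]; simp [g₁1]; omega
      · rw [h₁]
        refine hf₁.replace (by simp [pow_succ]; omega) ⟨hr, trivial⟩ fun k hk _ =>
          nd_congr_off off₂ k ?_ ?_
        · simp at hk; omega
        · simp at hk; omega
  · simp only [WExp.val_mod, WExp.val_reg, WExp.val_three, WExp.val_zero, hg] at c
    rwa [show n / 3 = (n - 1) / 3 by omega]

/-- Undoes the link that was due when the node count became N; the last node is then a tree of size
1 and is released. As the array still has `n` cells, one to three of them now lie behind the forest.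
-/
theorem WP.shrinkProg (hg : g 0 = n) (hw : 100 * (n + 1) ≤ 2 ^ w) (hn : 0 < n)
    (hf : ForestAt (nd f) 0 (shape (n / 3)))
    (h : ∀ g' f', g' 0 = n → ForestAt (nd f') 0 (shape ((n - 1) / 3)) → Q g' f') :
    WP w n shrinkProg Q g f := by
  generalize hB : 2 ^ w = B at hw
  refine .ifEq ?_ ?_ (fun c => ?_) (fun c => .skip (h _ _ hg ?_))
  · simp only [hB, WExp.ok_mod, WExp.ok_reg, WExp.ok_three]; omega
  · simp only [hB, WExp.ok_zero]; omega
  · simp only [WExp.val_mod, WExp.val_reg, WExp.val_three, WExp.val_zero, hg] at c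
    obtain ⟨N, rfl⟩ : ∃ N, n = 3 * N := ⟨n / 3, by omega⟩
    rw [show (3 * N - 1) / 3 = N - 1 by omega] at h
    rw [show 3 * N / 3 = N by omega] at hf
    refine .seq (.assign (by norm_num) ?_ ?_)
    · simp only [hB, WExp.ok_div, WExp.ok_reg, WExp.ok_three]; omega
    obtain ⟨v, m, hvm⟩ := exists_eq_two_pow_mul_two_mul_add_one (N := N) (by omega)
    have hv := Nat.two_pow_pos v
    have hvN : 2 ^ v ≤ N := by rw [hvm]; nlinarith
    set g₁ := Function.update g 1 ((WExp.reg 0 / 3).val g) with hg₁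
    have g₁1 : g₁ 1 = N := by simp [hg₁, hg]
    have g₁0 : g₁ 0 = 3 * N := by simp [hg₁, hg]
    have hlow : (WExp.lowBit (.reg 1)).val g₁ = 2 ^ v := WExp.val_lowBit (g₁1.trans hvm)
    refine .seq (.assign (by norm_num) ?_ ?_)
    · rw [hB]
      refine WExp.ok_lowBit ?_ ?_ ?_ <;> simp only [WExp.ok_reg, WExp.val_reg, g₁1] <;> omega
    rw [hlow]
    refine .ifLt ?_ ?_ (fun c => .skip (h _ _ (by simp [g₁0]) ?_)) (fun c => ?_)
    · simp [hB, g₁1]; omega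
    · simp only [hB, WExp.ok_mul, WExp.ok_reg, WExp.ok_three, WExp.val_three, WExp.val_reg,
        Function.update_self]
      omega
    · simp [g₁1] at c
      obtain rfl : m = 0 := by
        by_contra hm
        have : 2 ^ v * 3 ≤ N := by rw [hvm]; exact Nat.mul_le_mul_left _ (by omega)
        omega
      rw [hvm] at hf ⊢
      simp only [mul_zero, zero_add, mul_one, shape_two_pow] at hf ⊢
      exact (forestAt_append.1 hf).1
    · simp [g₁1] at c
      have hm : 1 ≤ m := by
        rcases m with _ | m
        · omega
        · omega
      obtain ⟨A, B', h₁, h₂, h₃⟩ := shape_increment v m hm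
      rw [← hvm] at h₁ h₂ h₃
      rw [h₁] at hf
      have hf₂ := hf
      simp only [forestAt_append, zero_add] at hf₂
      have hs : 2 ^ v + (2 ^ v + 0) + weight B' = 3 * 2 ^ v := by
        have := congrArg weight h₁
        simp [pow_succ] at this
        omega
      refine .unlink (p := weight A) (i := v) ?_ ?_ ?_ ?_ (by omega) hf₂.2.1.1.1
        fun f₂ off₂ hr hr' => h _ _ (by simp [g₁0]) ?_
      · simp [g₁1]; omega
      · simp [g₁1]; omega
      · rw [hB]; simp [g₁1]; omega
      · rw [hB]; simp [g₁1]; omega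
      · have : ForestAt (nd f₂) 0 (shape (N - 1) ++ [0]) := by
          rw [h₂]
          refine hf.replace (by simp [pow_succ]; omega) ⟨hr, hr', trivial⟩ fun k hk _ =>
            nd_congr_off off₂ k ?_ ?_
          · simp at hk; omega
          · simp [pow_succ] at hk; omega
        exact (forestAt_append.1 this).1
  · simp only [WExp.val_mod, WExp.val_reg, WExp.val_three, WExp.val_zero, hg] at c
    rwa [← show n / 3 = (n - 1) / 3 by omega]

end

section

variable {α : Type u} [LinearOrder α] {w n : ℕ} {Q : (ℕ → ℕ) → (ℕ → α) → Prop} {g : ℕ → ℕ}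
  {f : ℕ → α} {p q : Prog} {K : ℕ}

/-! ## Programs with loops that make at most `K` rounds -/

theorem WP.bounded (h : WP w n p Q g f) (hp : p.LoopFree) (hK : 0 < K) :
    WPT w n p (K * p.size) Q g f :=
  (h.timed hp).mono (Nat.le_mul_of_pos_left _ hK) fun _ _ h => h

/-- Sizes add up under composition, and so do bounds of the form `K * size`; times of consecutive
programs need no separate tracking. -/
theorem WPT.seq_bounded (h : WPT w n p (K * p.size) (fun g f => WPT w n q (K * q.size) Q g f) g f) :
    WPT w n (.seq p q) (K * (Prog.seq p q).size) Q g f := by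
  rw [Prog.size, mul_add]
  exact h.seq

theorem WP.seq_bounded (hK : 0 < K) (hp : p.LoopFree)
    (h : WP w n p (fun g f => WPT w n q (K * q.size) Q g f) g f) :
    WPT w n (.seq p q) (K * (Prog.seq p q).size) Q g f :=
  (h.bounded hp hK).seq_bounded

theorem WPT.whileLt_bounded {a b : WExp} (I : ℕ → (ℕ → ℕ) → (ℕ → α) → Prop) (hp : p.LoopFree)
    (h : ∀ k g f, I k g f → a.Ok (2 ^ w) g ∧ b.Ok (2 ^ w) g ∧
      (a.val g < b.val g → WP w n p (fun g' f' => ∃ k' < k, I k' g' f') g f) ∧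
      (b.val g ≤ a.val g → Q g f)) {k : ℕ} (hI : I k g f) (hk : k < K) :
    WPT w n (.whileLt a b p) (K * (Prog.whileLt a b p).size) Q g f :=
  (WPT.whileLt I hp h hI).mono (Nat.mul_le_mul_right _ hk) fun _ _ h => h

theorem WPT.ifEq_bounded {a b : WExp} (ha : a.Ok (2 ^ w) g) (hb : b.Ok (2 ^ w) g) (hK : 0 < K)
    (h₁ : a.val g = b.val g → WPT w n p (K * p.size) Q g f)
    (h₂ : a.val g ≠ b.val g → WPT w n q (K * q.size) Q g f) :
    WPT w n (.ifEq a b p q) (K * (Prog.ifEq a b p q).size) Q g f := by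
  intro s hs
  obtain ⟨s₁, t₁, m₁, e₁, hva, hvb, hs₁, ha₁⟩ := exec_compile_pair hs ha hb
  have b₁ := e₁.time_le_size ⟨a.loopFree_compile _, b.loopFree_compile _⟩
  have b₂ : (Prog.seq (a.compile 32) (b.compile 33)).size + 1 ≤
    K * ((Prog.seq (a.compile 32) (b.compile 33)).size + 1) := Nat.le_mul_of_pos_left _ hK
  have b₃ : K * (Prog.ifEq a b p q).size =
      K * ((Prog.seq (a.compile 32) (b.compile 33)).size + 1) + K * p.size + K * q.size := by
    simp only [Prog.ifEq, Prog.size]; ring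
  by_cases hab : a.val g = b.val g
  · obtain ⟨s', t, m, g', f', k₁, k₀, k₂, k₃, k₄⟩ := h₁ hab s₁ hs₁
    exact ⟨s', _, _, g', f', .seq _ _ _ _ _ _ _ _ _ e₁
      (.iteTrue _ _ _ _ _ _ _ (by simp [Test.eval, hva, hvb, hab]) k₁), by omega, k₂, ha₁ ▸ k₃, k₄⟩
  · obtain ⟨s', t, m, g', f', k₁, k₀, k₂, k₃, k₄⟩ := h₂ hab s₁ hs₁
    exact ⟨s', _, _, g', f', .seq _ _ _ _ _ _ _ _ _ e₁
      (.iteFalse _ _ _ _ _ _ _ (by simp [Test.eval, hva, hvb, hab]) k₁), by omega, k₂, ha₁ ▸ k₃,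
      k₄⟩

/-! ## Finding the minimum -/

theorem RBTAt.le_cell {i k : ℕ} (h : RBTAt (nd f) i k) {c : ℕ} (h₁ : 3 * k ≤ c)
    (h₂ : c < 3 * (k + 2 ^ i)) : f (3 * k) ≤ f c := by
  have := h.1.2 (c / 3) (by omega) (by omega) (f c) (mem_elems_nd.2 ⟨c, rfl, rfl⟩)
  rwa [Node.key_eq_of_isRoot h.2] at this

/-- The cell `c` holds the smallest of the elements in the buffer, which begins behind the `M` nodes
of the forest, and the first `k` nodes.  If `z` is not zero, it is the first cell of a tree of size
`z`. -/
structure BestCell (f : ℕ → α) (n M k c z : ℕ) : Prop where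
  lt : c < n
  le : ∀ d < n, d < 3 * k ∨ 3 * M ≤ d → f c ≤ f d
  kind : (z = 0 ∧ 3 * M ≤ c) ∨
    ∃ I A B, z = 2 ^ I ∧ shape M = A ++ ([I] ++ B) ∧ c = 3 * weight A

/-- The first cell of a relaxed binomial tree holds its minimum, so one comparison accounts for the
whole tree. -/
theorem BestCell.step {M k c z i : ℕ} {A B : List ℕ} (hb : BestCell f n M k c z)
    (hf : ForestAt (nd f) 0 (shape M)) (hs : shape M = A ++ ([i] ++ B)) (hA : weight A = k)
    (hn : 3 * M < n) :
    (f (3 * k) < f c → BestCell f n M (k + 2 ^ i) (3 * k) (2 ^ i)) ∧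
      (f c ≤ f (3 * k) → BestCell f n M (k + 2 ^ i) c z) := by
  have hw := congrArg weight hs
  simp at hw
  have hi := Nat.two_pow_pos i
  have ht : RBTAt (nd f) i k := by
    rw [hs] at hf
    simp only [forestAt_append, zero_add, hA] at hf
    exact hf.2.1.1
  constructor
  · intro h
    refine ⟨by omega, fun d hd hd' => ?_, .inr ⟨i, A, B, rfl, hs, by rw [hA]⟩⟩
    by_cases h' : d < 3 * k ∨ 3 * M ≤ d
    · exact h.le.trans (hb.le d hd h')
    · exact ht.le_cell (by omega) (by omega)
  · intro h
    refine ⟨hb.lt, fun d hd hd' => ?_, hb.kind⟩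
    by_cases h' : d < 3 * k ∨ 3 * M ≤ d
    · exact hb.le d hd h'
    · exact h.trans (ht.le_cell (by omega) (by omega))

/-- Consider the cell that is `e` cells from the end, unless `a` tells that it is no buffer cell. -/
def bufferStepProg (a e : WExp) : Prog :=
  .ifLt a (.reg 0 - 1) (.ifCell (.reg 0 - e) (.reg 3) (.assign 3 (.reg 0 - e)) .skip) .skip

def bufferProg : Prog :=
  .seq (.assign 1 ((.reg 0 - 1) / 3)) (.seq (.assign 5 0) (.seq (.assign 3 (.reg 0 - 1))
    (.seq (bufferStepProg (3 * .reg 1) 2) (.seq (bufferStepProg (3 * .reg 1 + 1) 3)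
    (.seq (.assign 6 1) (.assign 7 0))))))

def largestTreeProg : Prog := .whileLt (3 * .reg 6) (.reg 1 + 1) (.assign 6 (2 * .reg 6))

def tryTreeProg : Prog :=
  .seq (.ifCell (3 * .reg 7) (.reg 3) (.seq (.assign 3 (3 * .reg 7)) (.assign 5 (.reg 6))) .skip)
    (.assign 7 (.reg 7 + .reg 6))

def scanStepProg : Prog :=
  .ifLt (2 * (.reg 1 - .reg 7)) (3 * .reg 6)
    (.ifEq (.reg 6) 1 tryTreeProg (.assign 6 (.reg 6 / 2))) tryTreeProg

def scanProg : Prog := .whileLt (.reg 7) (.reg 1) scanStepProg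

/-- Put the smallest cell into register `3`; if it is not in the buffer, it is the first one of a
tree, and its size is put into register `5`. -/
def findProg : Prog := .seq bufferProg (.seq largestTreeProg scanProg)

/-- Register `3` points to the smallest of the buffer cells among the last `j` cells. -/
structure BufferInv (f : ℕ → α) (n M j : ℕ) (g : ℕ → ℕ) : Prop where
  len : g 0 = n
  forest : g 1 = M
  size : g 5 = 0
  lt : g 3 < n
  ge : 3 * M ≤ g 3
  le : ∀ d < n, 3 * M ≤ d → n ≤ d + j → f (g 3) ≤ f d

/-- The cell n - (j + 1) belongs to the buffer if and only if 3M + j - 1 < n - 1. Testing this form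
first makes truncated subtraction harmless. -/
theorem WP.bufferStepProg {M j : ℕ} {a e : WExp} (hg : BufferInv f n M j g) (hj : 0 < j)
    (ha : a.Ok (2 ^ w) g) (hav : a.val g + 1 = 3 * M + j) (he : e.Ok (2 ^ w) g)
    (hev : e.val g = j + 1) (hw : n < 2 ^ w)
    (h : ∀ g', BufferInv f n M (j + 1) g' → Q g' f) :
    WP w n (bufferStepProg a e) Q g f := by
  obtain ⟨h₀, h₁, h₅, hc, hMc, hle⟩ := hg
  generalize hB : 2 ^ w = B at hw
  refine .ifLt ha ?_ (fun b₁ => .ifCell ?_ ?_ ?_ ?_ (fun b₂ => .assign (by norm_num) ?_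
    (h _ ?_)) (fun b₂ => .skip (h _ ?_))) (fun b₁ => .skip (h _ ?_))
  · rw [hB]; simp [h₀]; omega
  · rw [hB]; rw [hB] at he; simp [h₀, he]; omega
  · rw [hB]; simp; omega
  · simp [h₀]; omega
  · simpa
  · rw [hB]; rw [hB] at he; simp [h₀, he]; omega
  · simp only [WExp.val_sub, WExp.val_reg, WExp.val_one, h₀, hev] at b₁ b₂
    refine ⟨by simpa, by simpa, by simpa, ?_, ?_, fun d hd hd' hd'' => ?_⟩ <;>
      simp only [Function.update_self, WExp.val_sub, WExp.val_reg, h₀, hev]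
    · omega
    · omega
    by_cases h : n ≤ d + j
    · exact b₂.le.trans (hle d hd hd' h)
    · rw [show d = n - (j + 1) by omega]
  · simp only [WExp.val_sub, WExp.val_reg, WExp.val_one, h₀, hev] at b₁ b₂
    refine ⟨h₀, h₁, h₅, hc, hMc, fun d hd hd' hd'' => ?_⟩
    by_cases h : n ≤ d + j
    · exact hle d hd hd' h
    · rw [show d = n - (j + 1) by omega]; exact b₂
  · simp only [WExp.val_sub, WExp.val_reg, WExp.val_one, h₀] at b₁
    exact ⟨h₀, h₁, h₅, hc, hMc, fun d hd hd' hd'' => hle d hd hd' (by omega)⟩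

theorem WP.bufferProg (hg : g 0 = n) (hw : 100 * (n + 1) ≤ 2 ^ w) (hn : 0 < n)
    (h : ∀ g', g' 0 = n → g' 1 = (n - 1) / 3 → g' 6 = 1 → g' 7 = 0 →
      BestCell f n ((n - 1) / 3) 0 (g' 3) (g' 5) → Q g' f) :
    WP w n bufferProg Q g f := by
  generalize hB : 2 ^ w = B at hw
  refine .seq (.assign (by norm_num) ?_ (.seq (.assign (by norm_num) ?_
    (.seq (.assign (by norm_num) ?_ (.seq (.bufferStepProg (M := (n - 1) / 3) (j := 1)
      ⟨?_, ?_, ?_, ?_, ?_, ?_⟩ one_pos ?_ ?_ ?_ rfl (by omega)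
      fun g₁ h₁ => .seq (.bufferStepProg (j := 2) h₁ two_pos ?_ ?_ ?_ rfl (by omega)
      fun g₂ h₂ => .seq (.assign (by norm_num) ?_ (.assign (by norm_num) ?_
        (h _ ?_ ?_ ?_ ?_ ?_)))))))))))
  · rw [hB]; simp [hg]; omega
  · rw [hB]; simp; omega
  · rw [hB]; simp [hg]; omega
  · simpa
  · simp [hg]
  · simp
  · simp [hg]; omega
  · simp [hg]; omega
  · intro d hd hd' hd''
    simp only [Function.update_self, WExp.val_sub, WExp.val_reg, WExp.val_one, ne_eq,
      OfNat.zero_ne_ofNat, not_false_eq_true, Function.update_of_ne, hg, zero_ne_one]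
    rw [show d = n - 1 by omega]
  · rw [hB]; simp [hg]; omega
  · simp [hg]
  · rw [hB]; simp; omega
  · rw [hB]; simp [h₁.forest]; omega
  · simp [h₁.forest]
  · rw [hB]; simp; omega
  · rw [hB]; simp; omega
  · rw [hB]; simp; omega
  · simpa using h₂.len
  · simpa using h₂.forest
  · simp
  · simp
  · simp only [ne_eq, Nat.reduceEqDiff, not_false_eq_true, Function.update_of_ne]
    exact ⟨h₂.lt, fun d hd hd' => h₂.le d hd (by omega) (by omega), .inl ⟨h₂.size, h₂.ge⟩⟩

theorem WPT.largestTreeProg {N : ℕ} (hN : g 1 = N) (hNn : N < n) (h6 : g 6 = 1)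
    (hw : 100 * (n + 1) ≤ 2 ^ w) (hK : Nat.log 2 n + 1 < K)
    (h : ∀ i, N < 3 * 2 ^ i → 2 ^ i ≤ n → Q (Function.update g 6 (2 ^ i)) f) :
    WPT w n largestTreeProg (K * largestTreeProg.size) Q g f := by
  generalize hB : 2 ^ w = B at hw
  refine .whileLt_bounded (fun k g' f' => f' = f ∧ ∃ i, g' = Function.update g 6 (2 ^ i) ∧
    2 ^ i ≤ n ∧ i + k = Nat.log 2 n + 1) (by simp) ?_
    (k := Nat.log 2 n + 1) ⟨rfl, 0, ?_, ?_, ?_⟩ hK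
  · rintro k _ _ ⟨rfl, i, rfl, hi, hk⟩
    have hlog : i ≤ Nat.log 2 n := Nat.le_log_of_pow_le (by norm_num) hi
    refine ⟨?_, ?_, fun c => .assign (by norm_num) ?_ ⟨k - 1, by omega, rfl, i + 1, ?_, ?_, ?_⟩,
      fun c => h i ?_ hi⟩
    · rw [hB]; simp; omega
    · rw [hB]; simp [hN]; omega
    · rw [hB]; simp; omega
    · simp [pow_succ, mul_comm]
    · simp [hN] at c; rw [pow_succ]; omega
    · omega
    · simp [hN] at c; omega
  · simp [← h6]
  · simp; omega
  · simp

/-- The trees before node `g 7` have been considered. -/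
structure ScanInv (f : ℕ → α) (n M k : ℕ) (g : ℕ → ℕ) (i : ℕ) (A : List ℕ) : Prop where
  len : g 0 = n
  forest : g 1 = M
  size : g 6 = 2 ^ i
  size_le : 2 ^ i ≤ n
  node : g 7 = weight A
  node_le : weight A ≤ M
  shape : shape M = A ++ shape (M - weight A)
  rest : M - weight A < 3 * 2 ^ i
  best : BestCell f n M (weight A) (g 3) (g 5)
  -- Fewer than 3·2^i nodes remain, so the two indicators count how many trees of size 2^i still
  -- fit. With the halving of the size this gives at most three rounds per rank.
  rounds : 3 * i + (if 2 ^ i ≤ M - weight A then 1 else 0) +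
    (if 2 * 2 ^ i ≤ M - weight A then 1 else 0) ≤ k

theorem WP.tryTreeProg {M k i : ℕ} {A : List ℕ} (hI : ScanInv f n M k g i A)
    (hM : weight A < M) (hi : i = 0 ∨ 3 * 2 ^ i ≤ 2 * (M - weight A))
    (hw : 100 * (n + 1) ≤ 2 ^ w) (hn : 3 * M < n) (hf : ForestAt (nd f) 0 (ImplicitPQ.shape M))
    (h : ∀ k' < k, ∀ g' A', ScanInv f n M k' g' i A' → Q g' f) :
    WP w n tryTreeProg Q g f := by
  generalize hB : 2 ^ w = B at hw
  obtain ⟨h₀, h₁, h₆, hin, h₇, hA, hs, hr, hb, hk⟩ := hI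
  have h2 := Nat.two_pow_pos i
  have hiM : 2 ^ i ≤ M - weight A := by
    rcases hi with rfl | hi
    · simp; omega
    · omega
  rw [if_pos hiM] at hk
  have hs' : ImplicitPQ.shape M = A ++ ([i] ++ ImplicitPQ.shape (M - weight (A ++ [i]))) := by
    rw [hs, shape_eq_cons (by omega) hi hr]
    simp [Nat.sub_sub]
  have hstep := hb.step hf hs' rfl hn
  have hlt := hb.lt
  have key : ∀ g' : ℕ → ℕ, g' 0 = n → g' 1 = M → g' 6 = 2 ^ i → g' 7 = weight A →
      BestCell f n M (weight A + 2 ^ i) (g' 3) (g' 5) →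
      WP w n (.assign 7 (.reg 7 + .reg 6)) Q g' f := by
    intro g' h₀ h₁ h₆ h₇ hb
    refine .assign (by norm_num) ?_ (h (k - 1) (by omega) _ (A ++ [i])
      ⟨?_, ?_, ?_, hin, ?_, ?_, ?_, ?_, ?_, ?_⟩)
    · rw [hB]; simp [h₆, h₇]; omega
    · simpa
    · simpa
    · simpa
    · simp [h₆, h₇]
    · simp; omega
    · rw [List.append_assoc]; exact hs'
    · simp; omega
    · simpa using hb
    · have : weight (A ++ [i]) = weight A + 2 ^ i := by simp
      rw [this]
      split_ifs at hk ⊢ <;> omega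
  refine .seq (.ifCell ?_ ?_ ?_ ?_ (fun c => .seq (.assign (by norm_num) ?_
    (.assign (by norm_num) ?_ (key _ ?_ ?_ ?_ ?_ ?_)))) (fun c => .skip (key _ h₀ h₁ h₆ h₇ ?_)))
  · rw [hB]; simp [h₇]; omega
  · rw [hB]; simp; omega
  · simp [h₇]; omega
  · simpa
  · rw [hB]; simp [h₇]; omega
  · rw [hB]; simp [h₆]; omega
  · simpa
  · simpa
  · simpa
  · simpa
  · simp [h₇] at c
    simpa [h₆, h₇] using hstep.1 c
  · simp [h₇] at c
    exact hstep.2 c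

theorem WPT.scanProg {M i : ℕ} {A : List ℕ} {k : ℕ} (hI : ScanInv f n M k g i A) (hk : k < K)
    (hw : 100 * (n + 1) ≤ 2 ^ w) (hn : 3 * M < n) (hf : ForestAt (nd f) 0 (ImplicitPQ.shape M))
    (h : ∀ g', g' 0 = n → BestCell f n M M (g' 3) (g' 5) → Q g' f) :
    WPT w n scanProg (K * scanProg.size) Q g f := by
  generalize hB : 2 ^ w = B at hw
  refine .whileLt_bounded (fun k g' f' => f' = f ∧ ∃ i A, ScanInv f n M k g' i A)
    (by simp [scanStepProg, tryTreeProg]) ?_ ⟨rfl, i, A, hI⟩ hk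
  rintro k g' _ ⟨rfl, i, A, hI⟩
  have hI' := hI
  obtain ⟨h₀, h₁, h₆, hin, h₇, hA, hs, hr, hb, hk⟩ := hI'
  have h2 := Nat.two_pow_pos i
  refine ⟨?_, ?_, fun c => .ifLt ?_ ?_ (fun c₁ => .ifEq ?_ ?_ (fun c₂ => ?_) (fun c₂ =>
    .assign (by norm_num) ?_ ?_)) (fun c₁ => ?_), fun c => h g' h₀ ?_⟩
  · rw [hB]; simp [h₇]; omega
  · rw [hB]; simp [h₁]; omega
  · rw [hB]; simp [h₁, h₇]; omega
  · rw [hB]; simp [h₆]; omega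
  · rw [hB]; simp [h₆]; omega
  · rw [hB]; simp; omega
  · simp only [WExp.val_reg, WExp.val_one, h₆] at c₂
    have : i = 0 := by
      rcases i with _ | i
      · rfl
      · rw [pow_succ] at c₂; omega
    simp [h₇, h₁] at c
    exact .tryTreeProg hI c (.inl this) (hB ▸ hw) hn hf
      fun k' hk' g' A' hI' => ⟨k', hk', rfl, i, A', hI'⟩
  · rw [hB]; simp [h₆]; omega
  · simp [h₆, h₇, h₁] at c c₁ c₂
    obtain ⟨i, rfl⟩ := Nat.exists_eq_succ_of_ne_zero c₂
    have h2 := Nat.two_pow_pos i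
    simp only [Nat.succ_eq_add_one, pow_succ] at *
    refine ⟨k - 1, ?_, trivial, i, A, ?_, ?_, ?_, ?_, ?_, ?_, ?_, ?_, ?_, ?_⟩
    · omega
    · simpa
    · simpa
    · simp [h₆]
    · omega
    · simpa
    · omega
    · exact hs
    · omega
    · simpa using hb
    · split_ifs <;> omega
  · simp [h₆, h₇, h₁] at c c₁
    exact .tryTreeProg hI c (.inr (by omega)) (hB ▸ hw) hn hf
      fun k' hk' g' A' hI' => ⟨k', hk', rfl, i, A', hI'⟩
  · simp [h₇, h₁] at c
    rwa [show weight A = M by omega] at hb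

theorem WPT.findProg (hg : g 0 = n) (hw : 100 * (n + 1) ≤ 2 ^ w) (hn : 0 < n)
    (hf : ForestAt (nd f) 0 (shape ((n - 1) / 3))) (hK : 3 * Nat.log 2 n + 2 < K)
    (h : ∀ g', g' 0 = n →
      BestCell f n ((n - 1) / 3) ((n - 1) / 3) (g' 3) (g' 5) → Q g' f) :
    WPT w n findProg (K * findProg.size) Q g f := by
  refine WP.seq_bounded (by omega) (by simp [bufferProg, bufferStepProg])
    (WP.bufferProg hg hw hn fun g₁ h₀ h₁ h₆ h₇ hb => WPT.seq_bounded
    (WPT.largestTreeProg h₁ (by omega) h₆ hw (by omega) fun i hi hin =>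
      WPT.scanProg (k := 3 * Nat.log 2 n + 2) (i := i) (A := [])
      ⟨by simpa, by simpa, by simp, hin, by simpa, by simp, by simp, by simpa, by simpa, ?_⟩ hK hw
      (by omega) hf h))
  have hlog : i ≤ Nat.log 2 n := Nat.le_log_of_pow_le (by norm_num) hin
  split_ifs <;> omega

end

section

variable {α : Type u} [LinearOrder α] {w n : ℕ} {Q Q' : (ℕ → ℕ) → (ℕ → α) → Prop} {g : ℕ → ℕ}
  {f : ℕ → α} {K : ℕ}

/-! ## Removing the minimum -/

/-- Follow the root of the tree of size `g 5` at node `g 4` while all links are undone; its offset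
is put into register `8`. -/
def descendProg : Prog :=
  .whileLt 0 (.reg 9)
    (.seq (.ifSmallerMin (.reg 4 + .reg 8 + .reg 9)
      (.seq (.swapNodes (.reg 4 + .reg 8) (.reg 4 + .reg 8 + .reg 9))
        (.assign 8 (.reg 8 + .reg 9))) .skip)
    (.assign 9 (.reg 9 / 2)))

/-- Redo the links. -/
def ascendProg : Prog :=
  .whileLt (.reg 9) (.reg 5)
    (.seq (.ifEq (.reg 8 / .reg 9 % 2) 1 (.assign 8 (.reg 8 - .reg 9)) .skip)
    (.seq (.link (.reg 4 + .reg 8) (.reg 4 + .reg 8 + .reg 9)) (.assign 9 (2 * .reg 9))))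

/-- Move the root of the tree in register `3` to the last cell. -/
def removeRootProg : Prog :=
  .seq (.assign 4 (.reg 3 / 3)) (.seq (.assign 8 0) (.seq (.assign 9 (.reg 5 / 2))
    (.seq descendProg (.seq (.swap (3 * (.reg 4 + .reg 8)) (.reg 0 - 1))
      (.seq (.norm (.reg 4 + .reg 8)) (.seq (.assign 9 1) ascendProg))))))

def extractProg : Prog :=
  .seq shrinkProg (.seq findProg (.ifEq (.reg 5) 0 (.swap (.reg 3) (.reg 0 - 1)) removeRootProg))

/-- The cells `f'` arise from `f` by operations on the tree of size `2 ^ I` at node `p`. -/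
def OffTree (f f' : ℕ → α) (I p : ℕ) : Prop :=
  ∀ c, c / 3 < p ∨ p + 2 ^ I ≤ c / 3 → f' c = f c

/-- The halved power in `step` is zero exactly for `j = 0`, which ends the loop. By `hole`, the
followed node still carries the original minimum in its first cell. -/
structure DescendInv (f : ℕ → α) (n I p j : ℕ) (g : ℕ → ℕ) (f' : ℕ → α) : Prop where
  len : g 0 = n
  node : g 4 = p
  size : g 5 = 2 ^ I
  step : g 9 = 2 ^ j / 2
  path : Path (nd f') I p j (p + g 8)
  rlx : RlxAt (nd f') j (p + g 8)
  hole : f' (3 * (p + g 8)) = f (3 * p)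
  off : OffTree f f' I p

theorem Path.add_le {a : ℕ → Node α} {I p j h : ℕ} (hp : Path a I p j h) :
    h + 2 ^ j ≤ p + 2 ^ I :=
  hp.bounds.2.choose_spec.2

/-- In each round, a last child in state `smallerMin` takes the place of the root, which moves on to
the right half; otherwise the root stays in the left half. The half left behind is minimal at its
root. States are not restored here, since `MinAt` ignores that of the root. -/
theorem WPT.descendProg {I p j : ℕ} (hI : DescendInv f n I p j g f) (hj : j < K)
    (hw : 100 * (n + 1) ≤ 2 ^ w) (hn : 3 * (p + 2 ^ I) ≤ n)
    (h : ∀ g' f', DescendInv f n I p 0 g' f' → Q g' f') :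
    WPT w n descendProg (K * descendProg.size) Q g f := by
  generalize hB : 2 ^ w = B at hw
  refine .whileLt_bounded (fun j g' f' => DescendInv f n I p j g' f') (by simp) ?_ hI hj
  intro j g f' hI
  have hI' := hI
  obtain ⟨h₀, h₄, h₅, h₉, hp, hr, hh, ho⟩ := hI'
  have hle := hp.add_le
  refine ⟨?_, ?_, fun c => ?_, fun c => h _ _ ?_⟩
  · rw [hB]; simp; omega
  · rw [hB]; simp; omega
  · rcases j with _ | j
    · simp [h₉] at c
    have h2 := Nat.two_pow_pos j
    rw [pow_succ] at h₉ hle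
    rw [Nat.mul_div_cancel _ two_pos] at h₉
    have fin : ∀ (g' : ℕ → ℕ) f'', g' 9 = 2 ^ j → (∀ g'', g'' = Function.update g' 9 (2 ^ j / 2) →
        DescendInv f n I p j g'' f'') → WP w n (.assign 9 (.reg 9 / 2))
          (fun g' f' => ∃ k' < j + 1, DescendInv f n I p k' g' f') g' f'' := by
      intro g' f'' h' h
      refine .assign (by norm_num) ?_ ⟨j, by omega, h _ (by simp [h'])⟩
      rw [hB]; simp [h']; omega
    have ok : (3 * (.reg 4 + .reg 8 + .reg 9) + 2 : WExp).Ok (2 ^ w) g := by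
      rw [hB]; simp [h₄, h₉]; omega
    have ok' : (3 * (.reg 4 + .reg 8) + 2 : WExp).Ok (2 ^ w) g := by
      rw [hB]; simp [h₄]; omega
    refine .seq (.ifSmallerMin (k := p + g 8 + 2 ^ j) (by simp [h₄, h₉]) ok (by omega)
      (fun c₁ => .seq (.swapNodes (k := p + g 8) (k' := p + g 8 + 2 ^ j) (by simp [h₄])
        (by simp [h₄, h₉]) ok' ok (by omega) (by omega) (by omega) fun f₁ off₁ e₁ e₂ =>
        .assign (by norm_num) ?_ (fin _ _ (by simp [h₉]) ?_)))
      (fun c₁ => .skip (fin _ _ h₉ ?_)))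
    · rw [hB]; simp [h₉]; omega
    · rintro g'' rfl
      have off := nd_congr_off off₁
      refine ⟨by simpa, by simpa, by simpa, by simp, ?_, ?_, ?_, ?_⟩
      · simp [h₉]
        rw [← add_assoc]
        refine .right (hp.congr fun k _ _ hk => off k (by omega) ?_)
          (hr.minAt_of_eq c₁ ?_ fun k _ _ => off k (by omega) (by omega))
        · rw [pow_succ] at hk; omega
        · rw [e₁]; exact .refl _
      · simp [h₉]
        rw [← add_assoc]
        exact hr.2.1.congr fun k _ _ => off k (by omega) (by omega)
      · simp [h₉]
        rw [← add_assoc]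
        exact (congrArg Prod.fst e₂).trans hh
      · intro c hc
        rw [off₁ c (by omega) (by omega)]
        exact ho c hc
    · rintro g'' rfl
      refine ⟨by simpa, by simpa, by simpa, by simp, ?_, ?_, ?_, ?_⟩
      · simpa using hp.left (hr.minAt_of_ne c₁)
      · simpa using hr.1
      · simpa using hh
      · exact ho
  · simp [h₉] at c
    obtain rfl : j = 0 := by
      rcases j with _ | j
      · rfl
      · have h2 := Nat.two_pow_pos j
        rw [pow_succ] at c; omega
    exact hI

structure AscendInv (f : ℕ → α) (n I p j : ℕ) (g : ℕ → ℕ) (f' : ℕ → α) : Prop where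
  len : g 0 = n
  node : g 4 = p
  size : g 5 = 2 ^ I
  step : g 9 = 2 ^ j
  path : Path (nd f') I p j (p + g 8)
  rbt : RBTAt (nd f') j (p + g 8)
  off : OffTree f f' I p

/-- Bit `j` of the offset in register 8 tells whether the current subtree is a left or a right half,
so O(1) registers remember the whole path. -/
theorem WPT.ascendProg {I p j : ℕ} (hI : AscendInv f n I p j g f) (hK : I < K)
    (hw : 100 * (n + 1) ≤ 2 ^ w) (hn : 3 * (p + 2 ^ I) ≤ n)
    (h : ∀ g' f', g' 0 = n → RBTAt (nd f') I p → OffTree f f' I p → Q g' f') :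
    WPT w n ascendProg (K * ascendProg.size) Q g f := by
  generalize hB : 2 ^ w = B at hw
  refine .whileLt_bounded (fun k g' f' => ∃ j, AscendInv f n I p j g' f' ∧ j + k = I)
    (by simp) ?_ (k := I - j) ⟨j, hI, by have := hI.path.bounds.1; omega⟩ (by omega)
  rintro k g f' ⟨j, ⟨h₀, h₄, h₅, h₉, hp, hr, ho⟩, hk⟩
  have hle := hp.add_le
  have h2 := Nat.two_pow_pos j
  refine ⟨?_, ?_, fun c => ?_, fun c => h _ _ h₀ ?_ ho⟩
  · rw [hB]; simp; omega
  · rw [hB]; simp; omega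
  · have fin : ∀ (g' : ℕ → ℕ) (r : ℕ), g' 0 = n → g' 4 = p → g' 5 = 2 ^ I → g' 9 = 2 ^ j →
        g' 8 = r → Path (nd f') I p (j + 1) (p + r) → MinAt (nd f') j (p + r) →
        MinAt (nd f') j (p + r + 2 ^ j) →
        WP w n (.seq (.link (.reg 4 + .reg 8) (.reg 4 + .reg 8 + .reg 9)) (.assign 9 (2 * .reg 9)))
          (fun g' f' => ∃ k' < k, ∃ j, AscendInv f n I p j g' f' ∧ j + k' = I) g' f' := by
      intro g' r h₀ h₄ h₅ h₉ h₈ hp m₁ m₂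
      have hle := hp.add_le
      have hj := hp.bounds.1
      rw [pow_succ] at hle
      refine .seq (.link (p := p + r) (i := j) (by simp [h₄, h₈]) (by simp [h₄, h₈, h₉])
        (by rw [hB]; simp [h₄, h₈]; omega) (by rw [hB]; simp [h₄, h₈, h₉]; omega) (by omega) m₁ m₂
        fun f₁ off₁ hr => .assign (by norm_num) (by rw [hB]; simp [h₉]; omega)
          ⟨k - 1, by omega, j + 1, ⟨by simpa, by simpa, by simpa, ?_, ?_, ?_, ?_⟩, by omega⟩)
      · simp [h₉, pow_succ, mul_comm]
      · simp [h₈]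
        exact hp.congr fun m _ _ hm => nd_congr_off off₁ m (by rw [pow_succ] at hm; omega)
          (by rw [pow_succ] at hm; omega)
      · simpa [h₈]
      · intro c hc
        rw [off₁ c (by omega) (by omega)]
        exact ho c hc
    have hdiv : ∀ m, g 8 = m * 2 ^ j → g 8 / g 9 % 2 = m % 2 := fun m hm => by
      rw [hm, h₉, Nat.mul_div_cancel _ h2]
    generalize hh : p + g 8 = h at hp hr hle
    cases hp with
    | base =>
      simp [h₉, h₅] at c
    | left hp hm =>
      obtain ⟨-, m, hm', -⟩ := hp.bounds
      have := hdiv (2 * m) (by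
        have : 2 * m * 2 ^ j = m * 2 ^ (j + 1) := by ring
        linarith)
      refine .seq (.ifEq ?_ ?_ (fun c₁ => ?_) 
        (fun c₁ => .skip (fin g (g 8) h₀ h₄ h₅ h₉ rfl ?_ ?_ ?_)))
      · rw [hB]; simp [h₉]; omega
      · rw [hB]; simp; omega
      · simp [this] at c₁
      · rw [hh]; exact hp
      · rw [hh]; exact hr.1
      · rw [hh]; exact hm
    | @right _ h' hp hm =>
      obtain ⟨-, m, hm', -⟩ := hp.bounds
      have hp' : p ≤ h' := by rw [hm']; exact Nat.le_add_right _ _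
      have := hdiv (2 * m + 1) (by
        have : (2 * m + 1) * 2 ^ j = m * 2 ^ (j + 1) + 2 ^ j := by ring
        linarith)
      have hh' : p + (g 8 - 2 ^ j) = h' := by omega
      refine .seq (.ifEq ?_ ?_ (fun c₁ => .assign (by norm_num) ?_
        (fin _ (g 8 - 2 ^ j) ?_ ?_ ?_ ?_ ?_ ?_ ?_ ?_))
        (fun c₁ => ?_))
      · rw [hB]; simp [h₉]; omega
      · rw [hB]; simp; omega
      · rw [hB]; simp [h₉]; omega
      · simpa
      · simpa
      · simpa
      · simpa
      · simp [h₉]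
      · rw [hh']; exact hp
      · rw [hh']; exact hm
      · rw [hh']; exact hr.1
      · simp [this] at c₁
  · simp [h₉, h₅] at c
    have := (Nat.pow_le_pow_iff_right (a := 2) (by norm_num)).1 c
    obtain rfl : j = I := by omega
    rwa [show p + g 8 = p by omega] at hr

/-- Lets a postcondition use that the cells were merely permuted, so that minimality of an element
carries over to the final array. -/
theorem WPT.of_perm {p : Prog} {T : ℕ} (h : WPT w n p T Q g f) (hQ : ∀ g' f',
    ((List.range n).map f').Perm ((List.range n).map f) → Q g' f' → Q' g' f') :
    WPT w n p T Q' g f := by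
  intro s hs
  obtain ⟨s', t, m, g', f', h₁, h₂, h₃, h₄, h₅⟩ := h s hs
  exact ⟨s', t, m, g', f', h₁, h₂, h₃, h₄, hQ _ _ (by rw [← h₃.arr, ← hs.arr]; exact h₄) h₅⟩

/-- The last cell lies behind the forest because 3M < n. Exchanging it with the minimum, once this
heads a tree of one node, disturbs no order: a single node is always a minimal tree, and the links
above it are redone. -/
theorem WPT.removeRootProg {M I : ℕ} {A B : List ℕ} (hg : g 0 = n) (h5 : g 5 = 2 ^ I)
    (hs : shape M = A ++ ([I] ++ B)) (h3 : g 3 = 3 * weight A) (hM : 3 * M < n)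
    (hw : 100 * (n + 1) ≤ 2 ^ w) (hf : ForestAt (nd f) 0 (shape M)) (hK : Nat.log 2 n < K)
    (h : ∀ g' f', g' 0 = n → ForestAt (nd f') 0 (shape M) → f' (n - 1) = f (3 * weight A) →
      Q g' f') :
    WPT w n removeRootProg (K * removeRootProg.size) Q g f := by
  generalize hB : 2 ^ w = B at hw
  have hwt := congrArg weight hs
  simp at hwt
  have h2 := Nat.two_pow_pos I
  have hI : I < K := lt_of_le_of_lt (Nat.le_log_of_pow_le (by norm_num) (by omega)) hK
  have hf' := hf
  rw [hs] at hf'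
  have ht := hf'
  simp only [forestAt_append, zero_add] at ht
  have hr := ht.2.1.1
  set p := weight A with hp
  have hK₀ : 0 < K := by omega
  refine WP.seq_bounded hK₀ (by simp) (.assign (by norm_num) ?_
    (WP.seq_bounded hK₀ (by simp) (.assign (by norm_num) ?_
    (WP.seq_bounded hK₀ (by simp) (.assign (by norm_num) ?_
    (WPT.seq_bounded (.descendProg (I := I) (p := p) (j := I)
      ⟨?_, ?_, ?_, ?_, ?_, ?_, ?_, ?_⟩ hI (hB ▸ hw) (by omega) fun g₁ f₁ hd => ?_)))))))
  · rw [hB]; simp [h3]; omega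
  · rw [hB]; simp; omega
  · rw [hB]; simp [h5]; omega
  · simpa
  · simp [h3]
  · simpa
  · simp [h5]
  · simpa using .base
  · simpa using hr.1.1
  · simp
  · intro c _; rfl
  obtain ⟨h₀, h₄, h₅, h₉, hpath, hrlx, hhole, hoff⟩ := hd
  have hle := hpath.add_le
  refine WP.seq_bounded hK₀ (by simp) (.swap ?_ ?_ ?_ ?_
    (WP.seq_bounded hK₀ (by simp) (.norm (k := p + g₁ 8) ?_ ?_ ?_
    fun f₂ off₂ same₂ root₂ => WP.seq_bounded hK₀ (by simp) (.assign (by norm_num) ?_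
      (.ascendProg (I := I) (p := p) (j := 0) ⟨?_, ?_, ?_, ?_, ?_, ?_, ?_⟩ hI (hB ▸ hw) (by omega)
        fun g₃ f₃ h₀₃ hr₃ off₃ => h _ _ h₀₃ ?_ ?_)))))
  · rw [hB]; simp [h₄]; omega
  · rw [hB]; simp [h₀]; omega
  · simp [h₄]; omega
  · simp [h₀]; omega
  · simp [h₄]
  · rw [hB]; simp [h₄]; omega
  · omega
  · rw [hB]; simp; omega
  · simpa
  · simpa
  · simpa
  · simp
  · simp only [ne_eq, Nat.reduceEqDiff, not_false_eq_true,
      Function.update_of_ne]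
    refine hpath.congr fun k _ _ hk => nd_congr fun c hc => ?_
    rw [off₂ c (by omega), comp_swap_off _ (by simp [h₄]; omega) (by simp [h₀]; omega)]
  · simp only [ne_eq, Nat.reduceEqDiff, not_false_eq_true,
      Function.update_of_ne]
    exact ⟨minAt_zero _ _, root₂⟩
  · exact fun c hc => rfl
  · rw [hs]
    refine hf'.replace rfl ⟨hr₃, trivial⟩ fun k hk hk' => nd_congr fun c hc => ?_
    simp at hk hk'
    rw [off₃ c (by omega), off₂ c (by omega), comp_swap_off _ (by simp [h₄]; omega)
      (by simp [h₀]; omega), hoff c (by omega)]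
  · have e : (3 * (.reg 4 + .reg 8) : WExp).val g₁ = 3 * (p + g₁ 8) := by simp [h₄]
    have e' : (.reg 0 - 1 : WExp).val g₁ = n - 1 := by simp [h₀]
    rw [off₃ _ (by omega), off₂ _ (by omega), e, e', comp_swap_right, hhole]

theorem WPT.extractProg (hg : g 0 = n) (hn : 0 < n) (hw : 100 * (n + 1) ≤ 2 ^ w)
    (hf : ForestAt (nd f) 0 (shape (n / 3))) (hK : 3 * Nat.log 2 n + 2 < K)
    (h : ∀ g' f', g' 0 = n → ForestAt (nd f') 0 (shape ((n - 1) / 3)) →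
      (∀ d < n, f' (n - 1) ≤ f' d) → Q g' f') :
    WPT w n extractProg (K * extractProg.size) Q g f := by
  generalize hB : 2 ^ w = B at hw
  refine WP.seq_bounded (by omega) (by simp [shrinkProg]) (.shrinkProg hg (hB ▸ hw) hn hf
    fun g₁ f₁ h₁ hf₁ => WPT.seq_bounded (.findProg h₁ (hB ▸ hw) hn hf₁ hK fun g₂ h₂ hb => ?_))
  obtain ⟨hlt, hle, hkind⟩ := hb
  have hle' : ∀ d < n, f₁ (g₂ 3) ≤ f₁ d := fun d hd => hle d hd (by omega)
  -- It suffices to know which element reaches the last cell; that it is the least follows from the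
  -- permutation.
  refine WPT.of_perm (Q := fun g' f' => g' 0 = n ∧ ForestAt (nd f') 0 (shape ((n - 1) / 3)) ∧
    f' (n - 1) = f₁ (g₂ 3)) (.ifEq_bounded ?_ ?_ (by omega)
    (fun c => WP.bounded (.swap ?_ ?_ ?_ ?_ ⟨h₂, ?_, ?_⟩) (by simp) (by omega)) (fun c => ?_))
    fun g' f' hperm ⟨k₀, k₁, k₂⟩ => h g' f' k₀ k₁ fun d hd => ?_
  all_goals try simp only [WExp.val_reg, WExp.val_zero] at c
  · rw [hB]
    rcases hkind with ⟨h5, -⟩ | ⟨I, A, B', h5, hs, -⟩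
    · simp [h5]; omega
    · have hwt := congrArg weight hs
      simp at hwt
      simp [h5]; omega
  · rw [hB]; simp; omega
  · rw [hB]; simp; omega
  · rw [hB]; simp [h₂]; omega
  · simpa
  · simp [h₂]; omega
  · have h3 : 3 * ((n - 1) / 3) ≤ g₂ 3 := by
      rcases hkind with ⟨-, h⟩ | ⟨I, A, B', h5, -⟩
      · exact h
      · simp [h5] at c
    refine hf₁.congr fun k _ hk => nd_congr fun d hd => ?_
    rw [weight_shape] at hk
    rw [comp_swap_off _ (by simp; omega) (by simp [h₂]; omega)]
  · have e' : (.reg 0 - 1 : WExp).val g₂ = n - 1 := by simp [h₂]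
    rw [e', comp_swap_right]; rfl
  · rcases hkind with ⟨h5, -⟩ | ⟨I, A, B', h5, hs, h3⟩
    · exact absurd h5 c
    · refine WPT.removeRootProg h₂ h5 hs h3 (by omega) (hB ▸ hw) hf₁ (by omega)
        fun g' f' k₀ k₁ k₂ => ⟨k₀, k₁, by rw [k₂, h3]⟩
  · rw [k₂]
    have : f' d ∈ (List.range n).map f₁ := hperm.subset (by simpa using ⟨d, hd, rfl⟩)
    obtain ⟨d', hd', e⟩ := List.mem_map.1 this
    rw [← e]
    exact hle' d' (List.mem_range.1 hd')

end

/-! ### Recognizing and locating trees by the states of the nodes. -/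

section

/-! ## Positions of the trees -/

/-- In a forest with ranks `R` there is a tree of rank `i` that starts at node `k`. -/
def StartsAt (R : List ℕ) (i k : ℕ) : Prop := ∃ A B, R = A ++ i :: B ∧ k = weight A

theorem startsAt_nil (i k : ℕ) : ¬ StartsAt [] i k := by
  rintro ⟨A, B, h, -⟩
  simp at h

theorem startsAt_cons {R : List ℕ} {i j k : ℕ} : StartsAt (j :: R) i k ↔
    (k = 0 ∧ i = j) ∨ (2 ^ j ≤ k ∧ StartsAt R i (k - 2 ^ j)) := by
  constructor
  · rintro ⟨A, B, h, rfl⟩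
    rcases A with _ | ⟨a, A⟩
    · simp at h
      exact .inl ⟨rfl, h.1.symm⟩
    · simp at h
      exact .inr ⟨by simp [h.1], A, B, h.2, by simp [h.1]⟩
  · rintro (⟨rfl, rfl⟩ | ⟨hk, A, B, rfl, h⟩)
    · exact ⟨[], R, rfl, rfl⟩
    · exact ⟨j :: A, B, rfl, by simp; omega⟩

theorem StartsAt.mem {R : List ℕ} {i k : ℕ} (h : StartsAt R i k) : i ∈ R := by
  obtain ⟨A, B, rfl, -⟩ := h
  simp

theorem startsAt_append {A R : List ℕ} {i k : ℕ} : StartsAt (A ++ R) i k ↔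
    StartsAt A i k ∨ (weight A ≤ k ∧ StartsAt R i (k - weight A)) := by
  induction A generalizing k with
  | nil => simp [startsAt_nil]
  | cons j A ih =>
    rw [List.cons_append, startsAt_cons, startsAt_cons, ih, weight_cons, Nat.sub_sub]
    constructor
    · rintro (h | ⟨h, h' | ⟨h', h''⟩⟩)
      exacts [.inl (.inl h), .inl (.inr ⟨h, h'⟩), .inr ⟨by omega, h''⟩]
    · rintro ((h | ⟨h, h'⟩) | ⟨h, h'⟩)
      exacts [.inl h, .inr ⟨h, .inl h'⟩, .inr ⟨by omega, .inr ⟨by omega, h'⟩⟩]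

theorem startsAt_replicate {c i k : ℕ} :
    StartsAt (List.replicate c i) i k ↔ ∃ j < c, k = j * 2 ^ i := by
  induction c generalizing k with
  | zero => simp [startsAt_nil]
  | succ c ih =>
    rw [List.replicate_succ, startsAt_cons, ih]
    constructor
    · rintro (⟨rfl, -⟩ | ⟨h, j, hj, h'⟩)
      · exact ⟨0, by omega, by simp⟩
      · exact ⟨j + 1, by omega, by rw [add_mul]; omega⟩
    · rintro ⟨j, hj, rfl⟩
      rcases j with _ | j
      · simp
      · exact .inr ⟨by rw [add_mul]; omega, j, by omega, by rw [add_mul]; omega⟩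

theorem eq_of_startsAt_iff {R R' : List ℕ} (h : ∀ i k, StartsAt R i k ↔ StartsAt R' i k) :
    R = R' := by
  induction R generalizing R' with
  | nil =>
    rcases R' with _ | ⟨j, R'⟩
    · rfl
    · exact absurd ((h j 0).2 (startsAt_cons.2 (.inl ⟨rfl, rfl⟩))) (startsAt_nil _ _)
  | cons i R ih =>
    have h₁ := (h i 0).1 (startsAt_cons.2 (.inl ⟨rfl, rfl⟩))
    rcases R' with _ | ⟨j, R'⟩
    · exact absurd h₁ (startsAt_nil _ _)
    have hj := Nat.two_pow_pos j
    obtain rfl : i = j := by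
      rcases startsAt_cons.1 h₁ with h | h
      · exact h.2
      · omega
    refine congrArg _ (ih fun m k => ?_)
    have := h m (2 ^ i + k)
    rw [startsAt_cons, startsAt_cons, Nat.add_sub_cancel_left] at this
    constructor
    · intro hk
      rcases this.1 (.inr ⟨by omega, hk⟩) with h | h
      · omega
      · exact h.2
    · intro hk
      rcases this.2 (.inr ⟨by omega, hk⟩) with h | h
      · omega
      · exact h.2

/-- Removing the first tree subtracts a multiple of all later sizes, so divisibility persists until
the position reaches 0, the start of a tree. -/
theorem exists_startsAt_of_dvd {R : List ℕ} {T : ℕ} (hR : R.Pairwise (· ≥ ·))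
    (hd : ∀ a ∈ R, 2 ^ a ∣ T) (hT : T < weight R) : ∃ j, StartsAt R j T := by
  induction R generalizing T with
  | nil => simp at hT
  | cons a R ih =>
    rw [List.pairwise_cons] at hR
    rcases Nat.eq_zero_or_pos T with rfl | hpos
    · exact ⟨a, startsAt_cons.2 (.inl ⟨rfl, rfl⟩)⟩
    · have hle := Nat.le_of_dvd hpos (hd a (by simp))
      rw [weight_cons] at hT
      obtain ⟨j, hj⟩ := ih hR.2 (T := T - 2 ^ a) (fun b hb => Nat.dvd_sub (hd b (by simp [hb]))
        (pow_dvd_pow 2 (hR.1 b hb))) (by omega)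
      exact ⟨j, startsAt_cons.2 (.inr ⟨hle, hj⟩)⟩

theorem exists_startsAt_zero {R : List ℕ} (hR : R ≠ []) : ∃ j, StartsAt R j 0 := by
  obtain ⟨a, R, rfl⟩ := List.exists_cons_of_ne_nil hR
  exact ⟨a, startsAt_cons.2 (.inl ⟨rfl, rfl⟩)⟩

/-- The trees can be recognized by the positions of the roots. -/
theorem startsAt_iff {R : List ℕ} (hR : R.Pairwise (· ≥ ·)) (i k : ℕ) : StartsAt R i k ↔
    (∃ j, StartsAt R j k) ∧ ((∃ j, StartsAt R j (k + 2 ^ i)) ∨ k + 2 ^ i = weight R) ∧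
      (i ≠ 0 → k + 2 ^ (i - 1) < weight R ∧ ¬ ∃ j, StartsAt R j (k + 2 ^ (i - 1))) := by
  induction R generalizing k with
  | nil => simp [startsAt_nil]
  | cons j R ih =>
    have hj := Nat.two_pow_pos j
    have hi := Nat.two_pow_pos i
    have hR' := List.pairwise_cons.1 hR
    rcases lt_or_ge k (2 ^ j) with hk | hk
    · rcases Nat.eq_zero_or_pos k with rfl | hpos
      · have h₀ : StartsAt (j :: R) i 0 ↔ i = j := by
          rw [startsAt_cons]; constructor
          · rintro (h | h)
            exacts [h.2, by omega]
          · intro h; exact .inl ⟨rfl, h⟩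
        rw [h₀]
        constructor
        · rintro rfl
          refine ⟨⟨i, startsAt_cons.2 (.inl ⟨rfl, rfl⟩)⟩, ?_, fun h => ?_⟩
          · by_cases hn : R = []
            · right; simp [hn]
            · obtain ⟨m, hm⟩ := exists_startsAt_zero hn
              exact .inl ⟨m, startsAt_cons.2 (.inr ⟨by omega, by simpa using hm⟩)⟩
          · obtain ⟨i, rfl⟩ := Nat.exists_eq_succ_of_ne_zero h
            have := Nat.two_pow_pos i
            simp only [Nat.succ_eq_add_one, Nat.add_sub_cancel, zero_add, weight_cons, pow_succ]
              at *
            refine ⟨by omega, ?_⟩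
            rintro ⟨m, hm⟩
            rcases startsAt_cons.1 hm with h | h
            · omega
            · rw [pow_succ] at h; omega
        · rintro ⟨-, h₁, h₂⟩
          rw [zero_add] at h₁ h₂
          -- If the guess is too small, node 2^i lies inside the first tree and is no root. If it is
          -- too large, 2^(i-1) is a multiple of all sizes, so a tree starts there, against the "not
          -- root" test.
          rcases lt_trichotomy i j with h | h | h
          · have hlt := Nat.pow_lt_pow_right (a := 2) (by norm_num) h
            rcases h₁ with ⟨m, hm⟩ | h₁
            · rcases startsAt_cons.1 hm with h | h <;> omega
            · rw [weight_cons] at h₁; omega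
          · exact h
          · exfalso
            obtain ⟨h₃, h₄⟩ := h₂ (by omega)
            refine h₄ (exists_startsAt_of_dvd hR (fun a ha => pow_dvd_pow 2 ?_) h₃)
            rcases List.mem_cons.1 ha with rfl | ha
            · omega
            · have := hR'.1 a ha; omega
      · have h₀ : ∀ m, ¬ StartsAt (j :: R) m k := fun m hm => by
          rcases startsAt_cons.1 hm with h | h <;> omega
        simp [h₀]
    · have shift : ∀ m d, StartsAt (j :: R) m (k + d) ↔ StartsAt R m (k - 2 ^ j + d) :=
        fun m d => by
        rw [startsAt_cons, show k + d - 2 ^ j = k - 2 ^ j + d by omega]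
        constructor
        · rintro (h | h)
          · omega
          · exact h.2
        · exact fun h => .inr ⟨by omega, h⟩
      have shift₀ := fun m => shift m 0
      simp only [add_zero] at shift₀
      simp only [shift, shift₀, weight_cons]
      rw [ih hR'.2, show k - 2 ^ j + 2 ^ i = weight R ↔ k + 2 ^ i = 2 ^ j + weight R by omega,
        show k - 2 ^ j + 2 ^ (i - 1) < weight R ↔ k + 2 ^ (i - 1) < 2 ^ j + weight R by omega]

theorem exists_eq_append_replicate {R : List ℕ} (hR : R.Pairwise (· ≥ ·)) (i : ℕ) :
    ∃ A B, R = A ++ (List.replicate (R.count i) i ++ B) ∧ (∀ a ∈ A, i < a) ∧ ∀ b ∈ B, b < i := by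
  induction R with
  | nil => exact ⟨[], [], by simp⟩
  | cons j R ih =>
    rw [List.pairwise_cons] at hR
    obtain ⟨A, B, h₁, h₂, h₃⟩ := ih hR.2
    rcases lt_trichotomy i j with h | rfl | h
    · refine ⟨j :: A, B, ?_, ?_, h₃⟩
      · rw [List.count_cons_of_ne h.ne']
        conv_lhs => rw [h₁]
        rfl
      · simpa using ⟨h, h₂⟩
    · have hA : A = [] := by
        rcases A with _ | ⟨a, A⟩
        · rfl
        · have := hR.1 a (by rw [h₁]; simp)
          have := h₂ a (by simp)
          omega
      subst hA
      refine ⟨[], B, ?_, by simp, h₃⟩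
      rw [List.count_cons_self, List.replicate_succ]
      conv_lhs => rw [h₁]
      rfl
    · refine ⟨[], j :: R, ?_, by simp, ?_⟩
      · rw [List.count_eq_zero_of_not_mem]
        · rfl
        · intro hi
          rcases List.mem_cons.1 hi with rfl | hi
          · omega
          · have := hR.1 i hi; omega
      · intro b hb
        rcases List.mem_cons.1 hb with rfl | hb
        · exact h
        · have := hR.1 b hb; omega

theorem weight_eq_count_add (i : ℕ) (L : List ℕ) :
    weight L = L.count i * 2 ^ i + weight (L.filter (· ≠ i)) := by
  induction L with
  | nil => simp
  | cons j L ih =>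
    by_cases h : j = i
    · subst h
      simp only [weight_cons, List.count_cons_self, ne_eq, not_true_eq_false, decide_false,
        Bool.false_eq_true, not_false_eq_true, List.filter_cons_of_neg, add_mul] at ih ⊢
      omega
    · rw [List.filter_cons_of_pos (by simpa using h), List.count_cons_of_ne h, weight_cons,
        weight_cons]
      omega

/-- The geometric sum c·(1 + 2 + … + 2^(i-1)) = c·2^i - c, obtained by splitting off the largest
rank. -/
theorem weight_lt_of_count_le {i c : ℕ} {L : List ℕ} (h : ∀ b ∈ L, b < i)
    (hc : ∀ j, L.count j ≤ c) : weight L + c ≤ c * 2 ^ i := by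
  induction i generalizing L with
  | zero =>
    have : L = [] := List.eq_nil_iff_forall_not_mem.2 fun b hb => by simpa using h b hb
    simp [this]
  | succ i ih =>
    have h₁ := ih (L := L.filter (· ≠ i)) (fun b hb => by
      rw [List.mem_filter] at hb
      have := h b hb.1
      have : b ≠ i := by simpa using hb.2
      omega) fun j => (List.filter_sublist.count_le j).trans (hc j)
    rw [weight_eq_count_add i L, pow_succ]
    have := Nat.mul_le_mul_right (2 ^ i) (hc i)
    rw [← mul_assoc]
    omega

/-- The positions of the trees of rank `i`: they are consecutive, and at most four times their size
many nodes follow, up to a remainder. -/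
theorem exists_startsAt_iff {R : List ℕ} (hR : R.Pairwise (· ≥ ·)) (h5 : ∀ j, R.count j ≤ 5)
    (i : ℕ) : ∃ a d, d ≤ 4 ∧ weight R = (a + R.count i + d) * 2 ^ i + weight R % 2 ^ i ∧
      ∀ k, StartsAt R i k ↔ ∃ j < R.count i, k = (a + j) * 2 ^ i := by
  obtain ⟨A, B, h₁, h₂, h₃⟩ := exists_eq_append_replicate hR i
  have hi := Nat.two_pow_pos i
  have hA : ∃ a, weight A = a * 2 ^ i := by
    clear h₁
    induction A with
    | nil => exact ⟨0, by simp⟩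
    | cons b A ih =>
      obtain ⟨a, ha⟩ := ih fun a ha => h₂ a (by simp [ha])
      have hb := h₂ b (by simp)
      refine ⟨2 ^ (b - i) + a, ?_⟩
      rw [weight_cons, ha, add_mul, ← pow_add, Nat.sub_add_cancel hb.le]
  obtain ⟨a, ha⟩ := hA
  -- All smaller trees together have fewer than 5·2^i nodes; this is where `d ≤ 4` comes from.
  have hB : weight B + 5 ≤ 5 * 2 ^ i := weight_lt_of_count_le h₃ fun j =>
    le_trans (List.Sublist.count_le j (by
      conv_rhs => rw [h₁]
      exact (List.sublist_append_right _ _).trans (List.sublist_append_right _ _))) (h5 j)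
  have hrep : ∀ c, weight (List.replicate c i) = c * 2 ^ i := fun c => by
    simp [weight]
  have hdm := Nat.div_add_mod (weight B) (2 ^ i)
  have hw : weight R = (a + R.count i + weight B / 2 ^ i) * 2 ^ i + weight B % 2 ^ i := by
    conv_lhs => rw [h₁]
    rw [weight_append, weight_append, hrep, ha]
    rw [add_mul, add_mul, mul_comm (weight B / 2 ^ i)]
    omega
  refine ⟨a, weight B / 2 ^ i, ?_, ?_, fun k => ?_⟩
  · have : weight B / 2 ^ i < 5 := Nat.div_lt_of_lt_mul (by omega)
    omega
  · have : weight R % 2 ^ i = weight B % 2 ^ i := by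
      rw [hw, Nat.mul_add_mod', Nat.mod_mod]
    rw [this]; exact hw
  · conv_lhs => rw [h₁]
    rw [startsAt_append, startsAt_append, startsAt_replicate, ha]
    constructor
    · rintro (h | ⟨h, ⟨j, hj, h'⟩ | ⟨h', h''⟩⟩)
      · exact absurd (h₂ i h.mem) (lt_irrefl _)
      · exact ⟨j, hj, by rw [add_mul]; omega⟩
      · exact absurd (h₃ i h''.mem) (lt_irrefl _)
    · rintro ⟨j, hj, rfl⟩
      exact .inr ⟨by rw [add_mul]; omega, .inl ⟨j, hj, by rw [add_mul]; omega⟩⟩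

end

section

variable {α : Type u} [LinearOrder α] {w n : ℕ} {Q : (ℕ → ℕ) → (ℕ → α) → Prop} {g : ℕ → ℕ}
  {f : ℕ → α} {P : Prog}

/-! ## Decoding -/

/-- Test whether there is a tree of size `g 3` at node `g 6`, where `g 2` is the number of nodes. -/
def ifTreeProg (P : Prog) : Prog :=
  .ifRoot (.reg 6)
    (.ifEq (.reg 6 + .reg 3) (.reg 2)
      (.ifEq (.reg 3) 1 P (.ifRoot (.reg 6 + .reg 3 / 2) .skip P))
      (.ifRoot (.reg 6 + .reg 3)
        (.ifEq (.reg 3) 1 P (.ifRoot (.reg 6 + .reg 3 / 2) .skip P)) .skip))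
    .skip

/-- Register 4 is the distance of the candidate from the end of the forest. Register 5 counts the
trees found, and register 7 keeps the last one, which is the leftmost because candidates move to the
left. -/
def decodeStepProg : Prog :=
  .seq (.assign 4 (.reg 4 + .reg 3))
    (.ifLt (.reg 2) (.reg 4) .skip
      (.seq (.assign 6 (.reg 2 - .reg 4))
        (ifTreeProg (.seq (.assign 5 (.reg 5 + 1)) (.assign 7 (.reg 6))))))

def decodeNonemptyProg : Prog :=
  .seq (.assign 2 (.reg 0 / 3)) (.seq (.assign 3 (.bin .shl 1 (.reg 1)))
    (.seq (.assign 4 (.reg 2 % .reg 3)) (.seq (.assign 5 0)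
      (.seq (decodeStepProg.iterate 9) (.seq (.assign 0 (.reg 5)) (.assign 1 (.reg 7)))))))

def decodeProg : Prog := .ifLt 0 (.reg 0) decodeNonemptyProg .skip

theorem WP.ifTreeProg {R : List ℕ} {N i k : ℕ} (hR : R.Pairwise (· ≥ ·)) (hN : weight R = N)
    (hf : ∀ k < N, (nd f k).state = .isRoot ↔ ∃ j, StartsAt R j k) (h₂ : g 2 = N)
    (h₃ : g 3 = 2 ^ i) (h₆ : g 6 = k) (hk : k + 2 ^ i ≤ N) (hNn : 3 * N ≤ n)
    (hw : 100 * (n + 1) ≤ 2 ^ w) (hP : StartsAt R i k → WP w n P Q g f)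
    (hQ : ¬ StartsAt R i k → Q g f) : WP w n (ifTreeProg P) Q g f := by
  generalize hB : 2 ^ w = B at hw
  have hi := Nat.two_pow_pos i
  have hiff := startsAt_iff hR i k
  rw [hN, ← hf k (by omega)] at hiff
  have tail : (nd f k).state = .isRoot → ((∃ j, StartsAt R j (k + 2 ^ i)) ∨ k + 2 ^ i = N) →
      WP w n (.ifEq (.reg 3) 1 P (.ifRoot (.reg 6 + .reg 3 / 2) .skip P)) Q g f := by
    intro t₁ t₂
    refine .ifEq ?_ ?_ (fun c => hP (hiff.2 ⟨t₁, t₂, fun h => ?_⟩)) (fun c => ?_)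
    · rw [hB]; simp [h₃]; omega
    · rw [hB]; simp; omega
    · simp [h₃] at c; exact absurd c h
    · simp [h₃] at c
      obtain ⟨i, rfl⟩ := Nat.exists_eq_succ_of_ne_zero c
      simp only [Nat.succ_eq_add_one, Nat.add_sub_cancel] at *
      have h2 := Nat.two_pow_pos i
      have hhalf : 2 ^ (i + 1) / 2 = 2 ^ i := by rw [pow_succ]; omega
      have hk' : k + 2 ^ i < N := by rw [pow_succ] at hk; omega
      have hroot := hf (k + 2 ^ i) hk'
      refine .ifRoot (k := k + 2 ^ i) ?_ ?_ (by omega) (fun c₁ => .skip (hQ ?_))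
        (fun c₁ => hP (hiff.2 ⟨t₁, t₂, fun _ => ⟨hk', ?_⟩⟩))
      · simp [h₃, h₆, hhalf]
      · rw [hB]; simp [h₃, h₆, hhalf]; omega
      · intro hs
        exact ((hiff.1 hs).2.2 (by omega)).2 (hroot.1 c₁)
      · exact fun hs => c₁ (hroot.2 hs)
  refine .ifRoot (k := k) (by simpa) ?_ (by omega) (fun c₁ => .ifEq ?_ ?_ (fun c₂ => tail c₁ ?_)
    (fun c₂ => ?_)) (fun c₁ => .skip (hQ fun hs => c₁ (hiff.1 hs).1))
  · rw [hB]; simp [h₆]; omega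
  · rw [hB]; simp [h₆, h₃]; omega
  · rw [hB]; simp [h₂]; omega
  · right; simpa [h₂, h₃, h₆] using c₂
  · simp [h₂, h₃, h₆] at c₂
    refine .ifRoot (k := k + 2 ^ i) (by simp [h₃, h₆]) ?_ (by omega)
      (fun c₃ => tail c₁ (.inl ((hf _ (by omega)).1 c₃)))
      (fun c₃ => .skip (hQ fun hs => ?_))
    · rw [hB]; simp [h₃, h₆]; omega
    · rcases (hiff.1 hs).2.1 with h | h
      · exact c₃ ((hf _ (by omega)).2 h)
      · exact c₂ h

/-- With c trees of rank i, their distances from the end are x + k·2^i for k = d + 1, …, d + c. As d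
≤ 4 and c ≤ 5, nine candidates suffice, and after k of them exactly min c (k - d) trees have been
seen. -/
theorem WP.decodeNonemptyProg {R : List ℕ} {i : ℕ} (hR : R.Pairwise (· ≥ ·))
    (h5 : ∀ j, R.count j ≤ 5) (hN : weight R = n / 3)
    (hf : ∀ k < n / 3, (nd f k).state = .isRoot ↔ ∃ j, StartsAt R j k) (h₀ : g 0 = n)
    (h₁ : g 1 = i) (h₇ : g 7 = 0) (hi : 2 ^ i ≤ n) (hw : 100 * (n + 1) ≤ 2 ^ w)
    (h : ∀ g', g' 0 = R.count i → (∀ j < R.count i, StartsAt R i (g' 1 + j * 2 ^ i)) → Q g' f) :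
    WP w n decodeNonemptyProg Q g f := by
  obtain ⟨a, d, hd, hNd, hst⟩ := exists_startsAt_iff hR h5 i
  have hc5 := h5 i
  have h2 := Nat.two_pow_pos i
  generalize R.count i = c at *
  generalize hNN : n / 3 = N at *
  rw [hN] at hNd
  generalize hx : N % 2 ^ i = x at *
  have hxlt : x < 2 ^ i := hx ▸ Nat.mod_lt _ h2
  have hxN : x ≤ N := hx ▸ Nat.mod_le _ _
  generalize hB : 2 ^ w = B at hw
  have hiB : i < B := lt_of_lt_of_le (Nat.lt_two_pow_self (n := i)) (by omega)
  have loop : ∀ g' : ℕ → ℕ, g' 2 = N → g' 3 = 2 ^ i → g' 4 = x → g' 5 = 0 → g' 7 = 0 →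
      WP w n (decodeStepProg.iterate 9) (fun g' f' => f' = f ∧ g' 2 = N ∧ g' 3 = 2 ^ i ∧
        g' 4 = 9 * 2 ^ i + x ∧ g' 5 = min c (9 - d) ∧ g' 7 ≤ N ∧
        (0 < g' 5 → g' 7 + (d + g' 5) * 2 ^ i + x = N)) g' f := by
    intro g' e₂ e₃ e₄ e₅ e₇
    refine .iterate (fun k g' f' => f' = f ∧ g' 2 = N ∧ g' 3 = 2 ^ i ∧
        g' 4 = k * 2 ^ i + x ∧ g' 5 = min c (k - d) ∧ g' 7 ≤ N ∧
        (0 < g' 5 → g' 7 + (d + g' 5) * 2 ^ i + x = N)) 9 ?_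
        ⟨rfl, e₂, e₃, by simp [e₄], by simp [e₅],
        by simp [e₇], by simp [e₅]⟩
    clear! g'
    rintro k hk9 g' _ ⟨rfl, e₂, e₃, e₄, e₅, e₇, e₈⟩
    have skipped : ¬ (d < k + 1 ∧ k < c + d) → min c (k - d) = min c (k + 1 - d) := by omega
    have hk8 : k * 2 ^ i ≤ 8 * 2 ^ i := Nat.mul_le_mul_right _ (by omega)
    have ek : k * 2 ^ i + x + 2 ^ i = (k + 1) * 2 ^ i + x := by ring
    refine .seq (.assign (by norm_num) ?_ (.ifLt ?_ ?_ (fun b₁ => .skip ?_) (fun b₁ => .seq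
      (.assign (by norm_num) ?_ (.ifTreeProg (i := i) (k := N - ((k + 1) * 2 ^ i + x)) hR hN hf
        ?_ ?_ ?_ ?_ (by omega) (hB ▸ hw) (fun b₂ => .seq (.assign (by norm_num) ?_
        (.assign (by norm_num) ?_ ?_))) (fun b₂ => ?_))))))
    · rw [hB]; simp [e₃, e₄]; omega
    · rw [hB]; simp [e₂]; omega
    · rw [hB]; simp [e₃, e₄]; omega
    · simp [e₂, e₃, e₄, ek] at b₁
      have : a + c + d < k + 1 := by
        rw [hNd] at b₁
        exact lt_of_mul_lt_mul_right (by omega : (a + c + d) * 2 ^ i < (k + 1) * 2 ^ i)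
          (Nat.zero_le _)
      exact ⟨rfl, by simpa, by simpa, by simp [e₃, e₄, ek], by simp; omega, by simpa,
        by simpa using e₈⟩
    · rw [hB]; simp [e₂, e₃, e₄]; omega
    · simpa
    · simpa
    · simp [e₂, e₃, e₄, ek]
    · simp [e₂, e₃, e₄, ek] at b₁
      omega
    · rw [hB]; simp [e₅]; omega
    · rw [hB]; simp [e₂, e₃, e₄]; omega
    · simp [e₂, e₃, e₄, ek] at b₁
      obtain ⟨j, hj, hjk⟩ := (hst _).1 b₂
      have hsum : (a + c + d) * 2 ^ i = (a + j + (k + 1)) * 2 ^ i := by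
        rw [add_mul (a + j)]; omega
      have hsum' := Nat.eq_of_mul_eq_mul_right h2 hsum
      refine ⟨rfl, by simpa, by simpa, by simp [e₃, e₄, ek], by simp [e₅]; omega,
        by simp [e₂], fun _ => ?_⟩
      have : d + (min c (k - d) + 1) = k + 1 := by omega
      simp [e₂, e₃, e₄, e₅, ek, this]
      omega
    · simp [e₂, e₃, e₄, ek] at b₁
      have hle : k + 1 ≤ a + c + d := by
        by_contra hlt
        have : (a + c + d + 1) * 2 ^ i ≤ (k + 1) * 2 ^ i := Nat.mul_le_mul_right _ (by omega)
        rw [add_mul _ 1] at this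
        omega
      have hno : ¬ (d < k + 1 ∧ k < c + d) := fun ⟨h₁, h₂⟩ => b₂ ((hst _).2
        ⟨c + d - (k + 1), by omega, by
          have : (a + c + d) * 2 ^ i = (a + (c + d - (k + 1))) * 2 ^ i + (k + 1) * 2 ^ i := by
            rw [← add_mul]; congr 1; omega
          omega⟩)
      have := skipped hno
      exact ⟨rfl, by simpa, by simpa, by simp [e₃, e₄, ek], by simp; omega, by simpa,
        by simpa using e₈⟩
  refine .seq (.assign (by norm_num) ?_ (.seq (.assign (by norm_num) ?_
    (.seq (.assign (by norm_num) ?_ (.seq (.assign (by norm_num) ?_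
    (.seq ((loop _ ?_ ?_ ?_ ?_ ?_).mono ?_)))))))))
  · rw [hB]; simp [h₀]; omega
  · rw [hB]; simp [h₁, Nat.shiftLeft_eq]; omega
  · rw [hB]; simp [h₀, h₁, hNN, Nat.shiftLeft_eq]; omega
  · rw [hB]; simp; omega
  · simpa [h₀]
  · simp [h₁, Nat.shiftLeft_eq]
  · simpa [h₀, h₁, hNN, Nat.shiftLeft_eq]
  · simp
  · simpa
  rintro g' _ ⟨rfl, e₂, e₃, e₄, e₅, e₈, e₇⟩
  have e₅' : g' 5 = c := by omega
  have b₇ : g' 7 < B := by omega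
  refine .seq (.assign (by norm_num) ?_ (.assign (by norm_num) ?_ (h _ ?_ ?_)))
  · rw [hB]; simp [e₅']; omega
  · rw [hB]; simp; omega
  · simp [e₅']
  · intro j hj
    refine (hst _).2 ⟨j, hj, ?_⟩
    rw [e₅'] at e₇
    have := e₇ (by omega)
    simp
    nlinarith

end

/-! ### Translation to forests of arrays, and assembly of the results. -/

section

/-! ## Forests of arrays and arrays of nodes -/

section

variable {α : Type u}

theorem map_range_add_three (f : ℕ → α) (n : ℕ) : (List.range (n + 3)).map f =
    f 0 :: f 1 :: f 2 :: (List.range n).map fun k => f (k + 3) := by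
  simp [List.range_succ_eq_map, Function.comp_def, add_assoc]

theorem nodes_map_range (f : ℕ → α) (n : ℕ) :
    nodes ((List.range n).map f) = (List.range (n / 3)).map (nd f) := by
  induction n using Nat.strong_induction_on generalizing f with
  | _ n ih =>
    by_cases hn : n < 3
    · interval_cases n <;> simp [nodes, List.range_succ]
    · obtain ⟨n, rfl⟩ : ∃ m, n = m + 3 := ⟨n - 3, by omega⟩
      rw [map_range_add_three, nodes, ih n (by omega), show (n + 3) / 3 = n / 3 + 1 by omega,
        List.range_succ_eq_map]
      simp [nd, Function.comp_def, mul_add]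

theorem length_nodes (l : List α) : (nodes l).length = l.length / 3 := by
  induction l using nodes.induct with
  | case1 a b c l ih => simp [nodes, ih]; omega
  | case2 l h =>
    rcases l with _ | ⟨a, _ | ⟨b, _ | ⟨c, l⟩⟩⟩
    · simp [nodes]
    · simp [nodes]
    · simp [nodes]
    · exact absurd rfl (h a b c l)

theorem BinTree.length_preorder {β : Type u} {i : ℕ} (t : BinTree β i) :
    t.preorder.length = 2 ^ i := by
  induction t with
  | single b => rfl
  | link t s iht ihs => simp [BinTree.preorder, iht, ihs, pow_succ]; omega

theorem BinTree.preorder_eq {β : Type u} {i : ℕ} (t : BinTree β i) :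
    t.preorder = t.root :: t.preorder.tail := by
  induction t with
  | single b => rfl
  | link t s iht ihs =>
    simp only [BinTree.preorder, BinTree.root]
    conv_lhs => rw [iht]
    rw [iht]
    rfl

theorem length_flatMap_preorder (F : List (Σ i, BinTree (Node α) i)) :
    (F.flatMap fun T => T.2.preorder).length = weight (F.map Sigma.fst) := by
  induction F with
  | nil => rfl
  | cons T F ih => simp [BinTree.length_preorder, ih, -List.length_flatMap]

theorem treeAt_iff (F : List (Σ i, BinTree (Node α) i)) (i k : ℕ) :
    TreeAt F i k ↔ StartsAt (F.map Sigma.fst) i k := by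
  have hw : ∀ G : List (Σ i, BinTree (Node α) i), (G.map fun S => 2 ^ S.1).sum =
      weight (G.map Sigma.fst) := fun G => by simp [weight, Function.comp_def]
  constructor
  · rintro ⟨F₁, F₂, T, rfl, rfl⟩
    exact ⟨F₁.map Sigma.fst, F₂.map Sigma.fst, by simp, hw F₁⟩
  · rintro ⟨A, B, h, rfl⟩
    obtain ⟨F₁, F', rfl, rfl, h'⟩ := List.map_eq_append_iff.1 h
    obtain ⟨⟨_, T⟩, F₂, rfl, rfl, rfl⟩ := List.map_eq_cons_iff.1 h'
    exact ⟨F₁, F₂, T, rfl, (hw F₁).symm⟩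

/-- The binomial tree formed by the nodes from `p` on. -/
def treeOf {β : Type u} (a : ℕ → β) : (i p : ℕ) → BinTree β i
  | 0, p => .single (a p)
  | i + 1, p => .link (treeOf a i p) (treeOf a i (p + 2 ^ i))

theorem root_treeOf {β : Type u} (a : ℕ → β) (i p : ℕ) : (treeOf a i p).root = a p := by
  induction i with
  | zero => rfl
  | succ i ih => exact ih

theorem preorder_treeOf {β : Type u} (a : ℕ → β) (i p : ℕ) :
    (treeOf a i p).preorder = (List.range' p (2 ^ i)).map a := by
  induction i generalizing p with
  | zero => rfl
  | succ i ih =>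
    rw [treeOf, BinTree.preorder, ih, ih, ← List.map_append, pow_succ, mul_two,
      List.range'_append_1]

def forestOf (a : ℕ → Node α) : ℕ → List ℕ → List (Σ i, BinTree (Node α) i)
  | _, [] => []
  | p, i :: L => ⟨i, treeOf a i p⟩ :: forestOf a (p + 2 ^ i) L

theorem fst_forestOf (a : ℕ → Node α) (p : ℕ) (L : List ℕ) :
    (forestOf a p L).map Sigma.fst = L := by
  induction L generalizing p with
  | nil => rfl
  | cons i L ih => simp [forestOf, ih]

theorem flatMap_forestOf (a : ℕ → Node α) (p : ℕ) (L : List ℕ) :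
    (forestOf a p L).flatMap (fun T => T.2.preorder) = (List.range' p (weight L)).map a := by
  induction L generalizing p with
  | nil => rfl
  | cons i L ih =>
    rw [forestOf, List.flatMap_cons, ih, preorder_treeOf, ← List.map_append, List.range'_append_1,
      weight_cons]

end

variable {α : Type u} [LinearOrder α]

theorem BinTree.Relaxed.state_ne {i : ℕ} {t : BinTree (Node α) i} (h : t.Relaxed) :
    ∀ b ∈ t.preorder.tail, b.state ≠ .isRoot := by
  induction t with
  | single b => simp [BinTree.preorder]
  | link t s iht ihs =>
    obtain ⟨ht, hs, h⟩ := h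
    intro b hb
    rw [BinTree.preorder, t.preorder_eq, List.cons_append, List.tail_cons, List.mem_append,
      s.preorder_eq, List.mem_cons] at hb
    rcases hb with hb | rfl | hb
    · exact iht ht b hb
    · rcases h with h | h <;> simp [h.1]
    · exact ihs hs b hb

/-- In a relaxed binomial tree every node but the first is in one of the two other states, so the
state "root" marks precisely where trees start. -/
theorem exists_isRoot_iff {F : List (Σ i, BinTree (Node α) i)} (hF : ∀ T ∈ F, T.2.IsRBT) (k : ℕ) :
    (∃ a, (F.flatMap fun T => T.2.preorder)[k]? = some a ∧ a.state = .isRoot) ↔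
      ∃ j, StartsAt (F.map Sigma.fst) j k := by
  induction F generalizing k with
  | nil => simp [startsAt_nil]
  | cons T F ih =>
    obtain ⟨i, t⟩ := T
    have ht : t.IsRBT := hF ⟨i, t⟩ (by simp)
    have hi := Nat.two_pow_pos i
    simp only [List.flatMap_cons, List.map_cons, startsAt_cons]
    rcases lt_or_ge k (2 ^ i) with hk | hk
    · rw [List.getElem?_append_left (by rwa [t.length_preorder])]
      rcases k with _ | k
      · rw [t.preorder_eq]
        exact ⟨fun _ => ⟨i, .inl ⟨rfl, rfl⟩⟩, fun _ => ⟨t.root, rfl, ht.2.1⟩⟩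
      · constructor
        · rintro ⟨a, ha, hr⟩
          rw [t.preorder_eq, List.getElem?_cons_succ] at ha
          exact absurd hr (ht.1.state_ne a (List.mem_of_getElem? ha))
        · rintro ⟨j, h | h⟩ <;> omega
    · rw [List.getElem?_append_right (by rwa [t.length_preorder]), t.length_preorder,
        ih (fun T hT => hF T (by simp [hT]))]
      refine exists_congr fun j => ⟨fun h => .inr ⟨hk, h⟩, ?_⟩
      rintro (h | h)
      · omega
      · exact h.2

theorem RlxAt.relaxed {a : ℕ → Node α} {i p : ℕ} (h : RlxAt a i p) : (treeOf a i p).Relaxed := by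
  induction i generalizing p with
  | zero => trivial
  | succ i ih =>
    obtain ⟨h₁, h₂, h₃⟩ := h
    refine ⟨ih h₁, ih h₂, ?_⟩
    rw [root_treeOf, preorder_treeOf, preorder_treeOf]
    refine h₃.imp (fun h => ⟨h.1, fun b hb => ?_⟩) (fun h => ⟨h.1, fun b hb => ?_⟩)
    · obtain ⟨k, hk, rfl⟩ := List.mem_map.1 hb
      rw [List.mem_range'_1] at hk
      exact h.2 k hk.1 hk.2
    · rw [← List.map_tail, List.tail_range'] at hb
      obtain ⟨k, hk, rfl⟩ := List.mem_map.1 hb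
      rw [List.mem_range'_1] at hk
      exact h.2 k hk.1 (by have := Nat.two_pow_pos i; omega)

theorem RBTAt.isRBT {a : ℕ → Node α} {i p : ℕ} (h : RBTAt a i p) : (treeOf a i p).IsRBT := by
  refine ⟨h.1.1.relaxed, ?_, fun b hb => ?_⟩
  · rw [root_treeOf]; exact h.2
  · rw [preorder_treeOf] at hb
    obtain ⟨k, hk, rfl⟩ := List.mem_map.1 hb
    rw [List.mem_range'_1] at hk
    rw [root_treeOf]
    exact h.1.2 k hk.1 hk.2

theorem ForestAt.isRBT {a : ℕ → Node α} {p : ℕ} {L : List ℕ} (h : ForestAt a p L) :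
    ∀ T ∈ forestOf a p L, T.2.IsRBT := by
  induction L generalizing p with
  | nil => simp [forestOf]
  | cons i L ih =>
    intro T hT
    rcases List.mem_cons.1 hT with rfl | hT
    · exact h.1.isRBT
    · exact ih h.2 T hT

/-- The arrays that arise between operations: canonical forests. -/
def Canonical (l : List α) : Prop :=
  l.Nodup ∧ ∀ f : ℕ → α, l = (List.range l.length).map f → ForestAt (nd f) 0 (shape (l.length / 3))

theorem canonical_map_range {f : ℕ → α} {n : ℕ} (hn : ((List.range n).map f).Nodup)
    (hf : ForestAt (nd f) 0 (shape (n / 3))) : Canonical ((List.range n).map f) := by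
  refine ⟨hn, fun f' h => ?_⟩
  rw [List.length_map, List.length_range] at h ⊢
  refine hf.congr fun k _ hk => nd_congr fun j hj => ?_
  rw [weight_shape] at hk
  exact (List.map_inj_left.1 h j (List.mem_range.2 (by omega))).symm

theorem Canonical.exists_isForest {l : List α} (h : Canonical l) : ∃ F, IsForest l F := by
  rcases l with _ | ⟨x, l⟩
  · exact ⟨[], by simp, rfl, by simp, by simp, by simp⟩
  · generalize hL : x :: l = L at h
    have hf : L = (List.range L.length).map fun i => L.getD i x := by
      refine List.ext_getElem (by simp) fun i h₁ h₂ => ?_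
      simp [List.getElem?_eq_getElem h₁]
    have hf' := h.2 _ hf
    refine ⟨forestOf (nd fun i => L.getD i x) 0 (shape (L.length / 3)), h.1, ?_, hf'.isRBT, ?_, ?_⟩
    · rw [flatMap_forestOf, weight_shape, ← List.range_eq_range', ← nodes_map_range, ← hf]
    · rw [fst_forestOf]; exact pairwise_shape _
    · intro i
      rw [fst_forestOf]
      exact (count_shape_le _ _).trans (by norm_num)

end

section

/-! ## The priority queue -/

def extractMinProg : Prog :=
  .seq extractProg (.seq ((.reg 0 - 1 : WExp).compile 32) (.load 0 32))

/-- The factor 3 stems from the bound 3·(log n + 1) on the rounds of the loops; the final 1 pays for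
the write that enlarges the array. -/
def costBound : ℕ := insertProg.size + extractMinProg.size * 3 + decodeProg.size + 1

/-- With z = 2^(log n + 1) one has n + 1 ≤ z and 100 ≤ 2^9 ≤ z^9. The factor 100 is generous room
for all intermediate word values. -/
theorem le_two_pow_wordSize (n : ℕ) : 100 * (n + 1) ≤ 2 ^ wordSize 10 n := by
  have h : n < 2 ^ (Nat.log 2 n + 1) := Nat.lt_pow_succ_log_self (by norm_num) n
  have h' : 2 ≤ 2 ^ (Nat.log 2 n + 1) := Nat.le_self_pow (Nat.succ_ne_zero _) 2
  rw [wordSize, mul_comm 10, pow_mul]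
  generalize 2 ^ (Nat.log 2 n + 1) = z at *
  calc 100 * (n + 1) ≤ z * 2 ^ 9 := by omega
    _ ≤ z * z ^ 9 := Nat.mul_le_mul_left _ (Nat.pow_le_pow_left h' 9)
    _ = z ^ 10 := by ring

variable {α : Type u}

theorem rel_initState {f : ℕ → α} {n : ℕ} (hn : ((List.range n).map f).Nodup) (arg : ℕ) :
    Rel n (initState ((List.range n).map f) arg)
      (fun r => if r = 0 then n else if r = 1 then arg else 0) f :=
  ⟨fun r _ => by simp [initState], rfl, hn⟩

theorem map_range_getD (l : List α) (x : α) : (List.range l.length).map (l.getD · x) = l := by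
  refine List.ext_getElem (by simp) fun i h₁ h₂ => ?_
  simp [List.getElem?_eq_getElem h₂]

variable [LinearOrder α]

theorem Canonical.insertRun {l : List α} (h : Canonical l) {x : α} (hx : x ∉ l) :
    ∃ (l' : List α) (t m : ℕ), InsertRun 10 insertProg l x l' t m ∧ l'.Perm (x :: l) ∧
      t ≤ costBound ∧ m ≤ costBound ∧ Canonical l' := by
  have hl : (List.range (l.length + 1)).map ((l ++ [x]).getD · x) = l ++ [x] := by
    simpa using map_range_getD (l ++ [x]) x
  have hnd : (l ++ [x]).Nodup := by
    rw [(List.perm_append_singleton x l).nodup_iff]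
    exact List.nodup_cons.2 ⟨hx, h.1⟩
  generalize (fun i => (l ++ [x]).getD i x) = f at hl
  have hl' : l = (List.range l.length).map f := by
    rw [List.range_succ, List.map_append] at hl
    exact (List.append_inj_left hl (by simp)).symm
  obtain ⟨s, t, m, g', f', he, hs, hp, hf⟩ :=
    WP.insertProg (n := l.length + 1)
      (Q := fun _ f' => ForestAt (nd f') 0 (shape ((l.length + 1) / 3))) rfl
      (le_two_pow_wordSize _) (Nat.succ_pos _) (h.2 f hl') (fun _ _ h => h) _
      (rel_initState (hl ▸ hnd) 0)
  rw [hl] at he hp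
  have ht := he.time_le_size (by simp [insertProg])
  have hm := he.moves_le_time
  refine ⟨s.arr, _, _, ⟨s, t, m, he, rfl, rfl, rfl⟩, hp.trans (List.perm_append_singleton x l),
    ?_, ?_, ?_⟩
  · unfold costBound; omega
  · unfold costBound; omega
  · rw [hs.arr]
    exact canonical_map_range (hs.arr ▸ hs.nodup) hf

theorem Canonical.extractRun {l : List α} (h : Canonical l) (hne : l ≠ []) :
    ∃ (x : α) (l' : List α) (t m : ℕ), ExtractRun 10 extractMinProg l x l' t m ∧
      (∀ y ∈ l, x ≤ y) ∧ l.Perm (x :: l') ∧ t ≤ costBound * (Nat.log 2 l.length + 1) ∧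
      m ≤ costBound * (Nat.log 2 l.length + 1) ∧ Canonical l' := by
  have hl := (map_range_getD l (l.head hne)).symm
  generalize (fun i => l.getD i (l.head hne)) = f at hl
  have hn : 0 < l.length := List.length_pos_iff.2 hne
  have hf := h.2 f hl
  have hnd := h.1
  generalize l.length = n at *
  subst hl
  obtain ⟨s, t, m, g', f', he, ht, hs, hp, hg, hf', hmin⟩ :=
    WPT.extractProg (n := n) (Q := fun g' f' => g' 0 = n ∧
      ForestAt (nd f') 0 (shape ((n - 1) / 3)) ∧
      ∀ d < n, f' (n - 1) ≤ f' d) rfl hn (le_two_pow_wordSize _) hf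
      (K := 3 * (Nat.log 2 n + 1)) (by omega) (fun _ _ h₁ h₂ h₃ => ⟨h₁, h₂, h₃⟩) _
      (rel_initState hnd 0)
  have hw := le_two_pow_wordSize n
  obtain ⟨s₁, t₁, m₁, he₁, hv, -, -, ha⟩ := (.reg 0 - 1 : WExp).exec_compile
    (w := wordSize 10 n) (d := 32) le_rfl s hs.word
    (by
      simp only [WExp.ok_sub, WExp.ok_reg, WExp.ok_one]
      omega)
  simp only [WExp.val_sub, WExp.val_reg, WExp.val_one, hg] at hv
  have hlast : s₁.arr[s₁.word 32]? = some (f' (n - 1)) := by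
    rw [hv, ha, hs.getElem? (by omega)]
  have hexec : Exec (wordSize 10 n) extractMinProg (initState ((List.range n).map f) 0)
      { s₁ with elt := Function.update s₁.elt 0 (some (f' (n - 1))) }
      (t + (t₁ + 1)) (m + (m₁ + 0)) :=
    .seq _ _ _ _ _ _ _ _ _ he (.seq _ _ _ _ _ _ _ _ _ he₁ (.load _ _ _ _ hlast))
  have ht₁ := he₁.time_le_size (WExp.loopFree_compile _ _)
  have hsplit : (List.range n).map f' = (List.range (n - 1)).map f' ++ [f' (n - 1)] := by
    conv_lhs => rw [show n = n - 1 + 1 by omega, List.range_succ, List.map_append]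
    rfl
  have hlp : ((List.range n).map f).Perm (f' (n - 1) :: (List.range (n - 1)).map f') := by
    refine .trans (.trans hp.symm (.of_eq (hs.arr.trans hsplit))) ?_
    exact List.perm_append_singleton _ _
  have hnd' := hlp.nodup_iff.1 hnd
  have htime : t + (t₁ + 1) ≤ costBound * (Nat.log 2 n + 1) := by
    generalize Nat.log 2 n = L at *
    have hsize : extractMinProg.size =
        extractProg.size + (((.reg 0 - 1 : WExp).compile 32).size + 1) := rfl
    generalize extractProg.size = e at *
    generalize ((.reg 0 - 1 : WExp).compile 32).size = b at *
    have hC : e * 3 + (b + 1) ≤ costBound := by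
      unfold costBound
      omega
    calc t + (t₁ + 1) ≤ 3 * (L + 1) * e + (b + 1) * 1 := by omega
      _ ≤ 3 * (L + 1) * e + (b + 1) * (L + 1) := by gcongr; omega
      _ = (e * 3 + (b + 1)) * (L + 1) := by ring
      _ ≤ costBound * (L + 1) := Nat.mul_le_mul_right _ hC
  have hrun : ExtractRun 10 extractMinProg ((List.range n).map f) (f' (n - 1))
      ((List.range (n - 1)).map f') (t + (t₁ + 1)) (m + (m₁ + 0)) := by
    refine ⟨_, by rw [List.length_map, List.length_range]; exact hexec, by simp, ?_⟩
    simp only [ha, hs.arr]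
    rw [hsplit, List.dropLast_concat]
  refine ⟨_, _, _, _, hrun, fun y hy => ?_, hlp, htime, hexec.moves_le_time.trans htime,
    canonical_map_range (List.nodup_cons.1 hnd').2 hf'⟩
  have hy' : y ∈ s.arr := hp.mem_iff.2 hy
  rw [hs.arr] at hy'
  obtain ⟨d, hd, rfl⟩ := List.mem_map.1 hy'
  exact hmin d (List.mem_range.1 hd)

/-- Reachability speaks of arbitrary runs; by determinism (`Exec.det`) they coincide with the runs
constructed above. -/
theorem Reachable.canonical {l : List α} (h : Reachable 10 insertProg extractMinProg l) :
    Canonical l := by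
  induction h with
  | empty => exact ⟨List.nodup_nil, fun _ _ => by simp [ForestAt]⟩
  | insert l l' x t m _ hx hr ih =>
    obtain ⟨l₁, _, _, ⟨s, _, _, he, rfl, -, -⟩, -, -, -, hc⟩ := ih.insertRun hx
    obtain ⟨s', _, _, he', rfl, -, -⟩ := hr
    exact (he'.det he).1 ▸ hc
  | extract l l' x t m _ hne hr ih =>
    obtain ⟨_, l₁, _, _, ⟨s, he, -, rfl⟩, -, -, -, -, hc⟩ := ih.extractRun hne
    obtain ⟨s', he', -, rfl⟩ := hr
    exact (he'.det he).1 ▸ hc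

/-! ## Decoding the shape -/

section

variable {l : List α} {F F' : List (Σ i, BinTree (Node α) i)}

theorem IsForest.weight_eq (h : IsForest l F) : weight (F.map Sigma.fst) = l.length / 3 := by
  rw [← length_flatMap_preorder, h.layout, length_nodes]

theorem IsForest.rootAt_iff (h : IsForest l F) (k : ℕ) :
    RootAt l k ↔ ∃ j, StartsAt (F.map Sigma.fst) j k := by
  rw [← exists_isRoot_iff h.rbt, h.layout, RootAt]

theorem nonRootAt_iff (l : List α) (k : ℕ) : NonRootAt l k ↔ k < l.length / 3 ∧ ¬ RootAt l k := by
  rw [← length_nodes]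
  constructor
  · rintro ⟨a, ha, hs⟩
    refine ⟨(List.getElem?_eq_some_iff.1 ha).1, ?_⟩
    rintro ⟨b, hb, hs'⟩
    rw [ha] at hb
    exact hs (Option.some.inj hb ▸ hs')
  · rintro ⟨hk, hs⟩
    exact ⟨_, List.getElem?_eq_getElem hk, fun h => hs ⟨_, List.getElem?_eq_getElem hk, h⟩⟩

theorem IsForest.startsAt_iff (h : IsForest l F) (i k : ℕ) : StartsAt (F.map Sigma.fst) i k ↔
    RootAt l k ∧ (RootAt l (k + 2 ^ i) ∨ k + 2 ^ i = l.length / 3) ∧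
      (i ≠ 0 → NonRootAt l (k + 2 ^ (i - 1))) := by
  rw [ImplicitPQ.startsAt_iff h.sorted]
  simp only [nonRootAt_iff, h.rootAt_iff, h.weight_eq]

theorem IsForest.shape_unique (h : IsForest l F) (h' : IsForest l F') :
    F'.map Sigma.fst = F.map Sigma.fst :=
  eq_of_startsAt_iff fun i k => (h'.startsAt_iff i k).trans (h.startsAt_iff i k).symm

theorem IsForest.exists_rightmost (h : IsForest l F) {i : ℕ} (hi : ∃ p, TreeAt F i p) :
    ∃ k p : ℕ, 1 ≤ k ∧ k ≤ 5 ∧ p + 2 ^ i * k + (l.length / 3) % 2 ^ i = l.length / 3 ∧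
      TreeAt F i p ∧ ∀ q, TreeAt F i q → q ≤ p := by
  simp only [treeAt_iff] at hi ⊢
  obtain ⟨a, d, hd, hN, hst⟩ := exists_startsAt_iff h.sorted h.five i
  simp only [hst] at hi ⊢
  obtain ⟨_, j, hj, -⟩ := hi
  rw [h.weight_eq] at hN
  -- The rightmost tree itself and the `d ≤ 4` full sizes behind it give the multiplier.
  refine ⟨d + 1, (a + (List.count i (F.map Sigma.fst) - 1)) * 2 ^ i, by omega, by omega, ?_,
    ⟨_, by omega, rfl⟩, ?_⟩
  · obtain ⟨c, hc⟩ : ∃ c, List.count i (F.map Sigma.fst) = c + 1 := ⟨_, (Nat.sub_add_cancel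
      (by omega : 1 ≤ List.count i (F.map Sigma.fst))).symm⟩
    rw [hc] at hN ⊢
    conv_rhs => rw [hN]
    rw [Nat.add_sub_cancel]
    ring
  · rintro _ ⟨j, hj, rfl⟩
    gcongr
    omega

theorem IsForest.decode (h : IsForest l F) {i : ℕ} (hi : i ≤ Nat.log 2 l.length) :
    ∃ (s : State α) (t : ℕ), Exec (wordSize 10 l.length) decodeProg (initState l i) s t 0 ∧
      t ≤ costBound ∧ s.word 0 = (F.map Sigma.fst).count i ∧
      ∀ j < s.word 0, TreeAt F i (s.word 1 + j * 2 ^ i) := by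
  suffices ∃ (s : State α) (t m : ℕ),
      Exec (wordSize 10 l.length) decodeProg (initState l i) s t m ∧
      s.word 0 = (F.map Sigma.fst).count i ∧
      ∀ j < s.word 0, TreeAt F i (s.word 1 + j * 2 ^ i) by
    obtain ⟨s, t, m, he, hs⟩ := this
    have ht := he.time_le_size (by
      simp [decodeProg, decodeNonemptyProg, decodeStepProg, ifTreeProg, Prog.LoopFree.iterate])
    have hm := he.moves_eq_zero (by
      simp [decodeProg, decodeNonemptyProg, decodeStepProg, ifTreeProg, Prog.StoreFree.iterate])
    exact ⟨s, t, hm ▸ he, by unfold costBound; omega, hs⟩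
  have hw := le_two_pow_wordSize l.length
  -- The empty array is separate because 2^i ≤ n, which keeps the shifted word small, fails there
  -- for i = 0.
  by_cases hne : l = []
  · subst hne
    have hF : F = [] := by
      have h0 := h.weight_eq
      rcases F with _ | ⟨T, F⟩
      · rfl
      · simp at h0
    obtain ⟨s₁, t₁, m₁, h₁, hv₁, hw₁, he₁, ha₁⟩ := (0 : WExp).exec_compile
      (g := (initState ([] : List α) i).word) (w := wordSize 10 0) (d := 32) le_rfl
      (initState ([] : List α) i) (fun _ _ => rfl) (by simp)
    obtain ⟨s₂, t₂, m₂, h₂, hv₂, hw₂, he₂, ha₂⟩ := (WExp.reg 0).exec_compile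
      (g := (initState ([] : List α) i).word) (w := wordSize 10 0) (d := 33) (by omega) s₁
      (fun r hr => hw₁ r hr) (by simp [initState])
    have h0 : s₂.word 0 = 0 := (hw₂ 0 (by omega)).trans (hw₁ 0 (by omega))
    refine ⟨s₂, _, _, .seq _ _ _ _ _ _ _ _ _ (.seq _ _ _ _ _ _ _ _ _ h₁ h₂)
      (.iteFalse _ _ _ _ _ _ _ ?_ (.skip _)), ?_, ?_⟩
    · simp [Test.eval, hv₂, hw₂ 32 (by omega), hv₁, initState]
    · simp [h0, hF]
    · simp [h0]
  · have hl := (map_range_getD l (l.head hne)).symm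
    generalize (fun i => l.getD i (l.head hne)) = f at hl
    have hn : 0 < l.length := List.length_pos_iff.2 hne
    have hi' : 2 ^ i ≤ l.length := Nat.pow_le_of_le_log hn.ne' hi
    have hN := h.weight_eq
    have hnd := h.nodup
    have hroot : ∀ k < l.length / 3,
        (nd f k).state = .isRoot ↔ ∃ j, StartsAt (F.map Sigma.fst) j k := fun k hk => by
      rw [← h.rootAt_iff, RootAt, hl, nodes_map_range]
      simp [hk]
    simp only [treeAt_iff]
    generalize l.length = n at *
    subst hl
    obtain ⟨s, t, m, g', f', he, hs, -, hg⟩ := WP.ifLt (p := decodeNonemptyProg) (q := .skip)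
      (a := 0) (b := .reg 0) (w := wordSize 10 n) (n := n) (f := f)
      (g := fun r => if r = 0 then n else if r = 1 then i else 0)
      (Q := fun g' _ => g' 0 = (F.map Sigma.fst).count i ∧
        ∀ j < (F.map Sigma.fst).count i, StartsAt (F.map Sigma.fst) i (g' 1 + j * 2 ^ i))
      (by simp) (by simp; omega)
      (fun _ => .decodeNonemptyProg h.sorted h.five hN hroot rfl rfl rfl hi' hw
        fun g' h₀ h₁ => ⟨h₀, h₁⟩)
      (fun c => absurd c (by simpa using hn.ne')) _ (rel_initState hnd i)
    refine ⟨s, t, m, he, ?_⟩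
    rw [hs.word 0 (by omega), hs.word 1 (by omega), hg.1]
    exact ⟨rfl, hg.2⟩

end

end

end ImplicitPQ

theorem mainTheorem2 :
    ∃ (ins ext dec : Prog) (c C : ℕ),
      -- the priority queue: correctness, costs and the invariant
      (∀ (α : Type*) [LinearOrder α] (l : List α), Reachable c ins ext l →
        (∃ F, IsForest l F) ∧
        (∀ x ∉ l, ∃ (l' : List α) (t m : ℕ), InsertRun c ins l x l' t m ∧
          l'.Perm (x :: l) ∧ t ≤ C ∧ m ≤ C ∧ ∃ F, IsForest l' F) ∧
        (l ≠ [] → ∃ (x : α) (l' : List α) (t m : ℕ), ExtractRun c ext l x l' t m ∧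
          (∀ y ∈ l, x ≤ y) ∧ l.Perm (x :: l') ∧
          t ≤ C * (Nat.log 2 l.length + 1) ∧ m ≤ C * (Nat.log 2 l.length + 1) ∧
          ∃ F, IsForest l' F)) ∧
      -- the shape of the forest is decodable from the array
      (∀ (α : Type*) [LinearOrder α] (l : List α) (F : List (Σ i, BinTree (Node α) i)),
        IsForest l F →
        (∀ F', IsForest l F' → F'.map Sigma.fst = F.map Sigma.fst) ∧
        (∀ i k : ℕ, TreeAt F i k ↔
          RootAt l k ∧ (RootAt l (k + 2 ^ i) ∨ k + 2 ^ i = l.length / 3) ∧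
            (i ≠ 0 → NonRootAt l (k + 2 ^ (i - 1)))) ∧
        (∀ i : ℕ, (∃ p, TreeAt F i p) →
          ∃ k p : ℕ, 1 ≤ k ∧ k ≤ 5 ∧ p + 2 ^ i * k + (l.length / 3) % 2 ^ i = l.length / 3 ∧
            TreeAt F i p ∧ ∀ q, TreeAt F i q → q ≤ p) ∧
        (∀ i ≤ Nat.log 2 l.length, ∃ (s : State α) (t : ℕ),
          Exec (wordSize c l.length) dec (initState l i) s t 0 ∧ t ≤ C ∧
            s.word 0 = (F.map Sigma.fst).count i ∧
            ∀ j < s.word 0, TreeAt F i (s.word 1 + j * 2 ^ i))) := by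
  refine ⟨insertProg, extractMinProg, decodeProg, 10, costBound, ?_, ?_⟩
  · intro α _ l hl
    have hc := hl.canonical
    refine ⟨hc.exists_isForest, fun x hx => ?_, fun hne => ?_⟩
    · obtain ⟨l', t, m, hr, hp, ht, hm, hc'⟩ := hc.insertRun hx
      exact ⟨l', t, m, hr, hp, ht, hm, hc'.exists_isForest⟩
    · obtain ⟨x, l', t, m, hr, hx, hp, ht, hm, hc'⟩ := hc.extractRun hne
      exact ⟨x, l', t, m, hr, hx, hp, ht, hm, hc'.exists_isForest⟩
  · intro α _ l F hF
    exact ⟨fun F' hF' => hF.shape_unique hF',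
      fun i k => (treeAt_iff F i k).trans (hF.startsAt_iff i k),
      fun i hi => hF.exists_rightmost hi, fun i hi => hF.decode hi⟩
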